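/- Definitions. A tetraplectic structure on a $4m$-dimensional manifold $X$ (smooth, Hausdorff, second countable, without boundary) is a smooth closed $4$-form $\psi$ such that the $4m$-form $\psi^m=\psi\wedge\dots\wedge\psi$ vanishes nowhere. Let $Sp(1)$ be the group of unit quaternions, $\mathfrak s$ its Lie algebra (the imaginary quaternions), $\Sigma^n=Sp(1)^n$ (a spheroid, $n\ge 0$), and $\sigma_n=\mathfrak s^{\,n}$ its Lie algebra. Let $\Sigma^n$ act smoothly on a tetraplectic manifold $(X,\psi)$, preserving $\psi$; for $\beta\in\sigma_n$ let $\tilde\beta$ be the generated vector field, $\tilde\beta(x)=\frac{d}{dt}\big|_{0}\exp(t\beta)\cdot x$. The action is generalized hamiltonian if each $3$-form $i_{\tilde\beta}\psi$ is exact. In that case a tri-momentum map is a smooth map $\mu=(\mu_1,\dots,\mu_n):X\to(\wedge^3\mathfrak s^*)^n\simeq\mathbb R^n$ (identified by evaluation on the generator $\mathbf i\wedge\mathbf j\wedge\mathbf k$ of each summand $\wedge^3\mathfrak s$) such that 1. $\mu(a\cdot x)=\mu(x)$ for all $a\in\Sigma^n$, $x\in X$; 2. $d\mu_j=\psi(\tilde{\mathbf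 i}_j,\tilde{\mathbf j}_j,\tilde{\mathbf k}_j,\,\cdot\,)$ for $j=1,\dots,n$, where $\mathbf i_j,\mathbf j_j,\mathbf k_j$ is the standard basis of the $j$-th summand of $\sigma_n$; 3. for every $x\in X$ such that $\mu(x)$ is a regular value of $\mu$, $\ker T_x\mu=\{v\in T_xX:\ \psi_x(\tilde\alpha,\tilde\beta,\tilde\gamma,v)=0\ \text{for all }\alpha,\beta,\gamma\in\sigma_n\}$. Theorem. Let $\mu:X\to\mathbb R^n$ be a tri-momentum map for a generalized hamiltonian action of $\Sigma^n$ on a tetraplectic manifold $(X,\psi)$, let $\mathbf x\in\mathbb R^n$ be a regular value of $\mu$, and let $Z_{\mathbf x}=\mu^{-1}(\mathbf x)$. Assume that (a) the stabilizers of the points of $Z_{\mathbf x}$ form a smooth spheroid bundle: locally over $Z_{\mathbf x}$ there are $k\ge 0$ and a smooth map $\Phi:Z_{\mathbf x}\times\Sigma^k\to\Sigma^n$ such that each $\Phi(z,\cdot)$ is a group isomorphism of $\Sigma^k$ onto the stabilizer of $z$; (b) $\psi$ is horizontal on $Z_{\mathbf x}$: $i_{\tilde\beta}(\psi|_{Z_{\mathbf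 x}})=0$ for every $\beta\in\sigma_n$. Then $Z_{\mathbf x}$ is an embedded submanifold of $X$ of codimension $n$ (if nonempty), the reduced space $Y_{\mathbf x}=Z_{\mathbf x}/\Sigma^n$ with the quotient topology is a (Hausdorff, second countable) smooth manifold of dimension divisible by $4$ for which the projection $\pi:Z_{\mathbf x}\to Y_{\mathbf x}$ is a smooth submersion, and there is a tetraplectic structure $\psi_{\mathbf x}$ on $Y_{\mathbf x}$ with $\pi^*\psi_{\mathbf x}=\psi|_{Z_{\mathbf x}}$. -/

import Mathlib

open scoped Manifold ContDiff Quaternion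

namespace Tetraplectic

/-! ### Differential forms on a manifold modelled on `ℝᵈ` -/

/-- A (not necessarily smooth) differential `k`-form on a `d`-dimensional manifold `M`. -/
abbrev DForm (d k : ℕ) (M : Type*) [TopologicalSpace M]
    [ChartedSpace (EuclideanSpace ℝ (Fin d)) M] : Type _ :=
  ∀ x : M, TangentSpace (𝓡 d) x [⋀^Fin k]→L[ℝ] ℝ

section Forms

variable {d k : ℕ} {M : Type*} [TopologicalSpace M]
  [ChartedSpace (EuclideanSpace ℝ (Fin d)) M]

/-- The coordinate representation of a form in the preferred chart at `x₀`, that is, its pullback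
under the inverse of that chart (meaningful on the target of the chart). -/
noncomputable def DForm.inChart (θ : DForm d k M) (x₀ : M) :
    EuclideanSpace ℝ (Fin d) → EuclideanSpace ℝ (Fin d) [⋀^Fin k]→L[ℝ] ℝ :=
  fun y => (θ ((chartAt (EuclideanSpace ℝ (Fin d)) x₀).symm y)).compContinuousLinearMap
    (mfderiv (𝓡 d) (𝓡 d) (chartAt (EuclideanSpace ℝ (Fin d)) x₀).symm y)

/-- Smoothness of a form: its coordinate representations are smooth. -/
def DForm.IsSmooth (θ : DForm d k M) : Prop :=
  ∀ x₀ : M, ContDiffOn ℝ ∞ (θ.inChart x₀) (chartAt (EuclideanSpace ℝ (Fin d)) x₀).target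

/-- `dθ = 0`, computed in the charts. -/
def DForm.IsClosed (θ : DForm d k M) : Prop :=
  ∀ x₀ : M, ∀ y ∈ (chartAt (EuclideanSpace ℝ (Fin d)) x₀).target,
    extDeriv (θ.inChart x₀) y = 0

/-- `θ` is exact: `θ = dη` for some smooth form `η`. -/
def DForm.IsExact (θ : DForm d (k + 1) M) : Prop :=
  ∃ η : DForm d k M, η.IsSmooth ∧
    ∀ x₀ : M, ∀ y ∈ (chartAt (EuclideanSpace ℝ (Fin d)) x₀).target,
      extDeriv (η.inChart x₀) y = θ.inChart x₀ y

/-- The contraction `i_Y θ`, with `(i_Y θ)(v₁, …, v_k) = θ(Y, v₁, …, v_k)`. -/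
noncomputable def DForm.contract (θ : DForm d (k + 1) M)
    (Y : ∀ x : M, TangentSpace (𝓡 d) x) : DForm d k M :=
  fun x => (show EuclideanSpace ℝ (Fin d) [⋀^Fin (k + 1)]→L[ℝ] ℝ from θ x).curryLeft (Y x)

/-- The pullback `f^* θ` of a form under a map `f : N → M`. -/
noncomputable def DForm.pullback {e : ℕ} {N : Type*} [TopologicalSpace N]
    [ChartedSpace (EuclideanSpace ℝ (Fin e)) N] (f : N → M) (θ : DForm d k M) : DForm e k N :=
  fun z => (θ (f z)).compContinuousLinearMap (mfderiv (𝓡 e) (𝓡 d) f z)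

end Forms

/-- The value of the `m`-th exterior power `ψ ∧ ⋯ ∧ ψ` of an alternating `4`-form `ψ` on `4m`
vectors, which are indexed by `m` blocks of four:
`ψᵐ(v) = (4!)⁻ᵐ ∑_σ sgn(σ) ∏_i ψ(v_{σ(i,0)}, v_{σ(i,1)}, v_{σ(i,2)}, v_{σ(i,3)})`. -/
noncomputable def wedgePow {V : Type*} [AddCommGroup V] [Module ℝ V] [TopologicalSpace V]
    (ψ : V [⋀^Fin 4]→L[ℝ] ℝ) (m : ℕ) (v : Fin m × Fin 4 → V) : ℝ :=
  ((24 : ℝ)⁻¹) ^ m * ∑ σ : Equiv.Perm (Fin m × Fin 4),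
    ((Equiv.Perm.sign σ : ℤ) : ℝ) * ∏ i : Fin m, ψ (fun a => v (σ (i, a)))

/-- A tetraplectic structure on a `4m`-dimensional manifold: a smooth closed `4`-form `ψ` such
that the top degree form `ψᵐ` is a volume form, that is, vanishes nowhere. -/
structure IsTetraplectic {m : ℕ} {M : Type*} [TopologicalSpace M]
    [ChartedSpace (EuclideanSpace ℝ (Fin (4 * m))) M] (ψ : DForm (4 * m) 4 M) : Prop where
  smooth : ψ.IsSmooth
  closed : ψ.IsClosed
  volume : ∀ x : M, ∃ v : Fin m × Fin 4 → TangentSpace (𝓡 (4 * m)) x, wedgePow (ψ x) m v ≠ 0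

/-! ### Spheroids and their actions -/

/-- The spheroid `Σⁿ = Sp(1)ⁿ`, where `Sp(1)` is the group of unit quaternions. -/
abbrev Spheroid (n : ℕ) : Type := Fin n → Metric.sphere (0 : ℍ[ℝ]) 1

instance fact_finrank_quaternion : Fact (Module.finrank ℝ ℍ[ℝ] = 3 + 1) :=
  ⟨Quaternion.finrank_eq_four⟩

/-- The model with corners of the manifold `Σⁿ = S³ × ⋯ × S³`. -/
noncomputable abbrev spheroidModel (n : ℕ) :=
  ModelWithCorners.pi (𝕜 := ℝ) (fun _ : Fin n => 𝓡 3)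

/-- The Lie algebra `𝔰 = 𝔰𝔭₁` of `Sp(1)`: the imaginary quaternions. -/
def imQuaternion : Submodule ℝ ℍ[ℝ] where
  carrier := {q | q.re = 0}
  add_mem' := by
    intro a b ha hb
    simp only [Set.mem_ofPred_eq] at ha hb ⊢
    simp [ha, hb]
  zero_mem' := by simp
  smul_mem' := by
    intro c a ha
    simp only [Set.mem_ofPred_eq] at ha ⊢
    simp [ha]

/-- The Lie algebra `σₙ = 𝔰ⁿ` of the spheroid `Σⁿ`. -/
abbrev SpheroidLie (n : ℕ) : Type := Fin n → imQuaternion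

theorem exp_mem_sphere (q : imQuaternion) :
    NormedSpace.exp (q : ℍ[ℝ]) ∈ Metric.sphere (0 : ℍ[ℝ]) 1 := by
  have h : (q : ℍ[ℝ]).re = 0 := q.2
  rw [mem_sphere_zero_iff_norm, Quaternion.norm_exp, h]
  simp

/-- The exponential map `σₙ → Σⁿ`. -/
noncomputable def spheroidExp {n : ℕ} (β : SpheroidLie n) : Spheroid n :=
  fun j => ⟨NormedSpace.exp (β j : ℍ[ℝ]), exp_mem_sphere (β j)⟩

/-- The basis `𝐢, 𝐣, 𝐤` of `𝔰`. -/
noncomputable def imBasis : Fin 3 → imQuaternion :=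
  ![⟨⟨0, 1, 0, 0⟩, rfl⟩, ⟨⟨0, 0, 1, 0⟩, rfl⟩, ⟨⟨0, 0, 0, 1⟩, rfl⟩]

/-- The element `𝐢`, `𝐣` or `𝐤` of the `j`-th summand `𝔰` of `σₙ`. -/
noncomputable def lieBasis {n : ℕ} (j : Fin n) (a : Fin 3) : SpheroidLie n := Pi.single j (imBasis a)

section Action

variable {d n : ℕ} {X : Type*} [TopologicalSpace X]
  [ChartedSpace (EuclideanSpace ℝ (Fin d)) X] [MulAction (Spheroid n) X]

/-- The vector field on `X` generated by `β ∈ σₙ`: `x ↦ d/dt|₀ exp(tβ) • x`. -/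
noncomputable def fundField (β : SpheroidLie n) (x : X) : TangentSpace (𝓡 d) x :=
  mfderiv 𝓘(ℝ, ℝ) (𝓡 d) (fun t : ℝ => spheroidExp (t • β) • x) 0 (1 : ℝ)

variable (d n X) in
/-- The action `Σⁿ × X → X` is smooth. -/
def IsSmoothAction : Prop :=
  ContMDiff ((spheroidModel n).prod (𝓡 d)) (𝓡 d) ∞
    (fun p : Spheroid n × X => p.1 • p.2)

/-- The action preserves `ψ`: every `g ∈ Σⁿ` satisfies `g^* ψ = ψ`. -/
def IsInvariantForm (ψ : DForm d 4 X) : Prop :=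
  ∀ g : Spheroid n, ψ.pullback (fun x : X => g • x) = ψ

/-- The action is (generalized) hamiltonian: for each generating vector field `β~`, the
`3`-form `i_{β~} ψ` is exact. -/
def IsHamiltonianAction (n : ℕ) [MulAction (Spheroid n) X] (ψ : DForm d 4 X) : Prop :=
  ∀ β : SpheroidLie n, (ψ.contract (fundField β)).IsExact

/-- The derivative of `μ : X → ℝⁿ` at `x`, as a linear map `T_x X → ℝⁿ`. -/
noncomputable def tangentMap (μ : X → EuclideanSpace ℝ (Fin n)) (x : X) :
    TangentSpace (𝓡 d) x →L[ℝ] EuclideanSpace ℝ (Fin n) :=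
  mfderiv (𝓡 d) 𝓘(ℝ, EuclideanSpace ℝ (Fin n)) μ x

variable (d) in
/-- `c` is a regular value of `μ`. -/
def IsRegularValue (μ : X → EuclideanSpace ℝ (Fin n)) (c : EuclideanSpace ℝ (Fin n)) : Prop :=
  ∀ x : X, μ x = c → Function.Surjective (tangentMap (d := d) μ x)

/-- `μ : X → (⋀³𝔰*)ⁿ ≃ ℝⁿ` is a tri-momentum map for a generalized hamiltonian action of `Σⁿ`
on `(X, ψ)`. The identification `(⋀³𝔰*)ⁿ ≃ ℝⁿ` is given by evaluation on
the generators `δ_j = 𝐢 ∧ 𝐣 ∧ 𝐤` of the summands `⋀³𝔰`. -/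
structure IsTriMomentumMap (ψ : DForm d 4 X) (μ : X → EuclideanSpace ℝ (Fin n)) : Prop where
  hamiltonian : IsHamiltonianAction n ψ
  smooth : ContMDiff (𝓡 d) 𝓘(ℝ, EuclideanSpace ℝ (Fin n)) ∞ μ
  invariant : ∀ (a : Spheroid n) (x : X), μ (a • x) = μ x
  /-- `d(μ, δ) = i_{δ~} ψ` for the generators `δ = δ_j`, hence for all `δ ∈ (⋀³𝔰)ⁿ`. -/
  momentum : ∀ (j : Fin n) (x : X) (v : TangentSpace (𝓡 d) x),
    tangentMap μ x v j =
      ψ x ![fundField (lieBasis j 0) x, fundField (lieBasis j 1) x, fundField (lieBasis j 2) x, v]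
  /-- `Ker T_x μ` is the `ψ_x`-orthogonal of `⋀³σₙ . x` whenever `μ(x)` is a regular value. -/
  kernel : ∀ x : X, IsRegularValue d μ (μ x) → ∀ v : TangentSpace (𝓡 d) x,
    tangentMap μ x v = 0 ↔
      ∀ α β γ : SpheroidLie n, ψ x ![fundField α x, fundField β x, fundField γ x, v] = 0

/-- The level set `Z_c = μ⁻¹(c)`, with the subspace topology. -/
abbrev LevelSet (μ : X → EuclideanSpace ℝ (Fin n)) (c : EuclideanSpace ℝ (Fin n)) :=
  {x : X // μ x = c}

/-- The reduced space `Z_c / Σⁿ` (points of `Z_c` are identified when they lie in the same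
`Σⁿ`-orbit), with the quotient topology. -/
abbrev ReducedSpace (μ : X → EuclideanSpace ℝ (Fin n)) (c : EuclideanSpace ℝ (Fin n)) :=
  Quotient ((MulAction.orbitRel (Spheroid n) X).comap (Subtype.val : LevelSet μ c → X))

/-- The projection `Z_c → Z_c / Σⁿ`. -/
noncomputable def reductionMap (μ : X → EuclideanSpace ℝ (Fin n)) (c : EuclideanSpace ℝ (Fin n)) :
    LevelSet μ c → ReducedSpace μ c :=
  Quotient.mk _

/-- The inclusion `Z_c → X`. -/
def inclusionMap (μ : X → EuclideanSpace ℝ (Fin n)) (c : EuclideanSpace ℝ (Fin n)) :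
    LevelSet μ c → X :=
  Subtype.val

/-- The stabilizers of the points of `Z_c` form a smooth spheroid bundle over `Z_c`: locally over
`Z_c` there is a smooth map `Φ : Z_c × Σᵏ → Σⁿ` (given as the restriction of a smooth map on an
open subset of `X` times `Σᵏ`) such that each `Φ(z, ·)` is an isomorphism of the group `Σᵏ` onto
the stabilizer of `z`. -/
def StabilizersFormSpheroidBundle (μ : X → EuclideanSpace ℝ (Fin n))
    (c : EuclideanSpace ℝ (Fin n)) : Prop :=
  ∀ z₀ : X, μ z₀ = c → ∃ (k : ℕ) (U : Set X) (Φ : X × Spheroid k → Spheroid n),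
    IsOpen U ∧ z₀ ∈ U ∧
    ContMDiffOn ((𝓡 d).prod (spheroidModel k)) (spheroidModel n) ∞ Φ (U ×ˢ Set.univ) ∧
    ∀ z ∈ U, μ z = c → ∃ φ : Spheroid k →* Spheroid n,
      (∀ g, φ g = Φ (z, g)) ∧ Function.Injective φ ∧
        φ.range = MulAction.stabilizer (Spheroid n) z

/-- `ψ` is horizontal on `Z_c`: `i_{β~} (ψ|_{Z_c}) = 0` for all `β ∈ σₙ`. Here `c` is a regular
value, so that `T_z Z_c = Ker T_z μ`. -/
def IsHorizontalOn (ψ : DForm d 4 X) (μ : X → EuclideanSpace ℝ (Fin n))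
    (c : EuclideanSpace ℝ (Fin n)) : Prop :=
  ∀ z : X, μ z = c → ∀ (β : SpheroidLie n) (u v w : TangentSpace (𝓡 d) z),
    tangentMap μ z u = 0 → tangentMap μ z v = 0 → tangentMap μ z w = 0 →
      ψ z ![fundField β z, u, v, w] = 0

end Action

end Tetraplectic

/-! The heart of the matter is that the action on `Z = μ⁻¹(c)` is free; after that the reduction
follows the symplectic pattern, with a counting argument for the volume form.

Freeness. Near `Z` the map `μ` is open, and its regular values are dense by Sard's theorem. At a
point with regular value the generating fields lie in the kernel of `dμ`, so the kernel condition
makes `ψ` vanish on any four of them; by continuity this holds on a whole neighbourhood of each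
point of `Z` (`IsTriMomentumMap.eventually_formAt_infAct`). Expanding `dψ = 0` on four generating
fields and a vector `v` then shows that the `3`-form `B = i_v ψ`, restricted to the infinitesimal
orbit, satisfies `B([x,y],z,w) + B([z,w],x,y) = 0` whenever `x, y` commute with `z, w`
(`IsSmoothAction.cocycle_identity`). Consequently, for a Lie algebra homomorphism `ρ : 𝔰 → σₙ` with
components `ρ_j`, the mixed terms of `B(ρ𝐢, ρ𝐣, ρ𝐤)` cancel and what remains is `∑ |ρ_j 𝐢|² B(𝐢_j,
𝐣_j, 𝐤_j)` (`IsCommCocycle.map_lie_hom`). If the stabilizer of `z` contained a factor `Sp(1)`, its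
differential `ρ` would generate fields vanishing at `z`, so the left side would be zero, while the
right side is `-∑ |ρ_j 𝐢|² dμ_j(v)`. Surjectivity of `dμ` forces every `ρ_j 𝐢` to vanish, contrary
to injectivity. Hence stabilizers are trivial (`eq_one_of_smul_eq`).

Quotient. A free smooth action of a compact group has slices (`exists_slice`), which serve as charts
of `Z/Σⁿ`; compactness makes the quotient Hausdorff. Freeness also gives `3n ≤ 4m - n`, so the
quotient of a nonempty `Z` has dimension `4(m - n)`.

Form. Horizontality and invariance let `ψ|_Z` descend (`exists_reduced_form_at`). In a chart the
descended form is the pullback of `ψ` along a local section, hence smooth and closed. For the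
volume, take a basis of `T_z X` made of `3n` orbit vectors, `n` vectors transverse to `Z`, and `4(m
- n)` others tangent to `Z`. A factor of `ψᵐ` containing an orbit vector vanishes unless it also
contains a transverse one; counting shows that the orbit and transverse vectors fill exactly `n`
factors, so `ψ^(m-n)` is nonzero on the rest (`exists_wedgePow_ne_zero_of_basis`). -/

namespace Tetraplectic

open Set Filter Topology MeasureTheory Module

universe u v

/-! ### Inverse functions and parametrized level sets. -/

section Calculus

variable {E : Type u} [NormedAddCommGroup E] [NormedSpace ℝ E] [FiniteDimensional ℝ E]
  {F : Type v} [NormedAddCommGroup F] [NormedSpace ℝ F]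

/-- The inverse function theorem, with smoothness of the inverse on a neighbourhood. -/
theorem exists_local_inverse {f : E → F} {a : E} (hf : ∀ᶠ x in 𝓝 a, ContDiffAt ℝ ∞ f x)
    (hbij : Function.Bijective (fderiv ℝ f a)) :
    ∃ g : F → E, (∀ᶠ y in 𝓝 (f a), ContDiffAt ℝ ∞ g y) ∧ g (f a) = a ∧
      (∀ᶠ x in 𝓝 a, g (f x) = x) ∧ ∀ᶠ y in 𝓝 (f a), f (g y) = y := by
  have hfa := hf.self_of_nhds
  let e : E ≃L[ℝ] F := (LinearEquiv.ofBijective (fderiv ℝ f a : E →ₗ[ℝ] F) hbij).toContinuousLinearEquiv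
  have he : (e : E →L[ℝ] F) = fderiv ℝ f a := by ext x; rfl
  have hd : HasFDerivAt f (e : E →L[ℝ] F) a := by
    rw [he]; exact (hfa.differentiableAt (by simp)).hasFDerivAt
  let Φ := hfa.toOpenPartialHomeomorph f hd (by simp)
  have hsrc : a ∈ Φ.source := hfa.mem_toOpenPartialHomeomorph_source hd (by simp)
  have htgt : f a ∈ Φ.target := hfa.image_mem_toOpenPartialHomeomorph_target hd (by simp)
  have hcoe : (Φ : E → F) = f := rfl
  have hsymm : Φ.symm (f a) = a := Φ.left_inv hsrc
  refine ⟨Φ.symm, ?_, hsymm, Φ.eventually_left_inverse hsrc, Φ.eventually_right_inverse htgt⟩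
  -- Invertible operators form an open set and the derivative is continuous, so the derivative stays
  -- invertible near `a`; the inverse is smooth at the images of such points.
  have hinv : ∀ᶠ x in 𝓝 a, ∃ e' : E ≃L[ℝ] F, (e' : E →L[ℝ] F) = fderiv ℝ f x := by
    have hc : ContinuousAt (fderiv ℝ f) a :=
      (hfa.fderiv_right (m := 0) (by simp)).continuousAt
    have h := e.nhds
    rw [he] at h
    exact hc h
  have hcont : Tendsto Φ.symm (𝓝 (f a)) (𝓝 a) := by
    have := Φ.symm.continuousAt (x := f a) htgt
    rwa [ContinuousAt, hsymm] at this
  filter_upwards [hcont.eventually (hf.and hinv), Φ.open_target.mem_nhds htgt] with y hy hyt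
  obtain ⟨h1, e', he'⟩ := hy
  refine Φ.contDiffAt_symm (f₀' := e') hyt ?_ h1
  rw [he']
  exact (h1.differentiableAt (by simp)).hasFDerivAt

/-- A level set of a smooth map with surjective derivative is locally parametrized by the kernel
of the derivative. -/
theorem exists_level_param {f : E → F} {x : E} (hf : ∀ᶠ y in 𝓝 x, ContDiffAt ℝ ∞ f y)
    (hsurj : Function.Surjective (fderiv ℝ f x)) :
    ∃ (O : Set (fderiv ℝ f x).ker) (p : (fderiv ℝ f x).ker → E)
      (l : E →L[ℝ] (fderiv ℝ f x).ker), IsOpen O ∧ ContDiffOn ℝ ∞ p O ∧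
      (∀ u ∈ O, f (p u) = f x) ∧ ∀ᶠ y in 𝓝 x, f y = f x → l y ∈ O ∧ p (l y) = y := by
  set K := (fderiv ℝ f x).ker
  obtain ⟨l, hl⟩ := K.exists_isCompl
  let π : E →L[ℝ] K := (K.projectionOnto l hl).toContinuousLinearMap
  have hπK : ∀ k : K, π k = k := fun k => Submodule.projectionOnto_apply_left hl k
  -- Completing `f` by a projection onto the kernel gives an invertible derivative; the inverse of
  -- `N`, restricted to `{f x} × K`, parametrizes the level set.
  let N : E → F × K := fun y => (f y, π y)
  have hN : ∀ᶠ y in 𝓝 x, ContDiffAt ℝ ∞ N y := by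
    filter_upwards [hf] with y hy
    exact hy.prodMk π.contDiff.contDiffAt
  have hfx := hf.self_of_nhds.differentiableAt (by simp)
  have hdN : fderiv ℝ N x = (fderiv ℝ f x).prod π :=
    (hfx.hasFDerivAt.prodMk π.hasFDerivAt).fderiv
  have hbij : Function.Bijective (fderiv ℝ N x) := by
    rw [hdN]
    constructor
    · refine (injective_iff_map_eq_zero _).2 fun v hv => ?_
      rw [ContinuousLinearMap.prod_apply, Prod.mk_eq_zero] at hv
      have h := congrArg Subtype.val (hπK ⟨v, hv.1⟩)
      simpa [hv.2] using h.symm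
    · rintro ⟨b, k⟩
      obtain ⟨v, hv⟩ := hsurj b
      have h0 : ∀ k : K, fderiv ℝ f x k = 0 := fun k => k.2
      refine ⟨v + ((k - π v : K) : E), ?_⟩
      rw [ContinuousLinearMap.prod_apply, map_add, map_add, h0, hπK, hv]
      simp
  obtain ⟨g, hg, -, hgl, hgr⟩ := exists_local_inverse hN hbij
  have hin : Tendsto (fun u : K => (f x, u)) (𝓝 (π x)) (𝓝 (N x)) :=
    (Continuous.prodMk_right (f x)).tendsto (π x)
  have hev := hin.eventually (hg.and hgr)
  obtain ⟨O, hO, hOo, hxO⟩ := eventually_nhds_iff.1 hev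
  refine ⟨O, fun u => g (f x, u), π, hOo, fun u hu => ?_, fun u hu => ?_, ?_⟩
  · exact ((hO u hu).1.comp u (contDiffAt_const.prodMk contDiffAt_id)).contDiffWithinAt
  · exact congrArg Prod.fst (hO u hu).2
  · filter_upwards [hgl, π.continuous.continuousAt (hOo.mem_nhds hxO)] with y hy hyO hfy
    refine ⟨hyO, ?_⟩
    rw [← hfy]; exact hy

end Calculus

/-! ### Sard's theorem for real functions. -/

section Sard

variable {E : Type} [NormedAddCommGroup E] [NormedSpace ℝ E]

/-- Taylor estimate for a function that is flat at `x`. -/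
theorem norm_le_of_flat (k : ℕ) : ∀ {G : Type} [NormedAddCommGroup G] [NormedSpace ℝ G]
    (g : E → G) (V : Set E) (x : E) (M : ℝ), IsOpen V → Convex ℝ V → ContDiffOn ℝ ∞ g V →
    (∀ y ∈ V, ‖iteratedFDeriv ℝ k g y‖ ≤ M) → x ∈ V →
    (∀ i < k, iteratedFDeriv ℝ i g x = 0) → ∀ y ∈ V, ‖g y‖ ≤ M * ‖y - x‖ ^ k := by
  induction k with
  | zero =>
    intro G _ _ g V x M _ _ _ hM _ _ y hy
    simpa using hM y hy
  | succ k ih =>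
    intro G _ _ g V x M hV hVc hg hM hx h0 y hy
    have hM0 : 0 ≤ M := (norm_nonneg _).trans (hM x hx)
    -- The derivative is flat to one order less, so it is bounded by `M ‖y - x‖ ^ k`; the mean value
    -- inequality on the segment supplies the missing power.
    have hd := ih (fderiv ℝ g) V x M hV hVc (hg.fderiv_of_isOpen hV (by simp))
      (fun y hy => by rw [norm_iteratedFDeriv_fderiv]; exact hM y hy) hx
      (fun i hi => by
        rw [← norm_eq_zero, norm_iteratedFDeriv_fderiv, h0 (i + 1) (by omega), norm_zero])
    have hgx : g x = 0 := by
      have := h0 0 (by omega)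
      rw [← norm_eq_zero, norm_iteratedFDeriv_zero] at this
      simpa using this
    have hseg : segment ℝ x y ⊆ V := hVc.segment_subset hx hy
    have := (convex_segment x y).norm_image_sub_le_of_norm_fderiv_le (𝕜 := ℝ) (f := g)
      (C := M * ‖y - x‖ ^ k) (x := x) (y := y)
      (fun z hz => (hg.contDiffAt (hV.mem_nhds (hseg hz))).differentiableAt (by simp))
      (fun z hz => (hd z (hseg hz)).trans ?_) (left_mem_segment ℝ x y) (right_mem_segment ℝ x y)
    · rw [hgx, sub_zero] at this
      rw [pow_succ, ← mul_assoc]; exact this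
    · gcongr
      obtain ⟨a, b, ha, hb, hab, rfl⟩ := hz
      have : a • x + b • y - x = b • (y - x) := by
        rw [← eq_sub_iff_add_eq] at hab; rw [hab]; module
      rw [this, norm_smul, Real.norm_of_nonneg hb]
      exact mul_le_of_le_one_left (norm_nonneg _) (by linarith)

/-- The image of a set is null if it is locally null. -/
theorem volume_image_null_of_locally {X : Type*} [TopologicalSpace X] [SecondCountableTopology X]
    (f : X → ℝ) (s : Set X) (h : ∀ x ∈ s, ∃ u ∈ 𝓝 x, volume (f '' (s ∩ u)) = 0) :
    volume (f '' s) = 0 := by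
  have := measure_null_of_locally_null (μ := OuterMeasure.comap f (volume : Measure ℝ).toOuterMeasure)
    s fun x hx => by
      obtain ⟨u, hu, h0⟩ := h x hx
      exact ⟨s ∩ u, inter_mem_nhdsWithin s hu, by simpa using h0⟩
  simpa using this

variable [FiniteDimensional ℝ E]

/-- The points of `U` where the derivatives of `f` of order `1, …, k` vanish. -/
def flatSet (f : E → ℝ) (U : Set E) (k : ℕ) : Set E :=
  {x ∈ U | ∀ i, 1 ≤ i → i ≤ k → iteratedFDeriv ℝ i f x = 0}

/-- By Taylor's estimate `f` is locally Hölder of exponent `N + 1` on this set, with `N` the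
dimension. The image thus has Hausdorff dimension at most `N / (N + 1) < 1`, and so length zero. -/
theorem volume_image_flatSet {f : E → ℝ} {U : Set E} (hU : IsOpen U)
    (hf : ContDiffOn ℝ ∞ f U) : volume (f '' flatSet f U (finrank ℝ E)) = 0 := by
  set N := finrank ℝ E
  have key : dimH (f '' flatSet f U N) ≤ dimH (flatSet f U N) / ((N + 1 : ℕ) : NNReal) := by
    refine dimH_image_le_of_locally_holder_on (by positivity) fun x hx => ?_
    have hc : ContinuousAt (iteratedFDeriv ℝ (N + 1) f) x :=
      (hf.contDiffAt (hU.mem_nhds hx.1)).iteratedFDeriv_right (m := 0) (i := N + 1)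
        (by rw [zero_add]; exact_mod_cast le_top) |>.continuousAt
    set M := ‖iteratedFDeriv ℝ (N + 1) f x‖ + 1
    have hev : ∀ᶠ y in 𝓝 x, ‖iteratedFDeriv ℝ (N + 1) f y‖ < M :=
      hc.norm.eventually_lt_const (lt_add_one _)
    obtain ⟨r, hr, hball⟩ := Metric.eventually_nhds_iff_ball.1 (hev.and (hU.mem_nhds hx.1))
    have hM : 0 ≤ M := by positivity
    refine ⟨M.toNNReal, flatSet f U N ∩ Metric.ball x r,
      inter_mem_nhdsWithin _ (Metric.ball_mem_nhds x hr), ?_⟩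
    intro a ha b hb
    have hfB : ContDiffOn ℝ ∞ f (Metric.ball x r) := hf.mono fun y hy => (hball y hy).2
    have hsub : ∀ y, 0 < N + 1 → ∀ i, 1 ≤ i → ∀ z ∈ Metric.ball x r,
        iteratedFDeriv ℝ i (fun t => f t - f y) z = iteratedFDeriv ℝ i f z := by
      intro y _ i hi z hz
      have h1 := (hfB.contDiffAt (Metric.isOpen_ball.mem_nhds hz)).of_le (m := i)
        (by exact_mod_cast le_top)
      have := iteratedFDeriv_sub_apply (𝕜 := ℝ) (i := i) (f := f) (g := fun _ => f y) (x := z) h1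
        contDiffAt_const
      have hc0 : iteratedFDeriv ℝ i (fun _ : E => f y) z = 0 := by
        rw [iteratedFDeriv_const_of_ne (by omega)]; rfl
      rw [hc0, sub_zero] at this
      exact this
    have h := norm_le_of_flat (N + 1) (fun y => f y - f b) (Metric.ball x r) b M
      Metric.isOpen_ball (convex_ball x r) (hfB.sub contDiffOn_const)
      (fun y hy => by rw [hsub b (by omega) _ (by omega) y hy]; exact (hball y hy).1.le) hb.2
      (fun i hi => by
        rcases Nat.eq_zero_or_pos i with rfl | hpos
        · rw [← norm_eq_zero, norm_iteratedFDeriv_zero]; simp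
        · rw [hsub b (by omega) _ hpos b hb.2]; exact hb.1.2 i hpos (by omega)) a ha.2
    rw [edist_nndist, edist_nndist, ← ENNReal.coe_rpow_of_nonneg _ (by positivity),
      ← ENNReal.coe_mul, ENNReal.coe_le_coe, ← NNReal.coe_le_coe]
    push_cast
    rw [Real.coe_toNNReal M hM, ← Nat.cast_succ, Real.rpow_natCast, dist_eq_norm, dist_eq_norm]
    exact h
  have h1 : dimH (f '' flatSet f U N) < (1 : NNReal) := by
    refine key.trans_lt ?_
    have hle : dimH (flatSet f U N) ≤ N := by
      refine (dimH_mono (subset_univ _)).trans ?_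
      rw [Real.dimH_univ_eq_finrank]
    refine (ENNReal.div_le_div_right hle _).trans_lt ?_
    rw [ENNReal.div_lt_iff (by simp) (by simp)]
    simp only [ENNReal.coe_one, one_mul]
    exact_mod_cast Nat.lt_succ_self N
  have := hausdorffMeasure_of_dimH_lt h1
  rw [NNReal.coe_one, hausdorffMeasure_real] at this
  exact this

/-- **Sard's theorem** for real valued functions. -/
theorem volume_critical_values (N : ℕ) : ∀ {E : Type} [NormedAddCommGroup E] [NormedSpace ℝ E]
    [FiniteDimensional ℝ E], finrank ℝ E = N → ∀ (f : E → ℝ) (U : Set E), IsOpen U →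
    ContDiffOn ℝ ∞ f U → volume (f '' {x ∈ U | fderiv ℝ f x = 0}) = 0 := by
  induction N using Nat.strong_induction_on with
  | _ N ih =>
  intro E _ _ _ hN f U hU hf
  have hone : ∀ x, iteratedFDeriv ℝ 1 f x = 0 ↔ fderiv ℝ f x = 0 := fun x => by
    rw [← norm_eq_zero, norm_iteratedFDeriv_one, norm_eq_zero]
  -- A critical point is either flat to order `N`, or flat to a last order `k ≥ 1`.
  have hcover : {x ∈ U | fderiv ℝ f x = 0} ⊆ flatSet f U N ∪
      ⋃ k : ℕ, if 1 ≤ k then flatSet f U k \ flatSet f U (k + 1) else ∅ := by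
    rintro x ⟨hxU, hx⟩
    by_cases h : x ∈ flatSet f U N
    · exact Or.inl h
    right
    have hex : ∃ k, x ∉ flatSet f U k := ⟨N, h⟩
    classical
    have hk := Nat.find_spec hex
    set k := Nat.find hex
    have hk2 : 2 ≤ k := by
      by_contra hlt
      exact hk ⟨hxU, fun i h1 h2 => by
        obtain rfl : i = 1 := by omega
        exact (hone x).2 hx⟩
    refine mem_iUnion.2 ⟨k - 1, ?_⟩
    rw [if_pos (by omega), show k - 1 + 1 = k by omega]
    exact ⟨not_not.1 (Nat.find_min hex (by omega : k - 1 < k)), hk⟩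
  refine measure_mono_null (image_mono hcover) ?_
  rw [image_union, image_iUnion]
  refine measure_union_null (by rw [← hN]; exact volume_image_flatSet hU hf)
    (measure_iUnion_null fun k => ?_)
  split_ifs with hk
  swap; · simp
  refine volume_image_null_of_locally _ _ ?_
  rintro x ⟨hx, hx'⟩
  have hne : iteratedFDeriv ℝ (k + 1) f x ≠ 0 := fun h0 => hx' ⟨hx.1, fun i h1 h2 => by
    rcases Nat.lt_or_ge k i with h | h
    · obtain rfl : i = k + 1 := by omega
      exact h0
    · exact hx.2 i h1 h⟩
  have hsm : ∀ y ∈ U, ContDiffAt ℝ ∞ (iteratedFDeriv ℝ k f) y := fun y hy =>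
    (hf.contDiffAt (hU.mem_nhds hy)).iteratedFDeriv_right (by
      exact_mod_cast (le_of_eq (by simp)))
  have hne2 : fderiv ℝ (iteratedFDeriv ℝ k f) x ≠ 0 := by
    intro h0
    refine hne (norm_eq_zero.1 ?_)
    rw [← norm_fderiv_iteratedFDeriv, h0]
    exact norm_zero (E := E →L[ℝ] E [×k]→L[ℝ] ℝ)
  obtain ⟨v, hv⟩ := DFunLike.ne_iff.1 hne2
  obtain ⟨m, hm⟩ := DFunLike.ne_iff.1 hv
  -- `w` is a component of the `k`-th derivative whose differential at `x` is nonzero. It vanishes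
  -- on `flatSet f U k`, so near `x` that set lies in a hypersurface parametrized by `p`, where its
  -- points are critical for `f ∘ p`; the induction hypothesis applies in the smaller dimension.
  let ev := ContinuousMultilinearMap.apply ℝ (fun _ : Fin k => E) ℝ m
  let w : E → ℝ := fun y => ev (iteratedFDeriv ℝ k f y)
  have hw : ∀ᶠ y in 𝓝 x, ContDiffAt ℝ ∞ w y := by
    filter_upwards [hU.mem_nhds hx.1] with y hy
    exact ev.contDiff.contDiffAt.comp y (hsm y hy)
  have hdw : fderiv ℝ w x = ev.comp (fderiv ℝ (iteratedFDeriv ℝ k f) x) :=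
    (ev.hasFDerivAt.comp x ((hsm x hx.1).differentiableAt (by simp)).hasFDerivAt).fderiv
  have hdw0 : fderiv ℝ w x v ≠ 0 := by rw [hdw]; exact hm
  have hsurj : Function.Surjective (fderiv ℝ w x) := fun t =>
    ⟨(t / fderiv ℝ w x v) • v, by rw [map_smul, smul_eq_mul, div_mul_cancel₀ _ hdw0]⟩
  obtain ⟨O, p, l, hO, hp, hwp, hl⟩ := exists_level_param hw hsurj
  have hlt : finrank ℝ (fderiv ℝ w x).ker < N := by
    have h := (fderiv ℝ w x : E →ₗ[ℝ] ℝ).finrank_range_add_finrank_ker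
    have h2 : finrank ℝ (fderiv ℝ w x : E →ₗ[ℝ] ℝ).range = 1 := by
      rw [LinearMap.range_eq_top.2 hsurj]; simp
    have h3 : finrank ℝ (fderiv ℝ w x).ker = finrank ℝ (fderiv ℝ w x : E →ₗ[ℝ] ℝ).ker := rfl
    omega
  have hO' : IsOpen (O ∩ p ⁻¹' U) := hp.continuousOn.isOpen_inter_preimage hO hU
  have hnull := ih _ hlt rfl (f ∘ p) (O ∩ p ⁻¹' U) hO'
    (hf.comp (hp.mono inter_subset_left) inter_subset_right)
  refine ⟨_, hl, measure_mono_null ?_ hnull⟩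
  rintro _ ⟨y, ⟨⟨hy, -⟩, hyl⟩, rfl⟩
  have hz : ∀ z ∈ flatSet f U k, w z = 0 := fun z hz => by
    change iteratedFDeriv ℝ k f z m = 0
    rw [hz.2 k hk le_rfl]; rfl
  obtain ⟨hyO, hpy⟩ := hyl (by rw [hz y hy, hz x hx])
  refine ⟨l y, ⟨⟨hyO, ?_⟩, ?_⟩, by simp [hpy]⟩
  · change p (l y) ∈ U
    rw [hpy]; exact hy.1
  · have h1 : DifferentiableAt ℝ f (p (l y)) := by
      rw [hpy]; exact (hf.contDiffAt (hU.mem_nhds hy.1)).differentiableAt (by simp)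
    have h2 : DifferentiableAt ℝ p (l y) :=
      (hp.contDiffAt (hO.mem_nhds hyO)).differentiableAt (by simp)
    rw [fderiv_comp _ h1 h2, hpy, (hone y).1 (hy.2 1 le_rfl hk), ContinuousLinearMap.zero_comp]

end Sard

end Tetraplectic

/-! ### Derivatives in charts, and density of regular values. -/

namespace Tetraplectic

open Set Filter Topology MeasureTheory Module

section MDer

variable {E : Type*} [NormedAddCommGroup E] [NormedSpace ℝ E] {H : Type*} [TopologicalSpace H]
  (I : ModelWithCorners ℝ E H) {M : Type*} [TopologicalSpace M] [ChartedSpace H M]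
  {E' : Type*} [NormedAddCommGroup E'] [NormedSpace ℝ E'] {H' : Type*} [TopologicalSpace H']
  (I' : ModelWithCorners ℝ E' H') {M' : Type*} [TopologicalSpace M'] [ChartedSpace H' M']
  {E'' : Type*} [NormedAddCommGroup E''] [NormedSpace ℝ E''] {H'' : Type*} [TopologicalSpace H'']
  (I'' : ModelWithCorners ℝ E'' H'') {M'' : Type*} [TopologicalSpace M''] [ChartedSpace H'' M'']

/-- The derivative of a map of manifolds, as a linear map between the model vector spaces. -/
noncomputable def mder (f : M → M') (x : M) : E →L[ℝ] E' := mfderiv I I' f x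

variable {I I' I''}

theorem mder_comp {f : M → M'} {g : M' → M''} (x : M) (hg : MDifferentiableAt I' I'' g (f x))
    (hf : MDifferentiableAt I I' f x) :
    mder I I'' (g ∘ f) x = (mder I' I'' g (f x)).comp (mder I I' f x) :=
  mfderiv_comp x hg hf

theorem mder_comp_apply {f : M → M'} {g : M' → M''} (x : M)
    (hg : MDifferentiableAt I' I'' g (f x)) (hf : MDifferentiableAt I I' f x) (v : E) :
    mder I I'' (g ∘ f) x v = mder I' I'' g (f x) (mder I I' f x v) := by
  rw [mder_comp x hg hf]; rfl

theorem mder_congr {f g : M → M'} {x : M} (h : f =ᶠ[𝓝 x] g) : mder I I' f x = mder I I' g x :=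
  h.mfderiv_eq

theorem mder_const (x : M) (c : M') : mder I I' (fun _ : M => c) x = 0 :=
  mfderiv_const

theorem mder_eq_fderiv (f : E → E') (x : E) : mder 𝓘(ℝ, E) 𝓘(ℝ, E') f x = fderiv ℝ f x :=
  mfderiv_eq_fderiv

end MDer

section Charts

variable {d : ℕ} {X : Type*} [TopologicalSpace X] [ChartedSpace (EuclideanSpace ℝ (Fin d)) X]
  [IsManifold (𝓡 d) ∞ X]
  {V : Type*} [NormedAddCommGroup V] [NormedSpace ℝ V]

theorem contMDiffAt_chart_symm (x : X) {y : EuclideanSpace ℝ (Fin d)}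
    (hy : y ∈ (chartAt (EuclideanSpace ℝ (Fin d)) x).target) :
    ContMDiffAt (𝓡 d) (𝓡 d) ∞ (chartAt (EuclideanSpace ℝ (Fin d)) x).symm y :=
  (contMDiffOn_chart_symm (I := 𝓡 d) (x := x)).contMDiffAt
    ((chartAt (EuclideanSpace ℝ (Fin d)) x).open_target.mem_nhds hy)

theorem contMDiffAt_chart (x : X) {y : X}
    (hy : y ∈ (chartAt (EuclideanSpace ℝ (Fin d)) x).source) :
    ContMDiffAt (𝓡 d) (𝓡 d) ∞ (chartAt (EuclideanSpace ℝ (Fin d)) x) y :=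
  (contMDiffOn_chart (I := 𝓡 d) (x := x)).contMDiffAt
    ((chartAt (EuclideanSpace ℝ (Fin d)) x).open_source.mem_nhds hy)

theorem bijective_mder_chart (x : X) {y : X}
    (hy : y ∈ (chartAt (EuclideanSpace ℝ (Fin d)) x).source) :
    Function.Bijective (mder (𝓡 d) (𝓡 d) (chartAt (EuclideanSpace ℝ (Fin d)) x) y) :=
  (mdifferentiable_chart (I := 𝓡 d) x).mfderiv_bijective hy

theorem bijective_mder_chart_symm (x : X) {y : EuclideanSpace ℝ (Fin d)}
    (hy : y ∈ (chartAt (EuclideanSpace ℝ (Fin d)) x).target) :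
    Function.Bijective (mder (𝓡 d) (𝓡 d) (chartAt (EuclideanSpace ℝ (Fin d)) x).symm y) :=
  (mdifferentiable_chart (I := 𝓡 d) x).symm.mfderiv_bijective hy

/-- A map to a vector space, read in a chart, is smooth. -/
theorem contDiffAt_comp_chart_symm {F : X → V} (x : X) {y : EuclideanSpace ℝ (Fin d)}
    (hy : y ∈ (chartAt (EuclideanSpace ℝ (Fin d)) x).target)
    (hF : ContMDiffAt (𝓡 d) 𝓘(ℝ, V) ∞ F ((chartAt (EuclideanSpace ℝ (Fin d)) x).symm y)) :
    ContDiffAt ℝ ∞ (F ∘ (chartAt (EuclideanSpace ℝ (Fin d)) x).symm) y :=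
  contMDiffAt_iff_contDiffAt.1 (hF.comp y (contMDiffAt_chart_symm x hy))

/-- The derivative of a map to a vector space, read in a chart. -/
theorem fderiv_comp_chart_symm {F : X → V} (x : X) {y : EuclideanSpace ℝ (Fin d)}
    (hy : y ∈ (chartAt (EuclideanSpace ℝ (Fin d)) x).target)
    (hF : ContMDiffAt (𝓡 d) 𝓘(ℝ, V) ∞ F ((chartAt (EuclideanSpace ℝ (Fin d)) x).symm y))
    (v : EuclideanSpace ℝ (Fin d)) :
    fderiv ℝ (F ∘ (chartAt (EuclideanSpace ℝ (Fin d)) x).symm) y v =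
      mder (𝓡 d) 𝓘(ℝ, V) F ((chartAt (EuclideanSpace ℝ (Fin d)) x).symm y)
        (mder (𝓡 d) (𝓡 d) (chartAt (EuclideanSpace ℝ (Fin d)) x).symm y v) := by
  rw [← mder_eq_fderiv, ← mder_comp_apply y (hF.mdifferentiableAt (by simp))
    ((contMDiffAt_chart_symm x hy).mdifferentiableAt (by simp))]

/-- In a local parametrization `p` of the level set `F = c` these points become critical points of
`f ∘ p`, and real-valued Sard applies. This is the inductive step for vector-valued maps; since only
density is sought there, no Fubini argument is needed. -/
theorem volume_relative_critical_values [SecondCountableTopology X]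
    {G : Type*} [NormedAddCommGroup G] [NormedSpace ℝ G]
    {F : X → G} (hF : ContMDiff (𝓡 d) 𝓘(ℝ, G) ∞ F) {f : X → ℝ}
    (hf : ContMDiff (𝓡 d) 𝓘(ℝ, ℝ) ∞ f) (c : G)
    (hc : ∀ x, F x = c → Function.Surjective (mder (𝓡 d) 𝓘(ℝ, G) F x)) :
    volume (f '' {x | F x = c ∧ ∀ v, mder (𝓡 d) 𝓘(ℝ, G) F x v = 0 →
      mder (𝓡 d) 𝓘(ℝ, ℝ) f x v = 0}) = 0 := by
  refine volume_image_null_of_locally _ _ ?_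
  rintro x ⟨hx, -⟩
  let φ := chartAt (EuclideanSpace ℝ (Fin d)) x
  have hxs : x ∈ φ.source := mem_chart_source _ x
  have hxt : φ x ∈ φ.target := mem_chart_target _ x
  have hxx : φ.symm (φ x) = x := φ.left_inv hxs
  have hFs : ∀ᶠ y in 𝓝 (φ x), ContDiffAt ℝ ∞ (F ∘ φ.symm) y := by
    filter_upwards [φ.open_target.mem_nhds hxt] with y hy
    exact contDiffAt_comp_chart_symm x hy hF.contMDiffAt
  have hsurj : Function.Surjective (fderiv ℝ (F ∘ φ.symm) (φ x)) := by
    intro b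
    obtain ⟨v, hv⟩ := hc (φ.symm (φ x)) (by rw [hxx, hx]) b
    obtain ⟨u, rfl⟩ := (bijective_mder_chart_symm x hxt).2 v
    exact ⟨u, (fderiv_comp_chart_symm x hxt hF.contMDiffAt u).trans hv⟩
  obtain ⟨O, p, l, hO, hp, hFp, hl⟩ := exists_level_param hFs hsurj
  have hO' : IsOpen (O ∩ p ⁻¹' φ.target) :=
    hp.continuousOn.isOpen_inter_preimage hO φ.open_target
  have hfφ : ContDiffOn ℝ ∞ (f ∘ φ.symm) φ.target := fun y hy =>
    (contDiffAt_comp_chart_symm x hy hf.contMDiffAt).contDiffWithinAt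
  have hnull := volume_critical_values _ rfl ((f ∘ φ.symm) ∘ p) (O ∩ p ⁻¹' φ.target) hO'
    (hfφ.comp (hp.mono inter_subset_left) inter_subset_right)
  have hsrc : ∀ᶠ y in 𝓝 x, y ∈ φ.source := φ.open_source.mem_nhds hxs
  have hev : ∀ᶠ y in 𝓝 x, y ∈ φ.source ∧ ((F ∘ φ.symm) (φ y) = (F ∘ φ.symm) (φ x) →
      l (φ y) ∈ O ∧ p (l (φ y)) = φ y) := hsrc.and ((φ.continuousAt hxs).eventually hl)
  refine ⟨_, hev, measure_mono_null ?_ hnull⟩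
  rintro _ ⟨y, ⟨⟨hy, hcrit⟩, hys, hyl⟩, rfl⟩
  have hyy : φ.symm (φ y) = y := φ.left_inv hys
  have hyt : φ y ∈ φ.target := φ.map_source hys
  obtain ⟨hyO, hpy⟩ := hyl (by simp [hyy, hxx, hy, hx])
  refine ⟨l (φ y), ⟨⟨hyO, by rw [mem_preimage, hpy]; exact hyt⟩, ?_⟩, by simp [hpy, hyy]⟩
  have hdp : DifferentiableAt ℝ p (l (φ y)) :=
    (hp.contDiffAt (hO.mem_nhds hyO)).differentiableAt (by simp)
  have hdf : DifferentiableAt ℝ (f ∘ φ.symm) (p (l (φ y))) := by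
    rw [hpy]; exact (hfφ.contDiffAt (φ.open_target.mem_nhds hyt)).differentiableAt (by simp)
  have hdF : DifferentiableAt ℝ (F ∘ φ.symm) (p (l (φ y))) := by
    rw [hpy]
    exact (contDiffAt_comp_chart_symm x hyt hF.contMDiffAt).differentiableAt (by simp)
  have hconst : fderiv ℝ ((F ∘ φ.symm) ∘ p) (l (φ y)) = 0 := by
    have : (F ∘ φ.symm) ∘ p =ᶠ[𝓝 (l (φ y))] fun _ => (F ∘ φ.symm) (φ x) := by
      filter_upwards [hO.mem_nhds hyO] with u hu using hFp u hu
    rw [this.fderiv_eq]; simp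
  rw [fderiv_comp _ hdF hdp, hpy] at hconst
  rw [fderiv_comp _ hdf hdp, hpy]
  ext u
  have h1 := DFunLike.congr_fun hconst u
  rw [ContinuousLinearMap.comp_apply] at h1
  rw [ContinuousLinearMap.comp_apply]
  rw [← hyy] at hcrit
  exact (fderiv_comp_chart_symm x hyt hf.contMDiffAt _).trans
    (hcrit _ ((fderiv_comp_chart_symm x hyt hF.contMDiffAt _).symm.trans h1))

theorem mder_pi_apply {ι : Type*} [Fintype ι] {F : X → ι → ℝ}
    (hF : ContMDiff (𝓡 d) 𝓘(ℝ, ι → ℝ) ∞ F) (x : X) (v : EuclideanSpace ℝ (Fin d)) (i : ι) :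
    mder (𝓡 d) 𝓘(ℝ, ι → ℝ) F x v i = mder (𝓡 d) 𝓘(ℝ, ℝ) (fun x => F x i) x v := by
  let L := ContinuousLinearMap.proj (R := ℝ) (φ := fun _ : ι => ℝ) i
  have h := mder_comp_apply (I'' := 𝓘(ℝ, ℝ)) (g := L) x
    (L.contDiff.contMDiff.mdifferentiable (n := ∞) (by simp) (F x))
    (hF.mdifferentiable (by simp) x) v
  rw [mder_eq_fderiv, L.fderiv] at h
  exact h.symm

/-- **Sard's theorem**: the regular values of a smooth map are dense. -/
theorem dense_regular_values [SecondCountableTopology X] (n : ℕ) :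
    ∀ (F : X → Fin n → ℝ), ContMDiff (𝓡 d) 𝓘(ℝ, Fin n → ℝ) ∞ F →
    Dense {c | ∀ x, F x = c → Function.Surjective (mder (𝓡 d) 𝓘(ℝ, Fin n → ℝ) F x)} := by
  induction n with
  | zero =>
    intro F hF c
    exact subset_closure fun x _ b => ⟨0, Subsingleton.elim (α := Fin 0 → ℝ) _ _⟩
  | succ n ih =>
    intro F hF
    let H : X → Fin n → ℝ := fun x i => F x i.succ
    let f : X → ℝ := fun x => F x 0
    have hcomp : ∀ i, ContMDiff (𝓡 d) 𝓘(ℝ, ℝ) ∞ fun x => F x i := contMDiff_pi_space.1 hF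
    have hH : ContMDiff (𝓡 d) 𝓘(ℝ, Fin n → ℝ) ∞ H := contMDiff_pi_space.2 fun i => hcomp _
    have hf : ContMDiff (𝓡 d) 𝓘(ℝ, ℝ) ∞ f := hcomp 0
    rw [Metric.dense_iff]
    intro c r hr
    -- The last `n` coordinates are chosen first, as a regular value of `H`; then the first
    -- coordinate avoids the null set of critical values of `f` on `H = c'`.
    obtain ⟨c', hc'r, hc'⟩ := Metric.dense_iff.1 (ih H hH) (fun i => c i.succ) r hr
    have hnull := volume_relative_critical_values hH hf c' hc'
    obtain ⟨t, htr, ht⟩ : (Metric.ball (c 0) r \ f '' {x | H x = c' ∧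
        ∀ v, mder (𝓡 d) 𝓘(ℝ, Fin n → ℝ) H x v = 0 →
          mder (𝓡 d) 𝓘(ℝ, ℝ) f x v = 0}).Nonempty := by
      by_contra hemp
      rw [not_nonempty_iff_eq_empty, sdiff_eq_empty] at hemp
      exact (Metric.measure_ball_pos volume (c 0) hr).ne' (measure_mono_null hemp hnull)
    refine ⟨Fin.cons t c', ?_, ?_⟩
    · rw [Metric.mem_ball, dist_pi_lt_iff hr]
      intro i
      refine Fin.cases ?_ (fun i => ?_) i
      · simpa using htr
      · exact (dist_pi_lt_iff hr).1 hc'r i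
    · intro x hx b
      have hHx : H x = c' := by ext i; simp [H, hx]
      have hfx : f x = t := by simp [f, hx]
      have hnc : ¬ ∀ v, mder (𝓡 d) 𝓘(ℝ, Fin n → ℝ) H x v = 0 →
          mder (𝓡 d) 𝓘(ℝ, ℝ) f x v = 0 := fun h => ht ⟨x, ⟨hHx, h⟩, hfx⟩
      push Not at hnc
      obtain ⟨v, hv, hfv⟩ := hnc
      obtain ⟨w, hw⟩ := hc' x hHx (fun i => b i.succ)
      -- `v` is tangent to the level of `H` and moves `f`, so a multiple of it corrects the first
      -- coordinate and leaves the others alone.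
      refine ⟨w + ((b 0 - mder (𝓡 d) 𝓘(ℝ, ℝ) f x w) / mder (𝓡 d) 𝓘(ℝ, ℝ) f x v) • v, ?_⟩
      ext i
      rw [mder_pi_apply hF, map_add, map_smul]
      refine Fin.cases ?_ (fun i => ?_) i
      · change mder (𝓡 d) 𝓘(ℝ, ℝ) f x w + _ * mder (𝓡 d) 𝓘(ℝ, ℝ) f x v = _
        rw [div_mul_cancel₀ _ hfv]; ring
      · have h1 := congrFun hw i
        have h2 := congrFun hv i
        rw [mder_pi_apply hH] at h1 h2
        change mder (𝓡 d) 𝓘(ℝ, ℝ) (fun x => H x i) x w +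
          _ * mder (𝓡 d) 𝓘(ℝ, ℝ) (fun x => H x i) x v = _
        rw [h1, h2]; simp

end Charts

section RegularValue

variable {d n : ℕ} {X : Type*} [TopologicalSpace X] [ChartedSpace (EuclideanSpace ℝ (Fin d)) X]
  [IsManifold (𝓡 d) ∞ X] [SecondCountableTopology X]

theorem dense_isRegularValue {μ : X → EuclideanSpace ℝ (Fin n)}
    (hμ : ContMDiff (𝓡 d) 𝓘(ℝ, EuclideanSpace ℝ (Fin n)) ∞ μ) :
    Dense {c | IsRegularValue d μ c} := by
  let e := EuclideanSpace.equiv (Fin n) ℝ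
  have he : ContMDiff 𝓘(ℝ, EuclideanSpace ℝ (Fin n)) 𝓘(ℝ, Fin n → ℝ) ∞ e := e.contDiff.contMDiff
  have h := dense_regular_values n (e ∘ μ) (he.comp hμ)
  have h2 := h.preimage e.toHomeomorph.isOpenMap
  refine h2.mono fun c hc x hx b => ?_
  obtain ⟨v, hv⟩ := hc x (congrArg e hx) (e b)
  refine ⟨v, e.injective ?_⟩
  rw [← hv, mder_comp_apply x (he.mdifferentiable (by simp) _) (hμ.mdifferentiable (by simp) x),
    mder_eq_fderiv, e.fderiv]
  rfl

end RegularValue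

end Tetraplectic

/-! ### The exponential map, the adjoint action and one-parameter groups of the spheroid. -/

namespace Tetraplectic

open Set Filter Topology MeasureTheory Module

section PiManifold

variable {E : Type*} [NormedAddCommGroup E] [NormedSpace ℝ E] {H : Type*} [TopologicalSpace H]
  {I : ModelWithCorners ℝ E H} {M : Type*} [TopologicalSpace M] [ChartedSpace H M] {n : ℕ}

theorem contMDiffAt_spheroid {f : M → Spheroid n} {x : M} :
    ContMDiffAt I (spheroidModel n) ∞ f x ↔ ∀ j, ContMDiffAt I (𝓡 3) ∞ (fun y => f y j) x := by
  simp only [contMDiffAt_iff, continuousAt_pi, forall_and]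
  refine and_congr_right fun _ => ?_
  rw [← contDiffWithinAt_pi]
  rfl

theorem contMDiff_spheroid {f : M → Spheroid n} :
    ContMDiff I (spheroidModel n) ∞ f ↔ ∀ j, ContMDiff I (𝓡 3) ∞ (fun y => f y j) :=
  ⟨fun h j x => contMDiffAt_spheroid.1 (h x) j, fun h x => contMDiffAt_spheroid.2 fun j => h j x⟩

theorem contMDiff_spheroid_coe (j : Fin n) :
    ContMDiff (spheroidModel n) 𝓘(ℝ, ℍ[ℝ]) ∞ (fun g : Spheroid n => (g j : ℍ[ℝ])) :=
  contMDiff_coe_sphere.comp (contMDiff_spheroid.1 contMDiff_id j)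

end PiManifold

noncomputable instance normedAlgebraRatQuaternion : NormedAlgebra ℚ ℍ[ℝ] :=
  NormedAlgebra.restrictScalars ℚ ℝ ℍ[ℝ]

/-- The imaginary part of a quaternion. -/
noncomputable def imProj : ℍ[ℝ] →L[ℝ] imQuaternion :=
  LinearMap.toContinuousLinearMap
    { toFun := fun q => ⟨q.im, rfl⟩
      map_add' := fun a b => by ext1; simp
      map_smul' := fun c a => by ext1; simp }

theorem coe_imProj {q : ℍ[ℝ]} (hq : q.re = 0) : (imProj q : ℍ[ℝ]) = q := by
  change q.im = q
  rw [← sub_eq_zero]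
  ext <;> simp [hq]

theorem re_mul_comm (a b : ℍ[ℝ]) : (a * b).re = (b * a).re := by
  simp only [Quaternion.re_mul]; ring

variable {n : ℕ}

theorem sphere_coe_ne_zero (g : Metric.sphere (0 : ℍ[ℝ]) 1) : (g : ℍ[ℝ]) ≠ 0 := by
  intro h
  have := g.2
  rw [h, mem_sphere_zero_iff_norm, norm_zero] at this
  exact zero_ne_one this

theorem re_conj (g : Metric.sphere (0 : ℍ[ℝ]) 1) (q : imQuaternion) :
    ((g : ℍ[ℝ]) * q * (g : ℍ[ℝ])⁻¹).re = 0 := by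
  rw [re_mul_comm, ← mul_assoc, inv_mul_cancel₀ (sphere_coe_ne_zero g), one_mul]
  exact q.2

/-- The commutator bracket of the Lie algebra `σₙ`. -/
noncomputable def lieBr (x y : SpheroidLie n) : SpheroidLie n :=
  fun j => imProj ((x j : ℍ[ℝ]) * y j - y j * x j)

theorem coe_lieBr (x y : SpheroidLie n) (j : Fin n) :
    (lieBr x y j : ℍ[ℝ]) = (x j : ℍ[ℝ]) * y j - y j * x j :=
  coe_imProj (by rw [Quaternion.re_sub, re_mul_comm, sub_self])

/-- The adjoint action of `Σⁿ` on its Lie algebra. -/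
noncomputable def spheroidAd (g : Spheroid n) (x : SpheroidLie n) : SpheroidLie n :=
  fun j => imProj ((g j : ℍ[ℝ]) * x j * (g j : ℍ[ℝ])⁻¹)

theorem coe_spheroidAd (g : Spheroid n) (x : SpheroidLie n) (j : Fin n) :
    (spheroidAd g x j : ℍ[ℝ]) = (g j : ℍ[ℝ]) * x j * (g j : ℍ[ℝ])⁻¹ :=
  coe_imProj (re_conj _ _)

theorem spheroidAd_smul (g : Spheroid n) (t : ℝ) (x : SpheroidLie n) :
    spheroidAd g (t • x) = t • spheroidAd g x := by
  ext1 j; apply Subtype.ext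
  rw [coe_spheroidAd, Pi.smul_apply, Pi.smul_apply, Submodule.coe_smul, Submodule.coe_smul,
    coe_spheroidAd]
  simp

theorem coe_spheroidExp (x : SpheroidLie n) (j : Fin n) :
    (spheroidExp x j : ℍ[ℝ]) = NormedSpace.exp (x j : ℍ[ℝ]) := rfl

theorem spheroidExp_zero : spheroidExp (0 : SpheroidLie n) = 1 := by
  ext1 j; apply Subtype.ext
  rw [coe_spheroidExp]; simp

theorem spheroidExp_add_smul (s t : ℝ) (x : SpheroidLie n) :
    spheroidExp ((s + t) • x) = spheroidExp (s • x) * spheroidExp (t • x) := by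
  ext1 j; apply Subtype.ext
  rw [Pi.mul_apply, Metric.unitSphere.coe_mul]
  simp only [coe_spheroidExp, Pi.smul_apply, Submodule.coe_smul]
  rw [add_smul, NormedSpace.exp_add_of_commute]
  exact ((Commute.refl _).smul_left _).smul_right _

theorem spheroidExp_conj (g : Spheroid n) (x : SpheroidLie n) :
    spheroidExp (spheroidAd g x) = g * spheroidExp x * g⁻¹ := by
  ext1 j; apply Subtype.ext
  rw [coe_spheroidExp, coe_spheroidAd, NormedSpace.exp_conj _ _ (sphere_coe_ne_zero _)]
  rfl

theorem spheroidExp_neg_smul (t : ℝ) (x : SpheroidLie n) :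
    spheroidExp (-(t • x)) = (spheroidExp (t • x))⁻¹ := by
  have h : -(t • x) = (-t) • x := by module
  rw [eq_inv_iff_mul_eq_one, h, ← spheroidExp_add_smul, neg_add_cancel, zero_smul,
    spheroidExp_zero]

theorem contDiff_exp_quaternion : ContDiff ℝ ∞ (NormedSpace.exp : ℍ[ℝ] → ℍ[ℝ]) :=
  contDiff_iff_contDiffAt.2 fun x => (NormedSpace.exp_analytic (𝕂 := ℝ) x).contDiffAt

theorem contDiff_exp_coe (j : Fin n) :
    ContDiff ℝ ∞ fun x : SpheroidLie n => NormedSpace.exp (x j : ℍ[ℝ]) :=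
  contDiff_exp_quaternion.comp (imQuaternion.subtypeL.contDiff.comp (contDiff_apply ℝ _ j))

theorem contMDiff_spheroidExp :
    ContMDiff 𝓘(ℝ, SpheroidLie n) (spheroidModel n) ∞ (spheroidExp (n := n)) :=
  contMDiff_spheroid.2 fun j =>
    ((contDiff_exp_coe j).contMDiff).codRestrict_sphere fun x => exp_mem_sphere (x j)

theorem hasDerivAt_exp_smul (p : ℍ[ℝ]) (t : ℝ) :
    HasDerivAt (fun s : ℝ => NormedSpace.exp (s • p)) (NormedSpace.exp (t • p) * p) t :=
  hasDerivAt_exp_smul_const p t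

theorem spheroidExp_injective_line {x y : SpheroidLie n}
    (h : ∀ t : ℝ, spheroidExp (t • x) = spheroidExp (t • y)) : x = y := by
  ext1 j; apply Subtype.ext
  have hx := hasDerivAt_exp_smul (x j : ℍ[ℝ]) 0
  have hy := hasDerivAt_exp_smul (y j : ℍ[ℝ]) 0
  have he : (fun s : ℝ => NormedSpace.exp (s • (x j : ℍ[ℝ]))) =
      fun s : ℝ => NormedSpace.exp (s • (y j : ℍ[ℝ])) := by
    ext1 t
    exact congrArg (fun g : Spheroid n => (g j : ℍ[ℝ])) (h t)
  rw [he] at hx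
  simpa using hx.unique hy

/-- A local logarithm on the spheroid. -/
theorem exists_spheroidLog : ∃ L : Spheroid n → SpheroidLie n,
    Tendsto L (𝓝 1) (𝓝 0) ∧ ∀ᶠ g in 𝓝 (1 : Spheroid n), spheroidExp (L g) = g := by
  have hd : HasFDerivAt (NormedSpace.exp : ℍ[ℝ] → ℍ[ℝ]) (1 : ℍ[ℝ] →L[ℝ] ℍ[ℝ]) 0 :=
    hasFDerivAt_exp_zero
  obtain ⟨l, hl, hl1, -, hlr⟩ := exists_local_inverse (f := (NormedSpace.exp : ℍ[ℝ] → ℍ[ℝ])) (a := 0)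
    (Eventually.of_forall fun x => contDiff_exp_quaternion.contDiffAt)
    (by rw [hd.fderiv]; exact Function.bijective_id)
  rw [NormedSpace.exp_zero] at hl hl1 hlr
  refine ⟨fun g j => imProj (l (g j)), ?_, ?_⟩
  · rw [tendsto_pi_nhds]
    intro j
    have h1 : Tendsto (fun g : Spheroid n => (g j : ℍ[ℝ])) (𝓝 1) (𝓝 1) := by
      have : Continuous fun g : Spheroid n => (g j : ℍ[ℝ]) :=
        continuous_subtype_val.comp (continuous_apply j)
      exact this.tendsto 1
    have h2 : Tendsto l (𝓝 1) (𝓝 0) := by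
      have := hl.self_of_nhds.continuousAt
      rwa [ContinuousAt, hl1] at this
    have h3 := imProj.continuous.tendsto 0
    rw [map_zero] at h3
    exact h3.comp (h2.comp h1)
  · have : ∀ j : Fin n, ∀ᶠ g in 𝓝 (1 : Spheroid n),
        NormedSpace.exp (l (g j : ℍ[ℝ])) = (g j : ℍ[ℝ]) := fun j => by
      have hc : Continuous fun g : Spheroid n => (g j : ℍ[ℝ]) :=
        continuous_subtype_val.comp (continuous_apply j)
      exact (hc.tendsto 1).eventually hlr
    filter_upwards [eventually_all.2 this] with g hg
    ext1 j; apply Subtype.ext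
    -- Since `‖exp q‖ = exp (re q)`, any logarithm of a unit quaternion is imaginary.
    have hre : (l (g j : ℍ[ℝ])).re = 0 := by
      have h1 := congrArg norm (hg j)
      rw [Quaternion.norm_exp, mem_sphere_zero_iff_norm.1 (g j).2] at h1
      rw [← Real.exp_eq_exp_ℝ, Real.norm_of_nonneg (Real.exp_pos _).le, Real.exp_eq_one_iff] at h1
      exact h1
    rw [coe_spheroidExp, coe_imProj hre, hg j]

/-- A differentiable one-parameter subgroup of the quaternions is an exponential. -/
theorem eq_exp_of_one_parameter {c : ℝ → ℍ[ℝ]} {p : ℍ[ℝ]} (h0 : c 0 = 1)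
    (hadd : ∀ s t, c (s + t) = c s * c t) (hd : HasDerivAt c p 0) (t : ℝ) :
    c t = NormedSpace.exp (t • p) := by
  have hdt : ∀ t, HasDerivAt c (c t * p) t := fun t => by
    have h1 : HasDerivAt (fun s => c t * c (s - t)) (c t * p) t := by
      have : HasDerivAt (fun s => c (s - t)) p t := by
        have h2 := HasDerivAt.scomp (g₁ := c) (h := fun s : ℝ => s - t) (h' := 1) (g₁' := p) t
          (by simpa using hd) ((hasDerivAt_id t).sub_const t)
        rw [one_smul] at h2
        exact h2
      exact this.const_mul (c t)
    refine h1.congr_of_eventuallyEq (Eventually.of_forall fun s => ?_)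
    change c s = c t * c (s - t)
    rw [← hadd, add_sub_cancel]
  have hconst : ∀ t, HasDerivAt (fun s : ℝ => c s * NormedSpace.exp (s • (-p))) 0 t := fun t => by
    have h := (hdt t).mul (hasDerivAt_exp_smul (-p) t)
    convert! h using 1
    have hc : Commute p (NormedSpace.exp (t • (-p))) :=
      (((Commute.refl p).neg_right).smul_right t).exp_right
    rw [mul_assoc, hc.eq]
    simp
  have hk : c t * NormedSpace.exp (t • (-p)) = 1 := by
    have := is_const_of_deriv_eq_zero (fun t => (hconst t).differentiableAt)
      (fun t => (hconst t).deriv) t 0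
    simpa [h0] using this
  have hinv : NormedSpace.exp (t • (-p)) * NormedSpace.exp (t • p) = 1 := by
    rw [← NormedSpace.exp_add_of_commute]
    · simp
    · exact (((Commute.refl p).neg_left).smul_left t).smul_right t
  calc c t = c t * (NormedSpace.exp (t • (-p)) * NormedSpace.exp (t • p)) := by rw [hinv, mul_one]
    _ = _ := by rw [← mul_assoc, hk, one_mul]

/-- The differential of the conjugation action along a one-parameter subgroup. -/
theorem hasDerivAt_exp_conj (p q : ℍ[ℝ]) :
    HasDerivAt (fun s : ℝ => NormedSpace.exp (s • p) * q * NormedSpace.exp (s • (-p)))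
      (p * q - q * p) 0 := by
  have h := ((hasDerivAt_exp_smul p 0).mul_const q).mul (hasDerivAt_exp_smul (-p) 0)
  convert! h using 1
  simp [sub_eq_add_neg]

theorem inv_exp_smul (p : ℍ[ℝ]) (t : ℝ) :
    (NormedSpace.exp (t • p))⁻¹ = NormedSpace.exp (t • (-p)) := by
  rw [smul_neg, NormedSpace.exp_neg]

theorem hasDerivAt_spheroidAd_exp (x y : SpheroidLie n) :
    HasDerivAt (fun s : ℝ => spheroidAd (spheroidExp (s • x)) y) (lieBr x y) 0 := by
  rw [hasDerivAt_pi]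
  intro j
  have h := imProj.hasFDerivAt.comp_hasDerivAt (0 : ℝ) (hasDerivAt_exp_conj (x j : ℍ[ℝ]) (y j))
  refine h.congr_of_eventuallyEq (Eventually.of_forall fun s => ?_)
  simp only [Function.comp_apply]
  rw [← inv_exp_smul]
  rfl

end Tetraplectic

/-! ### Lie algebra homomorphisms into `σₙ` and cocycles on them. -/

namespace Tetraplectic

open Set Filter Topology MeasureTheory Module

variable {n : ℕ}

/-- The differential of a smooth homomorphism of spheroids, restricted to one factor. -/
theorem exists_lie_hom {k : ℕ} (φ : Spheroid k →* Spheroid n)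
    (hφ : ContMDiff (spheroidModel k) (spheroidModel n) ∞ φ) (i : Fin k) :
    ∃ ρ : Fin n → imQuaternion →L[ℝ] imQuaternion,
      (∀ a, spheroidExp (fun j => ρ j a) = φ (spheroidExp (Pi.single i a))) ∧
      ∀ j (a b : imQuaternion), ρ j (imProj ((a : ℍ[ℝ]) * b - b * a)) =
        imProj ((ρ j a : ℍ[ℝ]) * ρ j b - ρ j b * ρ j a) := by
  let E : imQuaternion → Spheroid k := fun a => spheroidExp (Pi.single i a)
  let f : Fin n → imQuaternion → ℍ[ℝ] := fun j a => φ (E a) j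
  have hsingle : ∀ (t : ℝ) (a : imQuaternion),
      (Pi.single i (t • a) : SpheroidLie k) = t • Pi.single i a := fun t a =>
    Pi.single_smul (f := fun _ : Fin k => imQuaternion) i t a
  have hEs : ContMDiff 𝓘(ℝ, imQuaternion) (spheroidModel k) ∞ E :=
    contMDiff_spheroidExp.comp
      (ContinuousLinearMap.single ℝ (fun _ : Fin k => imQuaternion) i).contDiff.contMDiff
  have hf : ∀ j, ContDiff ℝ ∞ (f j) := fun j =>
    contMDiff_iff_contDiff.1 ((contMDiff_spheroid_coe j).comp (hφ.comp hEs))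
  let L : Fin n → imQuaternion →L[ℝ] ℍ[ℝ] := fun j => fderiv ℝ (f j) 0
  -- Along a line each component of `φ ∘ E` is a one-parameter group of quaternions, hence the
  -- exponential of its velocity; linearity in `a` is free because `L j` is a derivative.
  have hfL : ∀ j a (t : ℝ), f j (t • a) = NormedSpace.exp (t • L j a) := fun j a t => by
    refine eq_exp_of_one_parameter (c := fun t => f j (t • a)) ?_ ?_ ?_ t
    · simp [f, E, spheroidExp_zero]
    · intro s t
      simp only [f, E, hsingle, spheroidExp_add_smul, map_mul]
      rfl
    · have h1 : HasFDerivAt (f j) (L j) ((0 : ℝ) • a) := by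
        rw [zero_smul]; exact ((hf j).differentiable (by simp) 0).hasFDerivAt
      have h2 : HasDerivAt (fun t : ℝ => t • a) a 0 := by
        simpa using (hasDerivAt_id (0 : ℝ)).smul_const a
      exact h1.comp_hasDerivAt (0 : ℝ) h2
  have hre : ∀ j a, (L j a).re = 0 := fun j a => by
    have h1 := congrArg norm (hfL j a 1)
    rw [one_smul, one_smul, Quaternion.norm_exp,
      mem_sphere_zero_iff_norm.1 (φ (E a) j).2, ← Real.exp_eq_exp_ℝ,
      Real.norm_of_nonneg (Real.exp_pos _).le, eq_comm, Real.exp_eq_one_iff] at h1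
    exact h1
  let ρ : Fin n → imQuaternion →L[ℝ] imQuaternion := fun j => imProj.comp (L j)
  have hρ : ∀ j a, (ρ j a : ℍ[ℝ]) = L j a := fun j a => coe_imProj (hre j a)
  let ρv : imQuaternion → SpheroidLie n := fun a j => ρ j a
  have hexp : ∀ a, spheroidExp (ρv a) = φ (E a) := fun a => by
    ext1 j; apply Subtype.ext
    rw [coe_spheroidExp, hρ]
    have := hfL j a 1
    rw [one_smul, one_smul] at this
    exact this.symm
  have hρvs : ∀ (t : ℝ) a, ρv (t • a) = t • ρv a := fun t a => by
    ext1 j; exact map_smul (ρ j) t a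
  refine ⟨ρ, hexp, fun j a b => ?_⟩
  have hAdSingle : ∀ (g : Spheroid k) (x : imQuaternion),
      spheroidAd g (Pi.single i x) = Pi.single i (spheroidAd g (Pi.single i x) i) := fun g x => by
    ext1 l
    rcases eq_or_ne l i with rfl | hl
    · rw [Pi.single_eq_same]
    · rw [Pi.single_eq_of_ne hl]
      apply Subtype.ext
      rw [coe_spheroidAd, Pi.single_eq_of_ne hl]; simp
  -- `φ` intertwines conjugations, and an element of the Lie algebra is determined by its
  -- one-parameter group. Differentiating this identity in `s` at `0` gives the bracket relation.
  have hAd : ∀ s : ℝ, ρv (spheroidAd (spheroidExp (s • Pi.single i a)) (Pi.single i b) i) =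
      spheroidAd (spheroidExp (s • ρv a)) (ρv b) := fun s => by
    refine spheroidExp_injective_line fun t => ?_
    rw [← hρvs, hexp]
    simp only [E]
    rw [hsingle, ← hAdSingle, ← spheroidAd_smul, spheroidExp_conj, ← spheroidAd_smul,
      spheroidExp_conj, map_mul, map_mul, map_inv, ← hρvs, hexp, ← hρvs, hexp]
    simp only [E, hsingle]
  have h1 := hasDerivAt_pi.1 (hasDerivAt_spheroidAd_exp (Pi.single i a : SpheroidLie k)
    (Pi.single i b)) i
  have h2 := (ρ j).hasFDerivAt.comp_hasDerivAt (0 : ℝ) h1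
  have h3 := hasDerivAt_pi.1 (hasDerivAt_spheroidAd_exp (ρv a) (ρv b)) j
  have he : (ρ j ∘ fun s : ℝ => spheroidAd (spheroidExp (s • Pi.single i a)) (Pi.single i b) i) =
      fun s : ℝ => spheroidAd (spheroidExp (s • ρv a)) (ρv b) j := by
    ext1 s; exact congrFun (hAd s) j
  rw [he] at h2
  have h4 := h2.unique h3
  simp only [lieBr, Pi.single_eq_same] at h4
  exact h4

section Alternating

variable {V : Type*} [AddCommGroup V] [Module ℝ V]

theorem alternating_three_rotate (B : V [⋀^Fin 3]→ₗ[ℝ] ℝ) (a b c : V) :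
    B ![b, c, a] = B ![a, b, c] := by
  have h := B.map_perm ![a, b, c] (finRotate 3)
  rw [sign_finRotate] at h
  have h2 : ![a, b, c] ∘ (finRotate 3) = ![b, c, a] := by
    ext i; fin_cases i <;> rfl
  rw [h2] at h
  simpa using h

theorem alternating_four_rotate (B : V [⋀^Fin 4]→ₗ[ℝ] ℝ) (a b c v : V) :
    B ![a, b, c, v] = - B ![v, a, b, c] := by
  have h := B.map_perm ![v, a, b, c] (finRotate 4)
  rw [sign_finRotate] at h
  have h2 : ![v, a, b, c] ∘ (finRotate 4) = ![a, b, c, v] := by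
    ext i; fin_cases i <;> rfl
  rw [h2] at h
  simpa [pow_succ] using h

theorem alternating_three_add (B : V [⋀^Fin 3]→ₗ[ℝ] ℝ) (x x' a b : V) :
    B ![x + x', a, b] = B ![x, a, b] + B ![x', a, b] :=
  B.map_vecCons_add _ _ _

end Alternating

/-- The coordinates of an imaginary quaternion. -/
noncomputable def imEquiv : imQuaternion ≃ₗ[ℝ] (Fin 3 → ℝ) where
  toFun q := ![(q : ℍ[ℝ]).imI, (q : ℍ[ℝ]).imJ, (q : ℍ[ℝ]).imK]
  invFun v := ⟨⟨0, v 0, v 1, v 2⟩, rfl⟩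
  map_add' a b := by ext i; fin_cases i <;> simp
  map_smul' a b := by ext i; fin_cases i <;> simp
  left_inv q := by
    have h : (q : ℍ[ℝ]).re = 0 := q.2
    apply Subtype.ext
    ext <;> simp [h]
  right_inv v := by ext i; fin_cases i <;> rfl

theorem imEquiv_symm_single (a : Fin 3) : imEquiv.symm (Pi.single a 1) = imBasis a := by
  apply Subtype.ext
  fin_cases a <;> ext <;> simp [imEquiv, imBasis]

theorem alternating_im_eq_det (f : imQuaternion [⋀^Fin 3]→ₗ[ℝ] ℝ) (v : Fin 3 → imQuaternion) :
    f v = (Matrix.of fun a b => imEquiv (v b) a).det * f imBasis := by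
  let e : Basis (Fin 3) ℝ imQuaternion := Basis.ofEquivFun imEquiv
  have he : (e : Fin 3 → imQuaternion) = imBasis := by
    ext1 a
    rw [← imEquiv_symm_single]
    simp [e]
  have h := f.eq_smul_basis_det e
  rw [h, AlternatingMap.smul_apply, AlternatingMap.smul_apply, he, e.det_apply, smul_eq_mul,
    smul_eq_mul, ← he, e.det_self, mul_one, mul_comm]
  rfl

/-- Three imaginary quaternions that satisfy the commutation relations of `𝐢, 𝐣, 𝐤`. -/
structure IsImTriple {n : ℕ} (U : Fin 3 → SpheroidLie n) : Prop where
  br01 : lieBr (U 0) (U 1) = (2 : ℝ) • U 2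
  br12 : lieBr (U 1) (U 2) = (2 : ℝ) • U 0
  br20 : lieBr (U 2) (U 0) = (2 : ℝ) • U 1

/-- The closedness relation of an invariant `3`-form on `σₙ`, for pairs that commute. -/
def IsCommCocycle (B : SpheroidLie n [⋀^Fin 3]→ₗ[ℝ] ℝ) : Prop :=
  ∀ x y z w, lieBr x z = 0 → lieBr x w = 0 → lieBr y z = 0 → lieBr y w = 0 →
    B ![lieBr x y, z, w] + B ![lieBr z w, x, y] = 0

theorem IsCommCocycle.map_add {B : SpheroidLie n [⋀^Fin 3]→ₗ[ℝ] ℝ} (hB : IsCommCocycle B)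
    {U V : Fin 3 → SpheroidLie n} (hU : IsImTriple U) (hV : IsImTriple V)
    (hUV : ∀ a b, lieBr (U a) (V b) = 0) : B (U + V) = B U + B V := by
  have e : ∀ W : Fin 3 → SpheroidLie n, W = ![W 0, W 1, W 2] := fun W => by
    ext1 i; fin_cases i <;> rfl
  have s : ∀ a b c : SpheroidLie n, B ![(2 : ℝ) • a, b, c] = 2 * B ![a, b, c] := fun a b c =>
    B.map_vecCons_smul _ _ _
  have r := alternating_three_rotate B
  -- The six mixed terms of the trilinear expansion cancel in pairs: as `[U 0, U 1] = 2 U 2` and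
  -- likewise for `V`, the sum `B(U 2, V 0, V 1) + B(V 2, U 0, U 1)` is half a cocycle relation, and
  -- so on cyclically.
  have h1 := hB (U 0) (U 1) (V 0) (V 1) (hUV _ _) (hUV _ _) (hUV _ _) (hUV _ _)
  have h2 := hB (U 1) (U 2) (V 1) (V 2) (hUV _ _) (hUV _ _) (hUV _ _) (hUV _ _)
  have h3 := hB (U 2) (U 0) (V 2) (V 0) (hUV _ _) (hUV _ _) (hUV _ _) (hUV _ _)
  rw [hU.br01, hV.br01, s, s] at h1
  rw [hU.br12, hV.br12, s, s] at h2
  rw [hU.br20, hV.br20, s, s] at h3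
  rw [e U, e V]
  have hexp : B (![U 0, U 1, U 2] + ![V 0, V 1, V 2]) =
      B ![U 0, U 1, U 2] + B ![V 0, V 1, V 2] + (B ![U 2, V 0, V 1] + B ![V 2, U 0, U 1]) +
      (B ![U 0, V 1, V 2] + B ![V 0, U 1, U 2]) + (B ![U 1, V 2, V 0] + B ![V 1, U 2, U 0]) := by
    have hs : ![U 0, U 1, U 2] + ![V 0, V 1, V 2] = ![U 0 + V 0, U 1 + V 1, U 2 + V 2] := by
      ext1 i; fin_cases i <;> rfl
    have q : ∀ x a a' b, B ![x, a + a', b] = B ![x, a, b] + B ![x, a', b] := fun x a a' b => by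
      rw [← r x, alternating_three_add, r x, r x]
    have q' : ∀ x b a a', B ![x, b, a + a'] = B ![x, b, a] + B ![x, b, a'] := fun x b a a' => by
      rw [← r x, ← r b, alternating_three_add, r b, r b, r x, r x]
    rw [hs]
    simp only [alternating_three_add, q, q']
    rw [← r (V 0) (U 1) (V 2), ← r (U 0) (U 1) (V 2), ← r (U 1) (V 2) (U 0), ← r (V 0) (V 1) (U 2),
      ← r (V 1) (U 2) (V 0), ← r (U 0) (V 1) (U 2)]
    ring
  rw [hexp]
  linarith

theorem lieBr_single_of_apply_eq_zero (j : Fin n) (a : imQuaternion) (y : SpheroidLie n)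
    (hy : y j = 0) : lieBr (Pi.single j a) y = 0 := by
  ext1 l; apply Subtype.ext
  rw [coe_lieBr]
  rcases eq_or_ne l j with rfl | h
  · simp [hy]
  · simp [Pi.single_eq_of_ne h]

theorem lieBr_smul_single (j : Fin n) (a b : imQuaternion) :
    lieBr (Pi.single j a) (Pi.single j b) =
      Pi.single j (imProj ((a : ℍ[ℝ]) * b - b * a)) := by
  ext1 l
  rcases eq_or_ne l j with rfl | h
  · simp [lieBr]
  · simp [lieBr, Pi.single_eq_of_ne h]

/-- A cocycle, evaluated on a triple, is the sum of its values on the components. -/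
theorem IsCommCocycle.map_sum {B : SpheroidLie n [⋀^Fin 3]→ₗ[ℝ] ℝ} (hB : IsCommCocycle B)
    (p : Fin n → Fin 3 → imQuaternion) (hp : ∀ j, IsImTriple fun a => Pi.single j (p j a))
    (S : Finset (Fin n)) :
    B (∑ j ∈ S, fun a => Pi.single j (p j a)) =
      ∑ j ∈ S, B fun a => Pi.single j (p j a) := by
  have hz : ∀ (S : Finset (Fin n)) (a : Fin 3) (j : Fin n),
      (∑ j ∈ S, fun a => (Pi.single j (p j a) : SpheroidLie n)) a j =
        if j ∈ S then p j a else 0 := fun S a j => by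
    rw [Finset.sum_apply, Finset.sum_apply, Finset.sum_pi_single]
  have htr : ∀ S : Finset (Fin n),
      IsImTriple (∑ j ∈ S, fun a => (Pi.single j (p j a) : SpheroidLie n)) := by
    intro S
    have key : ∀ a b c, (∀ j, lieBr (Pi.single j (p j a) : SpheroidLie n) (Pi.single j (p j b)) =
        (2 : ℝ) • Pi.single j (p j c)) →
        lieBr ((∑ j ∈ S, fun a => (Pi.single j (p j a) : SpheroidLie n)) a)
          ((∑ j ∈ S, fun a => (Pi.single j (p j a) : SpheroidLie n)) b) =
        (2 : ℝ) • (∑ j ∈ S, fun a => (Pi.single j (p j a) : SpheroidLie n)) c := by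
      intro a b c h
      ext1 l
      have hl := congrFun (h l) l
      simp only [lieBr, Pi.single_eq_same, Pi.smul_apply] at hl
      simp only [lieBr, hz, Pi.smul_apply]
      split_ifs
      · exact hl
      · simp
    exact ⟨key _ _ _ fun j => (hp j).br01, key _ _ _ fun j => (hp j).br12,
      key _ _ _ fun j => (hp j).br20⟩
  induction S using Finset.induction_on with
  | empty =>
    rw [Finset.sum_empty, Finset.sum_empty]
    exact B.map_zero
  | insert j S hj ih =>
    rw [Finset.sum_insert hj, Finset.sum_insert hj, ← ih]
    refine hB.map_add (hp j) (htr S) fun a b => ?_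
    refine lieBr_single_of_apply_eq_zero j _ _ ?_
    rw [hz, if_neg hj]

/-- A cocycle, evaluated on the image of `𝐢, 𝐣, 𝐤` under a Lie algebra homomorphism `𝔰 → σₙ`. -/
theorem IsCommCocycle.map_lie_hom {B : SpheroidLie n [⋀^Fin 3]→ₗ[ℝ] ℝ} (hB : IsCommCocycle B)
    (ρ : Fin n → imQuaternion →L[ℝ] imQuaternion)
    (hρ : ∀ j (a b : imQuaternion), ρ j (imProj ((a : ℍ[ℝ]) * b - b * a)) =
        imProj ((ρ j a : ℍ[ℝ]) * ρ j b - ρ j b * ρ j a)) :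
    B (fun a j => ρ j (imBasis a)) =
      ∑ j, ‖(ρ j (imBasis 0) : ℍ[ℝ])‖ ^ 2 * B fun a => lieBasis j a := by
  have e0 : (imBasis 0 : ℍ[ℝ]).re = 0 ∧ (imBasis 0 : ℍ[ℝ]).imI = 1 ∧
      (imBasis 0 : ℍ[ℝ]).imJ = 0 ∧ (imBasis 0 : ℍ[ℝ]).imK = 0 := ⟨rfl, rfl, rfl, rfl⟩
  have e1 : (imBasis 1 : ℍ[ℝ]).re = 0 ∧ (imBasis 1 : ℍ[ℝ]).imI = 0 ∧
      (imBasis 1 : ℍ[ℝ]).imJ = 1 ∧ (imBasis 1 : ℍ[ℝ]).imK = 0 := ⟨rfl, rfl, rfl, rfl⟩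
  have e2 : (imBasis 2 : ℍ[ℝ]).re = 0 ∧ (imBasis 2 : ℍ[ℝ]).imI = 0 ∧
      (imBasis 2 : ℍ[ℝ]).imJ = 0 ∧ (imBasis 2 : ℍ[ℝ]).imK = 1 := ⟨rfl, rfl, rfl, rfl⟩
  have hb01 : imProj ((imBasis 0 : ℍ[ℝ]) * imBasis 1 - imBasis 1 * imBasis 0) =
      (2 : ℝ) • imBasis 2 := by
    apply Subtype.ext
    rw [coe_imProj (by rw [Quaternion.re_sub, re_mul_comm, sub_self]), Submodule.coe_smul]
    ext <;> simp only [Quaternion.re_sub, Quaternion.imI_sub, Quaternion.imJ_sub,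
      Quaternion.imK_sub, Quaternion.re_mul, Quaternion.imI_mul, Quaternion.imJ_mul,
      Quaternion.imK_mul, Quaternion.re_smul, Quaternion.imI_smul, Quaternion.imJ_smul,
      Quaternion.imK_smul, e0, e1, e2] <;> norm_num
  have hb12 : imProj ((imBasis 1 : ℍ[ℝ]) * imBasis 2 - imBasis 2 * imBasis 1) =
      (2 : ℝ) • imBasis 0 := by
    apply Subtype.ext
    rw [coe_imProj (by rw [Quaternion.re_sub, re_mul_comm, sub_self]), Submodule.coe_smul]
    ext <;> simp only [Quaternion.re_sub, Quaternion.imI_sub, Quaternion.imJ_sub,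
      Quaternion.imK_sub, Quaternion.re_mul, Quaternion.imI_mul, Quaternion.imJ_mul,
      Quaternion.imK_mul, Quaternion.re_smul, Quaternion.imI_smul, Quaternion.imJ_smul,
      Quaternion.imK_smul, e0, e1, e2] <;> norm_num
  have hb20 : imProj ((imBasis 2 : ℍ[ℝ]) * imBasis 0 - imBasis 0 * imBasis 2) =
      (2 : ℝ) • imBasis 1 := by
    apply Subtype.ext
    rw [coe_imProj (by rw [Quaternion.re_sub, re_mul_comm, sub_self]), Submodule.coe_smul]
    ext <;> simp only [Quaternion.re_sub, Quaternion.imI_sub, Quaternion.imJ_sub,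
      Quaternion.imK_sub, Quaternion.re_mul, Quaternion.imI_mul, Quaternion.imJ_mul,
      Quaternion.imK_mul, Quaternion.re_smul, Quaternion.imI_smul, Quaternion.imJ_smul,
      Quaternion.imK_smul, e0, e1, e2] <;> norm_num
  have h01 := fun j => (hρ j (imBasis 0) (imBasis 1)).symm
  have h12 := fun j => (hρ j (imBasis 1) (imBasis 2)).symm
  have h20 := fun j => (hρ j (imBasis 2) (imBasis 0)).symm
  simp only [hb01, hb12, hb20, map_smul] at h01 h12 h20
  have htr : ∀ j, IsImTriple fun a => (Pi.single j (ρ j (imBasis a)) : SpheroidLie n) := fun j =>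
    ⟨by rw [lieBr_smul_single, h01, Pi.single_smul], by rw [lieBr_smul_single, h12, Pi.single_smul],
      by rw [lieBr_smul_single, h20, Pi.single_smul]⟩
  have hsum := hB.map_sum (fun j a => ρ j (imBasis a)) htr Finset.univ
  have hfun : (∑ j, fun a => (Pi.single j (ρ j (imBasis a)) : SpheroidLie n)) =
      fun a j => ρ j (imBasis a) := by
    ext1 a
    rw [Finset.sum_apply]
    exact Finset.univ_sum_single _
  rw [hfun] at hsum
  rw [hsum]
  refine Finset.sum_congr rfl fun j _ => ?_
  -- On one factor a `3`-form is a multiple of the determinant. The relation `[ρ𝐣, ρ𝐤] = 2 ρ𝐢` says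
  -- that `ρ𝐢` is the cross product of `ρ𝐣` and `ρ𝐤`, so the determinant of the three is `|ρ𝐢|²`.
  have hdet := alternating_im_eq_det (B.compLinearMap
    (LinearMap.single ℝ (fun _ : Fin n => imQuaternion) j)) (fun a => ρ j (imBasis a))
  refine hdet.trans ?_
  change _ * (B fun a => lieBasis j a) = _
  congr 1
  have c01 := congrArg Subtype.val (h01 j)
  have c12 := congrArg Subtype.val (h12 j)
  have c20 := congrArg Subtype.val (h20 j)
  rw [coe_imProj (by rw [Quaternion.re_sub, re_mul_comm, sub_self])] at c01 c12 c20
  have r0 : (ρ j (imBasis 0) : ℍ[ℝ]).re = 0 := (ρ j (imBasis 0)).2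
  have r1 : (ρ j (imBasis 1) : ℍ[ℝ]).re = 0 := (ρ j (imBasis 1)).2
  have r2 : (ρ j (imBasis 2) : ℍ[ℝ]).re = 0 := (ρ j (imBasis 2)).2
  have n0 : ‖(ρ j (imBasis 0) : ℍ[ℝ])‖ ^ 2 = (ρ j (imBasis 0) : ℍ[ℝ]).imI ^ 2 +
      (ρ j (imBasis 0) : ℍ[ℝ]).imJ ^ 2 + (ρ j (imBasis 0) : ℍ[ℝ]).imK ^ 2 := by
    rw [sq, ← Quaternion.normSq_eq_norm_mul_self, Quaternion.normSq_def', r0]; ring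
  rw [n0, Matrix.det_fin_three]
  have i1 := congrArg QuaternionAlgebra.imI c12
  have i2 := congrArg QuaternionAlgebra.imJ c12
  have i3 := congrArg QuaternionAlgebra.imK c12
  simp only [Submodule.coe_smul, Quaternion.imI_sub, Quaternion.imJ_sub, Quaternion.imK_sub,
    Quaternion.imI_mul, Quaternion.imJ_mul, Quaternion.imK_mul, Quaternion.imI_smul,
    Quaternion.imJ_smul, Quaternion.imK_smul, r1, r2, smul_eq_mul] at i1 i2 i3
  simp only [Matrix.of_apply, imEquiv, LinearEquiv.coe_mk, LinearMap.coe_mk, AddHom.coe_mk,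
    Matrix.cons_val_zero, Matrix.cons_val_one, Matrix.cons_val]
  linear_combination (1 / 2 : ℝ) * (ρ j (imBasis 0) : ℍ[ℝ]).imI * i1 +
    (1 / 2 : ℝ) * (ρ j (imBasis 0) : ℍ[ℝ]).imJ * i2 +
    (1 / 2 : ℝ) * (ρ j (imBasis 0) : ℍ[ℝ]).imK * i3

end Tetraplectic

/-! ### Pullbacks of forms along maps from a vector space. -/

namespace Tetraplectic

open Set Filter Topology MeasureTheory Module

set_option synthInstance.maxHeartbeats 400000 in
noncomputable local instance instGroupSpheroid (n : ℕ) : Group (Spheroid n) := inferInstance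

set_option synthInstance.maxHeartbeats 400000 in
noncomputable local instance instSemigroupSpheroid (n : ℕ) : Semigroup (Spheroid n) := inferInstance

set_option synthInstance.maxHeartbeats 400000 in
noncomputable local instance instMonoidSpheroid (n : ℕ) : Monoid (Spheroid n) := inferInstance

section Pullback

variable {W E : Type*} [NormedAddCommGroup W] [NormedSpace ℝ W]
  [NormedAddCommGroup E] [NormedSpace ℝ E] {k : ℕ}

/-- Alternatization, normalized to be a retraction onto the alternating maps. -/
noncomputable def alternatizationRetraction :
    ContinuousMultilinearMap ℝ (fun _ : Fin k => W) ℝ →L[ℝ] W [⋀^Fin k]→L[ℝ] ℝ :=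
  LinearMap.mkContinuous
    { toFun := fun f => ((k.factorial : ℝ)⁻¹) • f.alternatization
      map_add' := fun f g => by rw [map_add, smul_add]
      map_smul' := fun c f => by
        ext v
        change ((k.factorial : ℝ)⁻¹) • (c • f).alternatization v =
          c • ((k.factorial : ℝ)⁻¹) • f.alternatization v
        rw [smul_comm c, ContinuousMultilinearMap.alternatization_apply_apply,
          ContinuousMultilinearMap.alternatization_apply_apply, Finset.smul_sum (r := c)]
        congr 1
        refine Finset.sum_congr rfl fun σ _ => ?_
        rw [smul_comm c]
        rfl }
    ((k.factorial : ℝ)⁻¹ * (k.factorial : ℝ)) fun f => by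
      change ‖((k.factorial : ℝ)⁻¹) • f.alternatization‖ ≤ _
      rw [norm_smul, norm_inv, RCLike.norm_natCast, mul_assoc]
      gcongr
      refine ContinuousAlternatingMap.opNorm_le_bound _ (by positivity) fun v => ?_
      rw [ContinuousMultilinearMap.alternatization_apply_apply]
      refine (norm_sum_le _ _).trans ?_
      have : ∀ σ ∈ (Finset.univ : Finset (Equiv.Perm (Fin k))),
          ‖Equiv.Perm.sign σ • f fun i => v (σ i)‖ ≤ ‖f‖ * ∏ i, ‖v i‖ := fun σ _ => by
        have h := f.le_opNorm fun i => v (σ i)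
        rw [Equiv.prod_comp σ fun i => ‖v i‖] at h
        rcases Int.units_eq_one_or (Equiv.Perm.sign σ) with hs | hs <;> rw [hs] <;> simpa using h
      refine (Finset.sum_le_card_nsmul _ _ _ this).trans_eq ?_
      rw [Finset.card_univ, Fintype.card_perm, Fintype.card_fin, nsmul_eq_mul, mul_assoc]

theorem alternatizationRetraction_apply (f : W [⋀^Fin k]→L[ℝ] ℝ) :
    alternatizationRetraction f.toContinuousMultilinearMap = f := by
  ext v
  change ((k.factorial : ℝ)⁻¹) • (f.toContinuousMultilinearMap.alternatization v) = _
  rw [ContinuousMultilinearMap.alternatization_apply_apply]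
  have : ∀ σ ∈ (Finset.univ : Finset (Equiv.Perm (Fin k))),
      (Equiv.Perm.sign σ • f.toContinuousMultilinearMap (v ∘ σ)) = f v := fun σ _ => by
    have h := f.toAlternatingMap.map_perm v σ
    have h2 : f.toContinuousMultilinearMap (v ∘ σ) = f.toAlternatingMap (v ∘ σ) := rfl
    rw [h2, h]
    rcases Int.units_eq_one_or (Equiv.Perm.sign σ) with hs | hs <;> simp [hs]
  rw [Finset.sum_congr rfl this, Finset.sum_const, Finset.card_univ, Fintype.card_perm,
    Fintype.card_fin, nsmul_eq_mul, smul_eq_mul, inv_mul_cancel_left₀ (by positivity)]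

/-- For multilinear maps the composition is polynomial in all its entries; the continuous linear
retraction `alternatizationRetraction` brings the smoothness back to alternating maps. -/
theorem ContDiffAt.compContinuousLinearMap {η : W → E [⋀^Fin k]→L[ℝ] ℝ} {L : W → W →L[ℝ] E}
    {w : W} (hη : ContDiffAt ℝ ∞ η w) (hL : ContDiffAt ℝ ∞ L w) :
    ContDiffAt ℝ ∞ (fun w => (η w).compContinuousLinearMap (L w)) w := by
  have h1 : ContDiffAt ℝ ∞ (fun w => (η w).toContinuousMultilinearMap) w :=
    (ContinuousAlternatingMap.toContinuousMultilinearMapLI (𝕜 := ℝ) (E := E) (F := ℝ)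
      (ι := Fin k)).contDiff.contDiffAt.comp w hη
  have h2 : ContDiffAt ℝ ∞ (fun w => ((fun _ => L w : Fin k → W →L[ℝ] E),
      (η w).toContinuousMultilinearMap)) w := (contDiffAt_pi.2 fun _ => hL).prodMk h1
  have h3 := (ContinuousMultilinearMap.cpolynomialAt_uncurry_compContinuousLinearMap (𝕜 := ℝ)
    (Fm := fun _ : Fin k => W) (Em := fun _ : Fin k => E) (G := ℝ)
    (q := ((fun _ => L w), (η w).toContinuousMultilinearMap))).contDiffAt (n := ∞)
  have h4 := alternatizationRetraction.contDiff.contDiffAt.comp w (h3.comp w h2)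
  refine h4.congr_of_eventuallyEq (Eventually.of_forall fun w => ?_)
  exact (alternatizationRetraction_apply ((η w).compContinuousLinearMap (L w))).symm

variable {d : ℕ} {X : Type*} [TopologicalSpace X] [ChartedSpace (EuclideanSpace ℝ (Fin d)) X]

/-- The value of a form, as an alternating map on the model space. -/
def formAt (θ : DForm d k X) (x : X) : EuclideanSpace ℝ (Fin d) [⋀^Fin k]→L[ℝ] ℝ := θ x

/-- The pullback of a form on `X` under a map from a vector space. -/
noncomputable def pullAlong (p : W → X) (θ : DForm d k X)
    (w : W) : W [⋀^Fin k]→L[ℝ] ℝ :=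
  (formAt θ (p w)).compContinuousLinearMap (mder 𝓘(ℝ, W) (𝓡 d) p w)

theorem pullAlong_apply (p : W → X) (θ : DForm d k X)
    (w : W) (v : Fin k → W) :
    pullAlong p θ w v = formAt θ (p w) fun i => mder 𝓘(ℝ, W) (𝓡 d) p w (v i) := rfl

theorem pullAlong_congr {p q : W → X} (θ : DForm d k X)
    {w : W} (h : p =ᶠ[𝓝 w] q) : pullAlong p θ w = pullAlong q θ w := by
  rw [pullAlong, pullAlong, mder_congr h, h.eq_of_nhds]

theorem inChart_eq_pullAlong (θ : DForm d k X) (x : X) :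
    θ.inChart x = pullAlong (chartAt (EuclideanSpace ℝ (Fin d)) x).symm θ := rfl

/-- The derivative of a map along a line. -/
theorem mder_line {p : W → X} {w : W} (hp : MDifferentiableAt 𝓘(ℝ, W) (𝓡 d) p w) (u : W) :
    mder 𝓘(ℝ, W) (𝓡 d) p w u = mder 𝓘(ℝ, ℝ) (𝓡 d) (fun r : ℝ => p (w + r • u)) 0 1 := by
  have hl : HasFDerivAt (fun r : ℝ => w + r • u) ((1 : ℝ →L[ℝ] ℝ).smulRight u) 0 :=
    ((1 : ℝ →L[ℝ] ℝ).smulRight u).hasFDerivAt.const_add w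
  have hp' : MDifferentiableAt 𝓘(ℝ, W) (𝓡 d) p (w + (0 : ℝ) • u) := by simpa using hp
  have h := mder_comp_apply (f := fun r : ℝ => w + r • u) (0 : ℝ) hp'
    hl.differentiableAt.mdifferentiableAt (1 : ℝ)
  rw [mder_eq_fderiv, hl.fderiv] at h
  have h0 : w + (0 : ℝ) • u = w := by simp
  rw [h0] at h
  simpa [Function.comp_def] using h.symm

variable [IsManifold (𝓡 d) ∞ X]

/-- Near `w` the map `p` factors through the chart at `p w`. This reduces smoothness and closedness
of the pullback to maps between vector spaces. -/
theorem pullAlong_eventuallyEq {p : W → X} {w : W}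
    (hp : ∀ᶠ w in 𝓝 w, ContMDiffAt 𝓘(ℝ, W) (𝓡 d) ∞ p w) (θ : DForm d k X) :
    pullAlong p θ =ᶠ[𝓝 w] fun u =>
      (θ.inChart (p w) (chartAt (EuclideanSpace ℝ (Fin d)) (p w) (p u))).compContinuousLinearMap
        (fderiv ℝ (chartAt (EuclideanSpace ℝ (Fin d)) (p w) ∘ p) u) := by
  let φ := chartAt (EuclideanSpace ℝ (Fin d)) (p w)
  have hs : ∀ᶠ u in 𝓝 w, p u ∈ φ.source :=
    hp.self_of_nhds.continuousAt (φ.open_source.mem_nhds (mem_chart_source _ _))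
  filter_upwards [hp, hs, hs.eventually_nhds] with u hu hus hev
  have ht : φ (p u) ∈ φ.target := φ.map_source hus
  have he : φ.symm ∘ (φ ∘ p) =ᶠ[𝓝 u] p := by
    filter_upwards [hev] with a ha using φ.left_inv ha
  rw [← pullAlong_congr θ he, inChart_eq_pullAlong]
  ext v
  rw [pullAlong_apply, ContinuousAlternatingMap.compContinuousLinearMap_apply, pullAlong_apply]
  have hd : MDifferentiableAt 𝓘(ℝ, W) (𝓡 d) (φ ∘ p) u :=
    ((contMDiffAt_chart (p w) hus).comp u hu).mdifferentiableAt (by simp)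
  have : ∀ i, mder 𝓘(ℝ, W) (𝓡 d) (φ.symm ∘ (φ ∘ p)) u (v i) =
      mder (𝓡 d) (𝓡 d) φ.symm (φ (p u)) (fderiv ℝ (φ ∘ p) u (v i)) := fun i => by
    rw [mder_comp_apply u ((contMDiffAt_chart_symm (p w) ht).mdifferentiableAt (by simp)) hd,
      mder_eq_fderiv]
    rfl
  simp only [this]
  rfl

theorem contDiffAt_comp_of_contMDiffAt {p : W → X} {w : W}
    (hp : ContMDiffAt 𝓘(ℝ, W) (𝓡 d) ∞ p w) :
    ContDiffAt ℝ ∞ (chartAt (EuclideanSpace ℝ (Fin d)) (p w) ∘ p) w :=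
  contMDiffAt_iff_contDiffAt.1 ((contMDiffAt_chart (p w) (mem_chart_source _ _)).comp w hp)

theorem contDiffAt_pullAlong {p : W → X} {w : W}
    (hp : ∀ᶠ w in 𝓝 w, ContMDiffAt 𝓘(ℝ, W) (𝓡 d) ∞ p w) {θ : DForm d k X} (hθ : θ.IsSmooth) :
    ContDiffAt ℝ ∞ (pullAlong p θ) w := by
  refine ContDiffAt.congr_of_eventuallyEq ?_ (pullAlong_eventuallyEq hp θ)
  have hF := contDiffAt_comp_of_contMDiffAt hp.self_of_nhds
  refine ContDiffAt.compContinuousLinearMap ?_ (hF.fderiv_right (by simp))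
  exact ((hθ (p w)).contDiffAt ((chartAt _ (p w)).open_target.mem_nhds
    (mem_chart_target _ _))).comp w hF

theorem extDeriv_pullAlong {p : W → X} {w : W}
    (hp : ∀ᶠ w in 𝓝 w, ContMDiffAt 𝓘(ℝ, W) (𝓡 d) ∞ p w) {θ : DForm d k X} (hθ : θ.IsSmooth)
    (hθc : θ.IsClosed) : extDeriv (pullAlong p θ) w = 0 := by
  rw [(pullAlong_eventuallyEq hp θ).extDeriv_eq]
  have hF := contDiffAt_comp_of_contMDiffAt hp.self_of_nhds
  have ht := mem_chart_target (EuclideanSpace ℝ (Fin d)) (p w)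
  have hω := ((hθ (p w)).contDiffAt ((chartAt _ (p w)).open_target.mem_nhds ht)).differentiableAt
    (by simp)
  have h := extDeriv_pullback (x := w) hω hF (by simpa using ENat.LEInfty.out)
  refine h.trans ?_
  have hz := hθc (p w) _ ht
  simp only [Function.comp_apply]
  rw [hz]
  ext v
  rfl

end Pullback

/-! ### The infinitesimal action. -/

section Action

variable {d n : ℕ} {X : Type*} [TopologicalSpace X] [ChartedSpace (EuclideanSpace ℝ (Fin d)) X]
  [MulAction (Spheroid n) X]

theorem IsSmoothAction.comp {E H M : Type*} [NormedAddCommGroup E] [NormedSpace ℝ E]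
    [TopologicalSpace H] {I : ModelWithCorners ℝ E H} [TopologicalSpace M] [ChartedSpace H M]
    (hact : IsSmoothAction d n X) {b : M → SpheroidLie n} {q : M → X} {x : M}
    (hb : ContMDiffAt I 𝓘(ℝ, SpheroidLie n) ∞ b x) (hq : ContMDiffAt I (𝓡 d) ∞ q x) :
    ContMDiffAt I (𝓡 d) ∞ (fun y => spheroidExp (b y) • q y) x :=
  (hact (spheroidExp (b x), q x)).comp x
    ((contMDiff_spheroidExp.contMDiffAt.comp x hb).prodMk hq)

theorem IsSmoothAction.contMDiff_smul (hact : IsSmoothAction d n X) (g : Spheroid n) :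
    ContMDiff (𝓡 d) (𝓡 d) ∞ fun x : X => g • x :=
  ContMDiff.comp (g := fun p : Spheroid n × X => p.1 • p.2) hact
    (contMDiff_const.prodMk contMDiff_id)

/-- The infinitesimal action `σₙ → T_x X`. -/
noncomputable def infAct (x : X) : SpheroidLie n →L[ℝ] EuclideanSpace ℝ (Fin d) :=
  mder 𝓘(ℝ, SpheroidLie n) (𝓡 d) (fun b : SpheroidLie n => spheroidExp b • x) 0

theorem IsSmoothAction.contMDiff_orbit (hact : IsSmoothAction d n X) (x : X) :
    ContMDiff 𝓘(ℝ, SpheroidLie n) (𝓡 d) ∞ fun b : SpheroidLie n => spheroidExp b • x :=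
  fun _ => hact.comp contMDiffAt_id contMDiffAt_const

theorem IsSmoothAction.infAct_eq (hact : IsSmoothAction d n X) (x : X) (b : SpheroidLie n) :
    infAct (d := d) x b = mder 𝓘(ℝ, ℝ) (𝓡 d) (fun t : ℝ => spheroidExp (t • b) • x) 0 1 := by
  have h := mder_line ((hact.contMDiff_orbit x).mdifferentiable (by simp) 0) b
  simpa [infAct] using h

theorem IsSmoothAction.fundField_eq (hact : IsSmoothAction d n X) (b : SpheroidLie n) (x : X) :
    fundField b x = infAct (d := d) x b := (hact.infAct_eq x b).symm

theorem spheroidExp_smul_conj (g : Spheroid n) (b : SpheroidLie n) (x : X) :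
    spheroidExp b • g • x = g • spheroidExp (spheroidAd g⁻¹ b) • x := by
  rw [spheroidExp_conj, inv_inv, ← mul_smul g, ← mul_assoc, ← mul_assoc, mul_inv_cancel, one_mul,
    mul_smul]

theorem IsSmoothAction.mder_smul_curve (hact : IsSmoothAction d n X) (g : Spheroid n) {q : ℝ → X}
    (hq : MDifferentiableAt 𝓘(ℝ, ℝ) (𝓡 d) q 0) :
    mder 𝓘(ℝ, ℝ) (𝓡 d) (fun t => g • q t) 0 1 =
      mder (𝓡 d) (𝓡 d) (fun x : X => g • x) (q 0) (mder 𝓘(ℝ, ℝ) (𝓡 d) q 0 1) :=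
  mder_comp_apply (g := fun x : X => g • x) (0 : ℝ)
    ((hact.contMDiff_smul g).mdifferentiable (by simp) _) hq 1

theorem IsSmoothAction.mdifferentiable_exp_curve (hact : IsSmoothAction d n X) (b : SpheroidLie n)
    (x : X) : MDifferentiableAt 𝓘(ℝ, ℝ) (𝓡 d) (fun t : ℝ => spheroidExp (t • b) • x) 0 :=
  (hact.comp (I := 𝓘(ℝ, ℝ)) (b := fun t : ℝ => t • b)
    (contDiff_id.smul contDiff_const).contMDiff.contMDiffAt
    contMDiffAt_const).mdifferentiableAt (by simp)

theorem IsSmoothAction.mder_smul_exp (hact : IsSmoothAction d n X) (g : Spheroid n)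
    (b : SpheroidLie n) (x : X) :
    mder 𝓘(ℝ, ℝ) (𝓡 d) (fun t : ℝ => g • spheroidExp (t • b) • x) 0 1 =
      mder (𝓡 d) (𝓡 d) (fun x : X => g • x) x (infAct x b) := by
  have h := hact.mder_smul_curve g (hact.mdifferentiable_exp_curve b x)
  rw [hact.infAct_eq]
  simpa [spheroidExp_zero] using h

/-- The infinitesimal action is equivariant. -/
theorem IsSmoothAction.infAct_smul (hact : IsSmoothAction d n X) (g : Spheroid n)
    (b : SpheroidLie n) (x : X) :
    infAct (g • x) b =
      mder (𝓡 d) (𝓡 d) (fun x : X => g • x) x (infAct x (spheroidAd g⁻¹ b)) := by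
  rw [hact.infAct_eq, ← hact.mder_smul_exp]
  congr 2
  ext t
  rw [spheroidExp_smul_conj, spheroidAd_smul]

theorem IsInvariantForm.apply {ψ : DForm d 4 X} (hinv : IsInvariantForm (n := n) ψ)
    (g : Spheroid n) (x : X) (v : Fin 4 → EuclideanSpace ℝ (Fin d)) :
    formAt ψ (g • x) (fun i => mder (𝓡 d) (𝓡 d) (fun x : X => g • x) x (v i)) = formAt ψ x v :=
  DFunLike.congr_fun (congrFun (hinv g) x) v

/-- A point at which a generating vector field vanishes is fixed by the one-parameter group. -/
theorem IsSmoothAction.smul_eq_of_infAct_eq_zero [T2Space X] [IsManifold (𝓡 d) ∞ X]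
    (hact : IsSmoothAction d n X) {b : SpheroidLie n} {x : X} (h : infAct (d := d) x b = 0)
    (t : ℝ) : spheroidExp (t • b) • x = x := by
  have : IsManifold (𝓡 d) 1 X := IsManifold.of_le (n := ∞) (by simp)
  -- The orbit curve is an integral curve of the zero field, its velocity at time `t` being the
  -- image, under the action of `exp (t b)`, of its velocity at time `0`. Uniqueness of integral
  -- curves then makes it constant.
  have hγ : IsMIntegralCurve (I := 𝓡 d) (fun t : ℝ => spheroidExp (t • b) • x)
      (fun y => (0 : TangentSpace (𝓡 d) y)) := fun t => by
    have hd : MDifferentiableAt 𝓘(ℝ, ℝ) (𝓡 d) (fun t : ℝ => spheroidExp (t • b) • x) t :=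
      (hact.comp (I := 𝓘(ℝ, ℝ)) (b := fun t : ℝ => t • b)
        (contDiff_id.smul contDiff_const).contMDiff.contMDiffAt
        contMDiffAt_const).mdifferentiableAt (by simp)
    have h0 : mder 𝓘(ℝ, ℝ) (𝓡 d) (fun t : ℝ => spheroidExp (t • b) • x) t = 0 := by
      ext1
      rw [mder_line hd]
      have he : (fun r : ℝ => spheroidExp ((t + r • (1 : ℝ)) • b) • x) =
          fun r : ℝ => spheroidExp (t • b) • spheroidExp (r • b) • x := by
        ext r
        rw [smul_eq_mul, mul_one, spheroidExp_add_smul]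
        exact mul_smul _ _ _
      rw [he, hact.mder_smul_exp, h, map_zero]
      rfl
    have h1 := hd.hasMFDerivAt
    have h2 : mfderiv 𝓘(ℝ, ℝ) (𝓡 d) (fun t : ℝ => spheroidExp (t • b) • x) t =
        (1 : ℝ →L[ℝ] ℝ).smulRight (0 : TangentSpace (𝓡 d) (spheroidExp (t • b) • x)) := by
      refine Eq.trans h0 ?_
      ext1
      exact (smul_zero (A := EuclideanSpace ℝ (Fin d)) (1 : ℝ)).symm
    rw [h2] at h1
    exact h1
  have hc : IsMIntegralCurve (I := 𝓡 d) (fun _ : ℝ => x)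
      (fun y => (0 : TangentSpace (𝓡 d) y)) := fun t => by
    have h1 := hasMFDerivAt_const (I := 𝓘(ℝ, ℝ)) (I' := 𝓡 d) x t
    have h2 : (0 : TangentSpace 𝓘(ℝ, ℝ) t →L[ℝ] TangentSpace (𝓡 d) x) =
        (1 : ℝ →L[ℝ] ℝ).smulRight (0 : TangentSpace (𝓡 d) x) := by
      ext1
      exact (smul_zero (A := EuclideanSpace ℝ (Fin d)) (1 : ℝ)).symm
    rw [h2] at h1
    exact h1
  have hv : ContMDiff (𝓡 d) (𝓡 d).tangent 1
      (fun y : X => (⟨y, 0⟩ : TangentBundle (𝓡 d) X)) :=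
    Bundle.contMDiff_zeroSection ℝ (TangentSpace (𝓡 d) : X → Type _)
  have := isMIntegralCurve_Ioo_eq_of_contMDiff_boundaryless (t₀ := 0) hv hγ hc
    (by simp [spheroidExp_zero])
  exact congrFun this t

theorem IsSmoothAction.infAct_eq_zero (hact : IsSmoothAction d n X) {b : SpheroidLie n} {x : X}
    (h : ∀ t : ℝ, spheroidExp (t • b) • x = x) : infAct (d := d) x b = 0 := by
  rw [hact.infAct_eq]
  simp only [h]
  rw [mder_const]
  rfl

end Action

end Tetraplectic

/-! ### The cocycle relation obtained from closedness of `ψ`. -/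

namespace Tetraplectic

open Set Filter Topology MeasureTheory Module

section Cocycle

variable {d n : ℕ} {X : Type*} [TopologicalSpace X] [ChartedSpace (EuclideanSpace ℝ (Fin d)) X]

theorem spheroidAd_exp_of_commute {x y : SpheroidLie n} (h : lieBr x y = 0) (t : ℝ) :
    spheroidAd (spheroidExp (t • x)) y = y := by
  ext1 j; apply Subtype.ext
  have hc : Commute (t • (x j : ℍ[ℝ])) (y j) := by
    refine Commute.smul_left ?_ t
    rw [commute_iff_eq, ← sub_eq_zero, ← coe_lieBr, h]
    rfl
  have := hc.exp_left
  rw [coe_spheroidAd, mul_inv_eq_iff_eq_mul₀ (sphere_coe_ne_zero _)]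
  exact this

theorem exists_curve [IsManifold (𝓡 d) ∞ X] (x : X) (v : EuclideanSpace ℝ (Fin d)) :
    ∃ χ : ℝ → X, (∀ᶠ r in 𝓝 0, ContMDiffAt 𝓘(ℝ, ℝ) (𝓡 d) ∞ χ r) ∧ χ 0 = x ∧
      mder 𝓘(ℝ, ℝ) (𝓡 d) χ 0 1 = v := by
  let φ := chartAt (EuclideanSpace ℝ (Fin d)) x
  have ht : φ x ∈ φ.target := mem_chart_target _ x
  obtain ⟨u, hu⟩ := (bijective_mder_chart_symm x ht).2 v
  have hl : ContDiff ℝ ∞ fun r : ℝ => φ x + r • u := by fun_prop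
  refine ⟨fun r => φ.symm (φ x + r • u), ?_, ?_, ?_⟩
  · have : ∀ᶠ r in 𝓝 (0 : ℝ), φ x + r • u ∈ φ.target :=
      hl.continuous.continuousAt (φ.open_target.mem_nhds (by simpa using ht))
    filter_upwards [this] with r hr
    exact (contMDiffAt_chart_symm x hr).comp r hl.contMDiff.contMDiffAt
  · simpa using φ.left_inv (mem_chart_source _ x)
  · rw [← mder_line ((contMDiffAt_chart_symm x ht).mdifferentiableAt (by simp)), hu]

theorem hasDerivAt_formAt {θ : DForm d 4 X} {x : X} {m : Fin 4 → EuclideanSpace ℝ (Fin d)}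
    (i : Fin 4) {c : ℝ → EuclideanSpace ℝ (Fin d)} {c' : EuclideanSpace ℝ (Fin d)} {t : ℝ}
    (hc : HasDerivAt c c' t) :
    HasDerivAt (fun s => formAt θ x (Function.update m i (c s)))
      (formAt θ x (Function.update m i c')) t :=
  ((formAt θ x).toContinuousMultilinearMap.toContinuousLinearMap m
    i).hasFDerivAt.comp_hasDerivAt t hc

/-- The `i`-th term of `dη(e₀, …, e_k)` at the origin involves `η` only along the `i`-th axis, so
one-variable derivatives suffice. -/
theorem sum_deriv_eq_zero_of_extDeriv {k : ℕ} {W : Type*} [NormedAddCommGroup W] [NormedSpace ℝ W]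
    {η : W → W [⋀^Fin k]→L[ℝ] ℝ} (hη : DifferentiableAt ℝ η 0) (h0 : extDeriv η 0 = 0)
    (e : Fin (k + 1) → W) (f' : Fin (k + 1) → ℝ)
    (hf : ∀ i, HasDerivAt (fun s : ℝ => η (s • e i) (i.removeNth e)) (f' i) 0) :
    ∑ i, (-1) ^ i.val * f' i = 0 := by
  have h := extDeriv_apply hη e
  rw [h0] at h
  refine Eq.trans (Finset.sum_congr rfl fun i _ => ?_) h.symm
  have h1 : DifferentiableAt ℝ (fun w => η w (i.removeNth e)) ((0 : ℝ) • e i) := by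
    rw [zero_smul]
    exact hη.continuousAlternatingMap_apply_const _
  have h2 := h1.hasFDerivAt.comp_hasDerivAt (0 : ℝ) ((hasDerivAt_id (0 : ℝ)).smul_const (e i))
  rw [(hf i).unique h2, zero_smul, one_smul]
  simp

variable [MulAction (Spheroid n) X] [IsManifold (𝓡 d) ∞ X]

/-- `ψ` is pulled back along the five-parameter map `exp(u₀x) exp(u₁y) exp(u₂z) exp(u₃w) χ(u₄)`,
where `χ` has velocity `v` at `q`. In the expansion of its exterior derivative at `0` only the axes
of `y` and `w` contribute, each through the derivative of an adjoint action. -/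
theorem IsSmoothAction.cocycle_identity (hact : IsSmoothAction d n X) {ψ : DForm d 4 X}
    (hψs : ψ.IsSmooth) (hψc : ψ.IsClosed) (hinv : IsInvariantForm (n := n) ψ) (q : X)
    (v : EuclideanSpace ℝ (Fin d)) {x y z w : SpheroidLie n}
    (h4 : ∀ᶠ p in 𝓝 q, formAt ψ p ![infAct p x, infAct p y, infAct p z, infAct p w] = 0)
    (hxz : lieBr x z = 0) (hxw : lieBr x w = 0) (hyz : lieBr y z = 0) (hyw : lieBr y w = 0) :
    formAt ψ q ![infAct q (lieBr x y), infAct q z, infAct q w, v] +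
      formAt ψ q ![infAct q x, infAct q y, infAct q (lieBr z w), v] = 0 := by
  obtain ⟨χ, hχ, hχ0, hχv⟩ := exists_curve q v
  let P : (Fin 5 → ℝ) → X := fun u => spheroidExp (u 0 • x) • spheroidExp (u 1 • y) •
    spheroidExp (u 2 • z) • spheroidExp (u 3 • w) • χ (u 4)
  have hPs : ∀ u : Fin 5 → ℝ, ContMDiffAt 𝓘(ℝ, ℝ) (𝓡 d) ∞ χ (u 4) →
      ContMDiffAt 𝓘(ℝ, Fin 5 → ℝ) (𝓡 d) ∞ P u := fun u hu => by
    have hl : ∀ (i : Fin 5) (b : SpheroidLie n),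
        ContMDiffAt 𝓘(ℝ, Fin 5 → ℝ) 𝓘(ℝ, SpheroidLie n) ∞ (fun u : Fin 5 → ℝ => u i • b) u :=
      fun i b => ((contDiff_apply ℝ ℝ i).smul contDiff_const).contMDiff.contMDiffAt
    refine hact.comp (hl 0 x) (hact.comp (hl 1 y) (hact.comp (hl 2 z) (hact.comp (hl 3 w) ?_)))
    exact hu.comp u (contDiff_apply ℝ ℝ (4 : Fin 5)).contMDiff.contMDiffAt
  have hP : ∀ᶠ u in 𝓝 (0 : Fin 5 → ℝ), ContMDiffAt 𝓘(ℝ, Fin 5 → ℝ) (𝓡 d) ∞ P u :=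
    (Tendsto.eventually ((continuous_apply (4 : Fin 5)).tendsto (0 : Fin 5 → ℝ)) hχ).mono hPs
  have hext := extDeriv_pullAlong hP hψs hψc
  have hdiff := (contDiffAt_pullAlong hP hψs).differentiableAt (by simp)
  let e : Fin 5 → Fin 5 → ℝ := fun i => Pi.single i 1
  have hm : ∀ (i j : Fin 5) (s : ℝ), ContMDiffAt 𝓘(ℝ, ℝ) (𝓡 d) ∞ χ ((s • e i) 4) →
      mder 𝓘(ℝ, Fin 5 → ℝ) (𝓡 d) P (s • e i) (e j) =
        mder 𝓘(ℝ, ℝ) (𝓡 d) (fun r : ℝ => P (s • e i + r • e j)) 0 1 := fun i j s hs =>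
    mder_line ((hPs _ hs).mdifferentiableAt (by simp)) _
  have hχ' := hχ.self_of_nhds
  -- Invariance of `ψ` moves the evaluation from `g • q` back to `q`, where the point no longer
  -- depends on `s`.
  have eval : ∀ (i : Fin 5) (s : ℝ) (g : Spheroid n) (c : Fin 4 → EuclideanSpace ℝ (Fin d)),
      P (s • e i) = g • q → (∀ k, mder 𝓘(ℝ, Fin 5 → ℝ) (𝓡 d) P (s • e i) (e (i.succAbove k)) =
        mder (𝓡 d) (𝓡 d) (fun x : X => g • x) q (c k)) →
      pullAlong P ψ (s • e i) (i.removeNth e) = formAt ψ q c := fun i s g c hg hc => by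
    rw [← hinv.apply g q c, pullAlong_apply, ← hg]
    congr 1
    ext1 k
    exact hc k
  have hmv : ∀ g : Spheroid n, mder 𝓘(ℝ, ℝ) (𝓡 d) (fun r => g • χ r) 0 1 =
      mder (𝓡 d) (𝓡 d) (fun x : X => g • x) q v := fun g => by
    rw [hact.mder_smul_curve g (hχ'.mdifferentiableAt (by simp)), hχ0, hχv]
  have hme : ∀ (g : Spheroid n) (b : SpheroidLie n),
      mder 𝓘(ℝ, ℝ) (𝓡 d) (fun r : ℝ => spheroidExp (r • b) • g • q) 0 1 =
      mder (𝓡 d) (𝓡 d) (fun x : X => g • x) q (infAct q (spheroidAd g⁻¹ b)) := fun g b => by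
    rw [← hact.infAct_eq, hact.infAct_smul]
  have had : ∀ (s : ℝ) (b a : SpheroidLie n),
      spheroidAd (spheroidExp (s • b))⁻¹ a = spheroidAd (spheroidExp (s • -b)) a := fun s b a => by
    rw [← spheroidExp_neg_smul, smul_neg]
  have hneg : ∀ a b : SpheroidLie n, lieBr a b = 0 → lieBr (-b) a = 0 := fun a b h => by
    ext1 j; apply Subtype.ext
    have := congrArg (fun c : SpheroidLie n => (c j : ℍ[ℝ])) h
    simp only [coe_lieBr] at this
    rw [coe_lieBr]
    simpa [sub_eq_add_neg, add_comm] using this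
  have hbr : ∀ a b : SpheroidLie n, lieBr (-b) a = lieBr a b := fun a b => by
    ext1 j; apply Subtype.ext
    rw [coe_lieBr, coe_lieBr]
    simp [sub_eq_add_neg, add_comm]
  have hsa : Fin.succAbove (2 : Fin 5) 1 = 1 ∧ Fin.succAbove (3 : Fin 5) 1 = 1 ∧
      Fin.succAbove (4 : Fin 5) 1 = 1 ∧ Fin.succAbove (1 : Fin 5) 2 = 3 ∧ Fin.succAbove (1 : Fin 5) 3 = 4 ∧
      Fin.succAbove (2 : Fin 5) 2 = 3 ∧ Fin.succAbove (2 : Fin 5) 3 = 4 ∧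
      Fin.succAbove (3 : Fin 5) 2 = 2 ∧ Fin.succAbove (3 : Fin 5) 3 = 4 ∧
      Fin.succAbove (4 : Fin 5) 2 = 2 ∧ Fin.succAbove (4 : Fin 5) 3 = 3 := by decide
  have hd0 : HasDerivAt (fun s : ℝ => pullAlong P ψ (s • e 0) (Fin.removeNth 0 e)) 0 0 := by
    have : (fun s : ℝ => pullAlong P ψ (s • e 0) (Fin.removeNth 0 e)) = fun _ =>
        formAt ψ q ![infAct q y, infAct q z, infAct q w, v] := by
      ext s
      refine eval 0 s (spheroidExp (s • x)) _ ?_ ?_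
      · simp [P, e, spheroidExp_zero, hχ0]
      · intro k
        rw [hm _ _ _ (by simpa [e] using hχ')]
        fin_cases k <;> simp [P, e, spheroidExp_zero, hχ0, hact.mder_smul_exp, hmv]
    rw [this]
    exact hasDerivAt_const _ _
  -- Translating back by `exp(sy)` replaces `x` by `Ad(exp(-sy)) x`, with derivative `[-y, x] = [x,
  -- y]`; `z`, `w` and `v` are untouched because their factors stand to the right of `exp(sy)`.
  have hd1 : HasDerivAt (fun s : ℝ => pullAlong P ψ (s • e 1) (Fin.removeNth 1 e))
      (formAt ψ q ![infAct q (lieBr x y), infAct q z, infAct q w, v]) 0 := by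
    have : (fun s : ℝ => pullAlong P ψ (s • e 1) (Fin.removeNth 1 e)) = fun s =>
        formAt ψ q ![infAct q (spheroidAd (spheroidExp (s • -y)) x), infAct q z, infAct q w, v] := by
      ext s
      refine eval 1 s (spheroidExp (s • y)) _ ?_ ?_
      · simp [P, e, spheroidExp_zero, hχ0]
      · intro k
        rw [hm _ _ _ (by simpa [e] using hχ')]
        fin_cases k <;> simp [P, e, spheroidExp_zero, hχ0, hact.mder_smul_exp, hmv,
          hme, had, hsa, -smul_neg]
    rw [this, ← hbr]
    have h := hasDerivAt_formAt (θ := ψ) (x := q) (m := ![0, infAct q z, infAct q w, v]) 0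
      ((infAct (d := d) q).hasFDerivAt.comp_hasDerivAt (0 : ℝ) (hasDerivAt_spheroidAd_exp (-y) x))
    have hu : ∀ c : EuclideanSpace ℝ (Fin d),
        Function.update ![0, infAct q z, infAct q w, v] 0 c = ![c, infAct q z, infAct q w, v] :=
      fun c => by ext1 k; fin_cases k <;> rfl
    simpa only [hu, Function.comp_def] using h
  -- Here `x` and `y` would be conjugated by `exp(-sz)`, but they commute with `z`.
  have hd2 : HasDerivAt (fun s : ℝ => pullAlong P ψ (s • e 2) (Fin.removeNth 2 e)) 0 0 := by
    have : (fun s : ℝ => pullAlong P ψ (s • e 2) (Fin.removeNth 2 e)) = fun _ =>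
        formAt ψ q ![infAct q x, infAct q y, infAct q w, v] := by
      ext s
      refine eval 2 s (spheroidExp (s • z)) _ ?_ ?_
      · simp [P, e, spheroidExp_zero, hχ0]
      · intro k
        rw [hm _ _ _ (by simpa [e] using hχ')]
        fin_cases k <;> simp [P, e, spheroidExp_zero, hχ0, hact.mder_smul_exp, hmv,
          hme, had, hsa, -smul_neg, spheroidAd_exp_of_commute (hneg x z hxz),
          spheroidAd_exp_of_commute (hneg y z hyz)]
    rw [this]
    exact hasDerivAt_const _ _
  have hd3 : HasDerivAt (fun s : ℝ => pullAlong P ψ (s • e 3) (Fin.removeNth 3 e))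
      (formAt ψ q ![infAct q x, infAct q y, infAct q (lieBr z w), v]) 0 := by
    have : (fun s : ℝ => pullAlong P ψ (s • e 3) (Fin.removeNth 3 e)) = fun s =>
        formAt ψ q ![infAct q x, infAct q y, infAct q (spheroidAd (spheroidExp (s • -w)) z), v] := by
      ext s
      refine eval 3 s (spheroidExp (s • w)) _ ?_ ?_
      · simp [P, e, spheroidExp_zero, hχ0]
      · intro k
        rw [hm _ _ _ (by simpa [e] using hχ')]
        fin_cases k <;> simp [P, e, spheroidExp_zero, hχ0, hmv,
          hme, had, hsa, -smul_neg, spheroidAd_exp_of_commute (hneg x w hxw),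
          spheroidAd_exp_of_commute (hneg y w hyw)]
    rw [this, ← hbr]
    have h := hasDerivAt_formAt (θ := ψ) (x := q) (m := ![infAct q x, infAct q y, 0, v]) 2
      ((infAct (d := d) q).hasFDerivAt.comp_hasDerivAt (0 : ℝ) (hasDerivAt_spheroidAd_exp (-w) z))
    have hu : ∀ c : EuclideanSpace ℝ (Fin d),
        Function.update ![infAct q x, infAct q y, 0, v] 2 c = ![infAct q x, infAct q y, c, v] :=
      fun c => by ext1 k; fin_cases k <;> rfl
    simpa only [hu, Function.comp_def] using h
  -- The curve `χ` may leave the level set, which is why the vanishing `h4` is needed on a full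
  -- neighbourhood of `q`.
  have hd4 : HasDerivAt (fun s : ℝ => pullAlong P ψ (s • e 4) (Fin.removeNth 4 e)) 0 0 := by
    refine (hasDerivAt_const (0 : ℝ) (0 : ℝ)).congr_of_eventuallyEq ?_
    have hχc : Tendsto χ (𝓝 0) (𝓝 q) := hχ0 ▸ hχ'.continuousAt.tendsto
    filter_upwards [hχ, hχc.eventually h4] with s hs hs4
    refine Eq.trans ?_ hs4
    have hP4 : P (s • e 4) = χ s := by simp [P, e, spheroidExp_zero]
    rw [pullAlong_apply, hP4]
    congr 1
    ext1 k
    change mder 𝓘(ℝ, Fin 5 → ℝ) (𝓡 d) P (s • e 4) (e (Fin.succAbove 4 k)) = _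
    rw [hm _ _ _ (by simpa [e] using hs)]
    fin_cases k <;> simp [P, e, spheroidExp_zero, hsa, hact.infAct_eq]
  have key := sum_deriv_eq_zero_of_extDeriv hdiff hext e
    ![0, formAt ψ q ![infAct q (lieBr x y), infAct q z, infAct q w, v], 0,
      formAt ψ q ![infAct q x, infAct q y, infAct q (lieBr z w), v], 0]
      (by intro i; fin_cases i <;> assumption)
  simp [Fin.sum_univ_succ] at key
  linarith

end Cocycle

end Tetraplectic

/-! ### Triviality of the stabilizers. -/

namespace Tetraplectic

open Set Filter Topology MeasureTheory Module

theorem eventually_surjective_fderiv {E V : Type*} [NormedAddCommGroup E] [NormedSpace ℝ E]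
    [NormedAddCommGroup V] [NormedSpace ℝ V] [FiniteDimensional ℝ V] {F : E → V} {a : E}
    (hF : ContDiffAt ℝ ∞ F a) (hs : Function.Surjective (fderiv ℝ F a)) :
    ∀ᶠ y in 𝓝 a, Function.Surjective (fderiv ℝ F y) := by
  have : CompleteSpace V := FiniteDimensional.complete ℝ V
  obtain ⟨R, hR⟩ := (fderiv ℝ F a : E →ₗ[ℝ] V).exists_rightInverse_of_surjective
    (LinearMap.range_eq_top.2 hs)
  let R' : V →L[ℝ] E := LinearMap.toContinuousLinearMap R
  have hc : ContinuousAt (fun y => (fderiv ℝ F y).comp R') a :=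
    ((hF.fderiv_right (m := ∞) (by simp)).continuousAt).clm_comp continuousAt_const
  have h1 : (fderiv ℝ F a).comp R' = 1 := ContinuousLinearMap.ext fun v => LinearMap.congr_fun hR v
  have hu : ∀ᶠ A in 𝓝 ((fderiv ℝ F a).comp R'), IsUnit A :=
    h1 ▸ Units.isOpen.mem_nhds isUnit_one
  filter_upwards [hc.eventually hu] with y hy v
  obtain ⟨B, hB⟩ := hy.exists_right_inv
  exact ⟨R' (B v), DFunLike.congr_fun hB v⟩

section Stabilizer

variable {d n : ℕ} {X : Type*} [TopologicalSpace X] [ChartedSpace (EuclideanSpace ℝ (Fin d)) X]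
  [IsManifold (𝓡 d) ∞ X]

/-- Submersivity is an open condition. The resulting openness of `μ` turns density of regular values
in `ℝⁿ` into density, near `z`, of points of `X` with regular value. -/
theorem eventually_map_nhds_eq {V : Type*} [NormedAddCommGroup V] [NormedSpace ℝ V]
    [FiniteDimensional ℝ V] {μ : X → V} (hμ : ContMDiff (𝓡 d) 𝓘(ℝ, V) ∞ μ) {z : X}
    (hz : Function.Surjective (mder (𝓡 d) 𝓘(ℝ, V) μ z)) :
    ∀ᶠ p in 𝓝 z, map μ (𝓝 p) = 𝓝 (μ p) := by
  have : CompleteSpace V := FiniteDimensional.complete ℝ V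
  let φ := chartAt (EuclideanSpace ℝ (Fin d)) z
  have ht : φ z ∈ φ.target := mem_chart_target _ z
  have hz' : φ.symm (φ z) = z := φ.left_inv (mem_chart_source _ z)
  have hF := contDiffAt_comp_chart_symm z ht (hμ _)
  have hs : Function.Surjective (fderiv ℝ (μ ∘ φ.symm) (φ z)) := fun c => by
    rw [← hz'] at hz
    obtain ⟨v, hv⟩ := hz c
    obtain ⟨u, hu⟩ := (bijective_mder_chart_symm z ht).2 v
    exact ⟨u, by rw [fderiv_comp_chart_symm z ht (hμ _), hu, hv]⟩
  have hφ : ContinuousAt φ z := φ.continuousAt (mem_chart_source _ z)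
  filter_upwards [hφ.eventually (eventually_surjective_fderiv hF hs),
    φ.open_source.mem_nhds (mem_chart_source _ z)] with p hp hps
  have htp := φ.map_source hps
  have hFp := contDiffAt_comp_chart_symm z htp (hμ _)
  have h := (hFp.hasStrictFDerivAt (by simp)).map_nhds_eq_of_surj (LinearMap.range_eq_top.2 hp)
  rw [← Filter.map_map, φ.symm_map_nhds_eq hps] at h
  rw [h, Function.comp_apply, φ.left_inv hps]

variable [MulAction (Spheroid n) X]

/-- The function is read off the smooth pullback of `ψ` along `(b, y) ↦ exp(b) • φ⁻¹(y)`, at the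
points `(0, φ p)` and on the constant vectors `(α i, 0)`. -/
theorem IsSmoothAction.continuous_formAt_infAct (hact : IsSmoothAction d n X) {ψ : DForm d 4 X}
    (hψ : ψ.IsSmooth) (α : Fin 4 → SpheroidLie n) :
    Continuous fun p => formAt ψ p fun i => infAct p (α i) := by
  refine continuous_iff_continuousAt.2 fun z => ?_
  let φ := chartAt (EuclideanSpace ℝ (Fin d)) z
  have ht : φ z ∈ φ.target := mem_chart_target _ z
  let P : SpheroidLie n × EuclideanSpace ℝ (Fin d) → X := fun u => spheroidExp u.1 • φ.symm u.2
  have hPs : ∀ u : SpheroidLie n × EuclideanSpace ℝ (Fin d), u.2 ∈ φ.target →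
      ContMDiffAt 𝓘(ℝ, SpheroidLie n × EuclideanSpace ℝ (Fin d)) (𝓡 d) ∞ P u := fun u hu =>
    hact.comp contDiff_fst.contMDiff.contMDiffAt
      ((contMDiffAt_chart_symm z hu).comp u contDiff_snd.contMDiff.contMDiffAt)
  have hev : ∀ᶠ u in 𝓝 ((0 : SpheroidLie n), φ z), u.2 ∈ φ.target :=
    continuousAt_snd.eventually (φ.open_target.mem_nhds ht)
  have h1 := (contDiffAt_pullAlong (hev.mono hPs) hψ).continuousAt
  let A : (SpheroidLie n × EuclideanSpace ℝ (Fin d)) [⋀^Fin 4]→L[ℝ] ℝ →L[ℝ] ℝ :=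
    ContinuousAlternatingMap.apply ℝ _ ℝ fun i => (α i, 0)
  have hφ : ContinuousAt φ z := φ.continuousAt (mem_chart_source _ z)
  have h2 : ContinuousAt (fun p => A (pullAlong P ψ (0, φ p))) z := by
    refine A.continuous.continuousAt.comp ?_
    exact ContinuousAt.comp (f := fun p => ((0 : SpheroidLie n), φ p)) h1
      (continuousAt_const.prodMk hφ)
  refine h2.congr ?_
  filter_upwards [φ.open_source.mem_nhds (mem_chart_source _ z)] with p hp
  have htp := φ.map_source hp
  have hP0 : P (0, φ p) = p := by
    simp [P, spheroidExp_zero, φ.left_inv hp]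
  change pullAlong P ψ (0, φ p) (fun i => (α i, 0)) = _
  rw [pullAlong_apply, hP0]
  congr 1
  ext1 i
  rw [mder_line ((hPs (0, φ p) htp).mdifferentiableAt (by simp)), hact.infAct_eq]
  simp [P, φ.left_inv hp]

omit [IsManifold (𝓡 d) ∞ X] in
theorem tangentMap_infAct (hact : IsSmoothAction d n X) {μ : X → EuclideanSpace ℝ (Fin n)}
    (hμ : ContMDiff (𝓡 d) 𝓘(ℝ, EuclideanSpace ℝ (Fin n)) ∞ μ)
    (hinv : ∀ (a : Spheroid n) (x : X), μ (a • x) = μ x) (x : X) (b : SpheroidLie n) :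
    mder (𝓡 d) 𝓘(ℝ, EuclideanSpace ℝ (Fin n)) μ x (infAct x b) = 0 := by
  have h := mder_comp_apply (g := μ) (0 : ℝ) (hμ.mdifferentiable (by simp) _)
    (hact.mdifferentiable_exp_curve b x) (1 : ℝ)
  have h2 : μ ∘ (fun t : ℝ => spheroidExp (t • b) • x) = fun _ => μ x := by
    ext1 t; exact hinv _ _
  rw [h2, mder_const, ← hact.infAct_eq] at h
  simpa [spheroidExp_zero] using h.symm

/-- The form vanishes on the orbits, near a point where `μ` is submersive. -/
theorem IsTriMomentumMap.eventually_formAt_infAct [SecondCountableTopology X]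
    (hact : IsSmoothAction d n X) {ψ : DForm d 4 X} (hψ : ψ.IsSmooth)
    {μ : X → EuclideanSpace ℝ (Fin n)} (hμ : IsTriMomentumMap ψ μ) {z : X}
    (hz : Function.Surjective (mder (𝓡 d) 𝓘(ℝ, EuclideanSpace ℝ (Fin n)) μ z))
    (α : Fin 4 → SpheroidLie n) :
    ∀ᶠ p in 𝓝 z, formAt ψ p (fun i => infAct p (α i)) = 0 := by
  filter_upwards [eventually_map_nhds_eq hμ.smooth hz] with p hp
  have hcl : IsClosed {p | formAt ψ p (fun i => infAct p (α i)) = 0} :=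
    isClosed_eq (hact.continuous_formAt_infAct hψ α) continuous_const
  -- Points `q` with regular value occur arbitrarily close to `p`. There the orbit directions lie in
  -- the kernel of `dμ`, so the kernel condition gives the vanishing, which passes to `p` by
  -- closedness.
  have hd : ∃ᶠ c in 𝓝 (μ p), IsRegularValue d μ c :=
    mem_closure_iff_frequently.1 (dense_isRegularValue hμ.smooth (μ p))
  rw [← hp] at hd
  refine hcl.closure_subset (mem_closure_iff_frequently.2 ((frequently_map.1 hd).mono fun q hq => ?_))
  have h := (hμ.kernel q hq (infAct q (α 3))).1 (tangentMap_infAct hact hμ.smooth hμ.invariant q _)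
    (α 0) (α 1) (α 2)
  rw [hact.fundField_eq, hact.fundField_eq, hact.fundField_eq] at h
  refine Eq.trans ?_ h
  change formAt ψ q _ = formAt ψ q _
  congr 1
  ext1 i
  fin_cases i <;> rfl

omit [IsManifold (𝓡 d) ∞ X] in
theorem IsTriMomentumMap.formAt_lieBasis (hact : IsSmoothAction d n X) {ψ : DForm d 4 X}
    {μ : X → EuclideanSpace ℝ (Fin n)} (hμ : IsTriMomentumMap ψ μ) (z : X) (j : Fin n)
    (v : EuclideanSpace ℝ (Fin d)) :
    formAt ψ z ![infAct z (lieBasis j 0), infAct z (lieBasis j 1), infAct z (lieBasis j 2), v] =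
      mder (𝓡 d) 𝓘(ℝ, EuclideanSpace ℝ (Fin n)) μ z v j := by
  have h := hμ.momentum j z v
  rw [hact.fundField_eq, hact.fundField_eq, hact.fundField_eq] at h
  exact h.symm

/-- The `3`-form on `σₙ` obtained from `ψ_z` by contraction with `v`. -/
noncomputable def orbitForm (n : ℕ) [MulAction (Spheroid n) X] (ψ : DForm d 4 X) (z : X)
    (v : EuclideanSpace ℝ (Fin d)) : SpheroidLie n [⋀^Fin 3]→ₗ[ℝ] ℝ :=
  ((formAt ψ z).curryLeft v).toAlternatingMap.compLinearMap (infAct (d := d) (n := n) z).toLinearMap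

omit [IsManifold (𝓡 d) ∞ X] in
theorem orbitForm_apply (ψ : DForm d 4 X) (z : X) (v : EuclideanSpace ℝ (Fin d))
    (m : Fin 3 → SpheroidLie n) : orbitForm n ψ z v m =
      - formAt ψ z ![infAct z (m 0), infAct z (m 1), infAct z (m 2), v] := by
  have h := alternating_four_rotate (formAt ψ z).toAlternatingMap (infAct (n := n) z (m 0))
    (infAct z (m 1)) (infAct z (m 2)) v
  have h2 : orbitForm n ψ z v m =
      (formAt ψ z).toAlternatingMap ![v, infAct z (m 0), infAct z (m 1), infAct z (m 2)] := by
    change formAt ψ z _ = formAt ψ z _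
    congr 1
    ext1 i
    fin_cases i <;> rfl
  rw [h2, ← neg_eq_iff_eq_neg.2 h]
  rfl

theorem isCommCocycle_orbitForm (hact : IsSmoothAction d n X) [SecondCountableTopology X]
    {ψ : DForm d 4 X} (hψ : ψ.IsSmooth) (hψc : ψ.IsClosed) (hinv : IsInvariantForm (n := n) ψ)
    {μ : X → EuclideanSpace ℝ (Fin n)} (hμ : IsTriMomentumMap ψ μ) {z : X}
    (hz : Function.Surjective (mder (𝓡 d) 𝓘(ℝ, EuclideanSpace ℝ (Fin n)) μ z))
    (v : EuclideanSpace ℝ (Fin d)) : IsCommCocycle (orbitForm n ψ z v) := by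
  intro x y p q hxp hxq hyp hyq
  have h4 := hμ.eventually_formAt_infAct hact hψ hz ![x, y, p, q]
  have key := hact.cocycle_identity hψ hψc hinv z v (x := x) (y := y) (z := p) (w := q)
    (h4.mono fun r hr => by
      rw [← hr]
      congr 1
      ext1 i
      fin_cases i <;> rfl) hxp hxq hyp hyq
  rw [← alternating_three_rotate _ (lieBr p q) x y, orbitForm_apply, orbitForm_apply]
  simp only [Matrix.cons_val]
  linarith

set_option synthInstance.maxHeartbeats 400000 in
/-- On a regular level on which they form a spheroid bundle, the stabilizers are trivial. -/
theorem eq_one_of_smul_eq [T2Space X] [SecondCountableTopology X] (hact : IsSmoothAction d n X)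
    {ψ : DForm d 4 X} (hψ : ψ.IsSmooth) (hψc : ψ.IsClosed) (hinv : IsInvariantForm (n := n) ψ)
    {μ : X → EuclideanSpace ℝ (Fin n)} (hμ : IsTriMomentumMap ψ μ) {c : EuclideanSpace ℝ (Fin n)}
    (hc : IsRegularValue d μ c) (hstab : StabilizersFormSpheroidBundle (d := d) μ c) {z : X}
    (hz : μ z = c) {g : Spheroid n} (hg : g • z = z) : g = 1 := by
  obtain ⟨k, U, Φ, hU, hzU, hΦ, hφ⟩ := hstab z hz
  obtain ⟨φ, hφΦ, hφi, hφr⟩ := hφ z hzU hz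
  have hgr : g ∈ φ.range := hφr ▸ MulAction.mem_stabilizer_iff.2 hg
  cases k with
  | zero =>
    obtain ⟨a, rfl⟩ := hgr
    rw [Subsingleton.elim a 1, map_one]
  | succ k =>
    exfalso
    have hsm : ContMDiff (spheroidModel (k + 1)) (spheroidModel n) ∞ φ := fun a => by
      have h1 : ContMDiffAt ((𝓡 d).prod (spheroidModel (k + 1))) (spheroidModel n) ∞ Φ (z, a) :=
        hΦ.contMDiffAt (prod_mem_nhds (hU.mem_nhds hzU) univ_mem)
      have h2 := h1.comp a (contMDiffAt_const.prodMk contMDiffAt_id)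
      exact h2.congr_of_eventuallyEq (Eventually.of_forall hφΦ)
    -- The differential of `φ` on the first factor `Sp(1)`; its image generates fields that vanish
    -- at `z`.
    obtain ⟨ρ, hρ, hbr⟩ := exists_lie_hom φ hsm 0
    have hρt : ∀ (t : ℝ) (a : imQuaternion),
        (t • (fun j => ρ j a) : SpheroidLie n) = fun j => ρ j (t • a) := fun t a => by
      ext1 j; simp
    have hρ0 : ∀ a, infAct (d := d) z (fun j => ρ j a) = 0 := fun a =>
      hact.infAct_eq_zero fun t => by
        rw [hρt, hρ]
        exact MulAction.mem_stabilizer_iff.1 (hφr ▸ ⟨_, rfl⟩)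
    -- The cocycle vanishes on the triple `ρ𝐢, ρ𝐣, ρ𝐤`, and its value on the basis of the `j`-th
    -- factor is `-dμ_j(v)`. As `dμ` is onto, `v` can be chosen to isolate each coefficient.
    have hsum : ∀ v, ∑ j, ‖(ρ j (imBasis 0) : ℍ[ℝ])‖ ^ 2 *
        mder (𝓡 d) 𝓘(ℝ, EuclideanSpace ℝ (Fin n)) μ z v j = 0 := fun v => by
      have h := (isCommCocycle_orbitForm hact hψ hψc hinv hμ (hc z hz) v).map_lie_hom ρ hbr
      rw [orbitForm_apply, hρ0] at h
      simp only [orbitForm_apply, hμ.formAt_lieBasis hact] at h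
      rw [(formAt ψ z).map_coord_zero (0 : Fin 4) rfl] at h
      simpa using h.symm
    have hz0 : ∀ j, ρ j (imBasis 0) = 0 := fun j => by
      obtain ⟨v, hv⟩ := hc z hz (EuclideanSpace.single j 1)
      have hv' : mder (𝓡 d) 𝓘(ℝ, EuclideanSpace ℝ (Fin n)) μ z v = EuclideanSpace.single j 1 := hv
      have h := hsum v
      rw [hv', Finset.sum_eq_single j (by intro b _ hb; simp [hb]) (by simp)] at h
      simpa using h
    -- Now `ρ𝐢 = 0`, so `φ` kills the circle `exp(t𝐢)` of the first factor, against injectivity.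
    have hone : ∀ t : ℝ, spheroidExp (t • (Pi.single 0 (imBasis 0) : SpheroidLie (k + 1))) =
        spheroidExp (t • (0 : SpheroidLie (k + 1))) := fun t => by
      apply hφi
      have : t • (Pi.single 0 (imBasis 0) : SpheroidLie (k + 1)) = Pi.single 0 (t • imBasis 0) := by
        rw [Pi.single_smul]
      rw [this, ← hρ, ← hρt, smul_zero, spheroidExp_zero, map_one]
      simp only [hz0]
      exact (congrArg spheroidExp (smul_zero t)).trans spheroidExp_zero
    have h := congrFun (spheroidExp_injective_line hone) 0
    have h2 := congrArg (fun q : imQuaternion => (q : ℍ[ℝ]).imI) h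
    simp [imBasis] at h2

/-- A generating field that vanishes at `z` puts its whole one-parameter group in the stabilizer. -/
theorem IsSmoothAction.injective_infAct [T2Space X] (hact : IsSmoothAction d n X) {z : X}
    (hz : ∀ g : Spheroid n, g • z = z → g = 1) :
    Function.Injective (infAct (d := d) (n := n) z) :=
  (injective_iff_map_eq_zero _).2 fun b hb => spheroidExp_injective_line fun t => by
    rw [hz _ (hact.smul_eq_of_infAct_eq_zero hb t), smul_zero, spheroidExp_zero]

end Stabilizer

end Tetraplectic

/-! ### Exterior powers of a `4`-form and the counting of blocks. -/

namespace Tetraplectic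

open Set Filter Topology MeasureTheory Module

section Wedge

variable {V : Type*} [AddCommGroup V] [Module ℝ V] [TopologicalSpace V]

theorem prod_update_block {R : Type*} [CommSemiring R] {β κ : Type*} [Fintype β] [DecidableEq β]
    [DecidableEq κ] {W : Type*} (F : (κ → W) → R) (v : β × κ → W) (p : β × κ) (x : W) :
    ∏ i, F (fun a => Function.update v p x (i, a)) =
      F (Function.update (fun a => v (p.1, a)) p.2 x) *
        ∏ i ∈ Finset.univ.erase p.1, F (fun a => v (i, a)) := by
  rw [← Finset.mul_prod_erase _ _ (Finset.mem_univ p.1)]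
  congr 1
  · congr 1
    ext1 a
    by_cases h : a = p.2
    · subst h; simp
    · rw [Function.update_of_ne h, Function.update_of_ne]
      exact fun h2 => h (congrArg Prod.snd h2)
  · refine Finset.prod_congr rfl fun i hi => ?_
    congr 1
    ext1 a
    rw [Function.update_of_ne]
    exact fun h2 => (Finset.mem_erase.1 hi).1 (congrArg Prod.fst h2)

/-- The product of the values of a form on the blocks of a family of vectors. -/
noncomputable def blockProduct (ψ : V [⋀^Fin 4]→L[ℝ] ℝ) (m : ℕ) :
    MultilinearMap ℝ (fun _ : Fin m × Fin 4 => V) ℝ :=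
  MultilinearMap.mk' (fun v => ∏ i : Fin m, ψ fun a => v (i, a))
    (by
      intro v p x y
      rw [prod_update_block, prod_update_block, prod_update_block, ψ.map_update_add, add_mul])
    (by
      intro v p c x
      rw [prod_update_block, prod_update_block, ψ.map_update_smul, smul_mul_assoc])

theorem wedgePow_eq_alternatization (ψ : V [⋀^Fin 4]→L[ℝ] ℝ) (m : ℕ) (v : Fin m × Fin 4 → V) :
    wedgePow ψ m v =
      ((24 : ℝ)⁻¹) ^ m * MultilinearMap.alternatization (blockProduct ψ m) v := by
  rw [wedgePow, MultilinearMap.alternatization_apply]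
  congr 1
  refine Finset.sum_congr rfl fun σ _ => ?_
  rw [Units.smul_def, zsmul_eq_mul]
  rfl

/-- `ψᵐ` is an alternating form of top degree, hence determined by its value on any basis. -/
theorem wedgePow_basis_ne_zero {ψ : V [⋀^Fin 4]→L[ℝ] ℝ} {m : ℕ} (e : Basis (Fin m × Fin 4) ℝ V)
    {v : Fin m × Fin 4 → V} (hv : wedgePow ψ m v ≠ 0) : wedgePow ψ m e ≠ 0 := by
  rw [wedgePow_eq_alternatization] at hv ⊢
  refine mul_ne_zero (left_ne_zero_of_mul hv) ((AlternatingMap.map_basis_ne_zero_iff e _).2 ?_)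
  rintro h
  rw [h] at hv
  exact hv (mul_zero _)

/-- If `ψ(u) = 0` whenever the basis vectors `u` involve the first kind but not the second, and
`ψ^{n+k}` does not vanish, then `ψ^k` does not vanish on the vectors of the third kind. -/
theorem exists_wedgePow_ne_zero_of_basis {ψ : V [⋀^Fin 4]→L[ℝ] ℝ} {m n k : ℕ} (hm : m = n + k)
    (b : Basis ((Fin n × Fin 3 ⊕ Fin n) ⊕ Fin k × Fin 4) ℝ V)
    (hb : ∀ u : Fin 4 → (Fin n × Fin 3 ⊕ Fin n) ⊕ Fin k × Fin 4,
      (∃ a p, u a = Sum.inl (Sum.inl p)) → (∀ a i, u a ≠ Sum.inl (Sum.inr i)) →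
      ψ (fun a => b (u a)) = 0)
    {v : Fin m × Fin 4 → V} (hv : wedgePow ψ m v ≠ 0) :
    ∃ ρ : Equiv.Perm (Fin k × Fin 4), wedgePow ψ k (fun i => b (Sum.inr (ρ i))) ≠ 0 := by
  by_contra! hcon
  have hcard : Fintype.card (Fin m × Fin 4) =
      Fintype.card ((Fin n × Fin 3 ⊕ Fin n) ⊕ Fin k × Fin 4) := by
    simp [hm]; ring
  let ε : Fin m × Fin 4 ≃ (Fin n × Fin 3 ⊕ Fin n) ⊕ Fin k × Fin 4 := Fintype.equivOfCardEq hcard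
  refine wedgePow_basis_ne_zero (b.reindex ε.symm) hv ?_
  rw [wedgePow]
  refine mul_eq_zero_of_right _ ?_
  let F : Equiv.Perm (Fin m × Fin 4) → ℝ := fun σ => ((Equiv.Perm.sign σ : ℤ) : ℝ) *
    ∏ i : Fin m, ψ (fun a => b (ε (σ (i, a))))
  have hF : ∑ σ, F σ = 0 := by
    -- The sum over all permutations is averaged over those that move only vectors of the third
    -- kind, so each such partial sum may be treated separately.
    let Θ : Equiv.Perm (Fin k × Fin 4) → Equiv.Perm ((Fin n × Fin 3 ⊕ Fin n) ⊕ Fin k × Fin 4) :=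
      fun τ => Equiv.Perm.sumCongr 1 τ
    let T : Equiv.Perm (Fin k × Fin 4) → Equiv.Perm (Fin m × Fin 4) := fun τ =>
      ε.symm.permCongr (Θ τ)
    have hTs : ∀ τ, Equiv.Perm.sign (T τ) = Equiv.Perm.sign τ := fun τ => by
      simp [T, Θ, Equiv.Perm.sign_permCongr, Equiv.Perm.sign_sumCongr]
    have hTa : ∀ τ p, ε (T τ p) = Θ τ (ε p) := fun τ p => by simp [T]
    suffices h : ∀ σ, ∑ τ, F (T τ * σ) = 0 by
      have h1 : ∑ τ : Equiv.Perm (Fin k × Fin 4), ∑ σ, F σ = 0 := by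
        have : ∀ τ, ∑ σ, F σ = ∑ σ, F (T τ * σ) := fun τ =>
          (Equiv.sum_comp (Equiv.mulLeft (T τ)) F).symm
        rw [Finset.sum_congr rfl fun τ _ => this τ, Finset.sum_comm]
        exact Finset.sum_eq_zero fun σ _ => h σ
      rw [Finset.sum_const, smul_eq_zero] at h1
      exact h1.resolve_left (by simp [Fintype.card_perm, Nat.factorial_ne_zero])
    intro σ
    let g : Fin m × Fin 4 ≃ (Fin n × Fin 3 ⊕ Fin n) ⊕ Fin k × Fin 4 := σ.trans ε
    have hFg : ∀ τ, F (T τ * σ) = ((Equiv.Perm.sign σ : ℤ) : ℝ) *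
        (((Equiv.Perm.sign τ : ℤ) : ℝ) * ∏ i : Fin m, ψ (fun a => b (Θ τ (g (i, a))))) := fun τ => by
      simp only [F, Equiv.Perm.sign_mul, hTs, Equiv.Perm.mul_apply, hTa]
      push_cast
      simp only [g, Equiv.trans_apply]
      ring
    simp only [hFg, ← Finset.mul_sum]
    refine mul_eq_zero_of_right _ ?_
    -- A block with a vector of the first kind and none of the second stays so under every `τ`, and
    -- makes each product vanish.
    by_cases hA : ∃ c, (∃ a p, g (c, a) = Sum.inl (Sum.inl p)) ∧ ∀ a i, g (c, a) ≠ Sum.inl (Sum.inr i)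
    · obtain ⟨c, ⟨a, p, hp⟩, hc⟩ := hA
      refine Finset.sum_eq_zero fun τ _ => mul_eq_zero_of_right _ ?_
      refine Finset.prod_eq_zero (Finset.mem_univ c) (hb _ ⟨a, p, ?_⟩ fun a i h => ?_)
      · rw [hp]; rfl
      · refine hc a i ?_
        rcases hg : g (c, a) with (q | q) | q <;> rw [hg] at h <;> simp [Θ] at h ⊢; exact h
    push Not at hA
    -- Otherwise every block meeting the first kind contains one of the `n` vectors of the second
    -- kind. So at most `n` blocks hold the `4n` vectors of the first two kinds; they are filled
    -- exactly, and the other `k` blocks contain only the third kind.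
    let Tb : Finset (Fin m) := Finset.univ.image fun i : Fin n => (g.symm (Sum.inl (Sum.inr i))).1
    have hTb : Tb.card ≤ n := Finset.card_image_le.trans (by simp)
    let Im : Finset (Fin m × Fin 4) :=
      Finset.univ.image fun x : Fin n × Fin 3 ⊕ Fin n => g.symm (Sum.inl x)
    have hIm : Im.card = 4 * n := by
      refine (Finset.card_image_of_injective _ (g.symm.injective.comp Sum.inl_injective)).trans ?_
      simp; ring
    have hsub : Im ⊆ Tb ×ˢ Finset.univ := by
      intro q hq
      obtain ⟨x, -, rfl⟩ := Finset.mem_image.1 hq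
      refine Finset.mem_product.2 ⟨?_, Finset.mem_univ _⟩
      rcases x with p | i
      · obtain ⟨a, i, hi⟩ := hA (g.symm (Sum.inl (Sum.inl p))).1
          ⟨(g.symm (Sum.inl (Sum.inl p))).2, p, by simp⟩
        refine Finset.mem_image.2 ⟨i, Finset.mem_univ _, ?_⟩
        rw [← hi]; simp
      · exact Finset.mem_image.2 ⟨i, Finset.mem_univ _, rfl⟩
    have hcp : (Tb ×ˢ (Finset.univ : Finset (Fin 4))).card = Tb.card * 4 := by
      rw [Finset.card_product]; simp
    have heq : Im = Tb ×ˢ Finset.univ :=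
      Finset.eq_of_subset_of_card_le hsub (by rw [hcp, hIm]; omega)
    have hTbn : Tb.card = n := by
      have := congrArg Finset.card heq
      rw [hcp, hIm] at this; omega
    have hin : ∀ c a, c ∈ Tb ↔ ∃ x, g (c, a) = Sum.inl x := fun c a => by
      have : c ∈ Tb ↔ (c, a) ∈ Im := by rw [heq]; simp
      rw [this, Finset.mem_image]
      constructor
      · rintro ⟨x, -, hx⟩; exact ⟨x, by rw [← hx]; simp⟩
      · rintro ⟨x, hx⟩; exact ⟨x, Finset.mem_univ _, by rw [← hx]; simp⟩
    have hck : Fintype.card (Fin k) = Fintype.card {c // c ∉ Tb} := by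
      rw [Fintype.card_fin, Fintype.card_subtype_compl]
      simp [hTbn, hm]
    let e : Fin k ≃ {c // c ∉ Tb} := Fintype.equivOfCardEq hck
    have hex : ∀ p : Fin k × Fin 4, ∃ q, g ((e p.1 : Fin m), p.2) = Sum.inr q := fun p => by
      rcases hg : g ((e p.1 : Fin m), p.2) with x | q
      · exact absurd ((hin _ _).2 ⟨x, hg⟩) (e p.1).2
      · exact ⟨q, rfl⟩
    choose ρ₀ hρ₀ using hex
    have hρi : Function.Injective ρ₀ := fun p q hpq => by
      have h1 := g.injective ((hρ₀ p).trans ((congrArg Sum.inr hpq).trans (hρ₀ q).symm))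
      exact Prod.ext (e.injective (Subtype.ext (congrArg Prod.fst h1))) (Prod.ext_iff.1 h1).2
    let ρ : Equiv.Perm (Fin k × Fin 4) := Equiv.ofBijective ρ₀ (Finite.injective_iff_bijective.1 hρi)
    have hρ : ∀ i a, g ((e i : Fin m), a) = Sum.inr (ρ (i, a)) := fun i a => hρ₀ (i, a)
    have hsplit : ∀ τ, ∏ i : Fin m, ψ (fun a => b (Θ τ (g (i, a)))) =
        (∏ i ∈ Tb, ψ (fun a => b (g (i, a)))) *
          ∏ i : Fin k, ψ (fun a => b (Sum.inr (τ (ρ (i, a))))) := fun τ => by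
      rw [← Finset.prod_mul_prod_compl Tb]
      congr 1
      · refine Finset.prod_congr rfl fun i hi => ?_
        congr 1; ext1 a
        obtain ⟨x, hx⟩ := (hin i a).1 hi
        rw [hx]; rfl
      · rw [Finset.prod_subtype (p := fun c => c ∉ Tb) _ (by simp), ← Equiv.prod_comp e]
        refine Finset.prod_congr rfl fun i _ => ?_
        congr 1; ext1 a
        rw [hρ]; rfl
    simp only [hsplit, mul_left_comm _ (∏ i ∈ Tb, ψ (fun a => b (g (i, a)))), ← Finset.mul_sum]
    refine mul_eq_zero_of_right _ ?_
    -- Up to normalization the remaining sum is `ψᵏ` on the third-kind vectors arranged by `ρ`;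
    -- conjugating `τ` by `ρ` preserves signs and matches the two expressions.
    have h0 := (mul_eq_zero.1 (hcon ρ)).resolve_left (by positivity)
    rw [← h0, ← Equiv.sum_comp (MulAut.conj ρ).toEquiv]
    refine Finset.sum_congr rfl fun τ _ => ?_
    congr 1
    · rcases Int.units_eq_one_or (Equiv.Perm.sign ρ) with hs | hs <;> simp [hs]
    · simp
  refine Eq.trans (Finset.sum_congr rfl fun σ _ => ?_) hF
  simp [F]

end Wedge

end Tetraplectic

/-! ### Slices for a local action on a level set. -/

namespace Tetraplectic

open Set Filter Topology MeasureTheory Module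

section Slice

variable {E P G D : Type*} [NormedAddCommGroup E] [NormedSpace ℝ E] [FiniteDimensional ℝ E]
  [NormedAddCommGroup P] [NormedSpace ℝ P] [FiniteDimensional ℝ P]
  [NormedAddCommGroup G] [NormedSpace ℝ G] [FiniteDimensional ℝ G]
  [NormedAddCommGroup D] [NormedSpace ℝ D] [FiniteDimensional ℝ D]

/-- A splitting of the source of a surjection, adapted to a subspace of the kernel. -/
theorem exists_linear_splitting (B : P →ₗ[ℝ] E) (hB : Function.Injective B) (T : E →ₗ[ℝ] G)
    (hT : Function.Surjective T) (hTB : ∀ p, T (B p) = 0)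
    (hdim : finrank ℝ E = finrank ℝ P + finrank ℝ G + finrank ℝ D) :
    ∃ Ψ : ((P × G) × D) ≃ₗ[ℝ] E, (∀ p, Ψ ((p, 0), 0) = B p) ∧ ∀ p c w, T (Ψ ((p, c), w)) = c := by
  obtain ⟨R, hR⟩ := T.exists_rightInverse_of_surjective (LinearMap.range_eq_top.2 hT)
  have hR' : ∀ c, T (R c) = c := fun c => LinearMap.congr_fun hR c
  have hker : finrank ℝ (LinearMap.ker T) = finrank ℝ P + finrank ℝ D := by
    have := T.finrank_range_add_finrank_ker
    rw [LinearMap.range_eq_top.2 hT, finrank_top] at this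
    omega
  let B' : P →ₗ[ℝ] LinearMap.ker T := B.codRestrict _ fun p => hTB p
  have hB' : Function.Injective B' := fun p q h => hB (congrArg Subtype.val h)
  obtain ⟨C, hC⟩ := (LinearMap.range B').exists_isCompl
  have hCd : finrank ℝ D = finrank ℝ C := by
    have h1 := Submodule.finrank_add_eq_of_isCompl hC
    rw [LinearMap.finrank_range_of_inj hB', hker] at h1
    omega
  let i : D ≃ₗ[ℝ] C := LinearEquiv.ofFinrankEq D C hCd
  let ι : D →ₗ[ℝ] E := (LinearMap.ker T).subtype ∘ₗ C.subtype ∘ₗ i.toLinearMap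
  have hι : ∀ w, T (ι w) = 0 := fun w => (i w : LinearMap.ker T).2
  let Φ : (P × G) × D →ₗ[ℝ] E := (B.coprod R).coprod ι
  have hΦ : ∀ p c w, Φ ((p, c), w) = B p + R c + ι w := fun p c w => by simp [Φ]
  have hTΦ : ∀ p c w, T (Φ ((p, c), w)) = c := fun p c w => by
    rw [hΦ, map_add, map_add, hTB, hR', hι]; simp
  have hinj : Function.Injective Φ := by
    refine (injective_iff_map_eq_zero _).2 ?_
    rintro ⟨⟨p, c⟩, w⟩ h
    have hc : c = 0 := by rw [← hTΦ p c w, h, map_zero]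
    subst hc
    rw [hΦ, map_zero, add_zero] at h
    have h1 : B' p + (i w : LinearMap.ker T) = 0 := Subtype.ext h
    have h2 : B' p = 0 := by
      refine (Submodule.disjoint_def.1 hC.disjoint) _ ⟨p, rfl⟩ ?_
      rw [eq_neg_of_add_eq_zero_left h1]
      exact C.neg_mem (i w).2
    have hp : p = 0 := hB' (h2.trans (map_zero B').symm)
    rw [h2, zero_add] at h1
    have hw : w = 0 := i.injective ((Subtype.ext h1).trans (map_zero i).symm)
    rw [hp, hw]; rfl
  have hd : finrank ℝ ((P × G) × D) = finrank ℝ E := by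
    rw [finrank_prod, finrank_prod, hdim]
  refine ⟨LinearEquiv.ofInjectiveOfFinrankEq Φ hinj hd, fun p => ?_, fun p c w => ?_⟩
  · change Φ _ = _
    rw [hΦ]; simp
  · exact hTΦ p c w

/-- A slice for a local action `A` on the level sets of an invariant submersion `g`. -/
theorem exists_slice {A : P × E → E} {g : E → G} {z : E}
    (hA : ∀ᶠ q in 𝓝 ((0 : P), z), ContDiffAt ℝ ∞ A q) (hA0 : ∀ᶠ x in 𝓝 z, A (0, x) = x)
    (hB : Function.Injective fun p => fderiv ℝ A (0, z) (p, 0))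
    (hg : ∀ᶠ x in 𝓝 z, ContDiffAt ℝ ∞ g x) (hgs : Function.Surjective (fderiv ℝ g z))
    (hgA : ∀ᶠ q in 𝓝 ((0 : P), z), g (A q) = g q.2)
    (hdim : finrank ℝ E = finrank ℝ P + finrank ℝ G + finrank ℝ D) :
    ∃ (s : D → E) (ζ : E → D) (b : E → P),
      (∀ᶠ w in 𝓝 0, ContDiffAt ℝ ∞ s w) ∧ s 0 = z ∧ (∀ᶠ w in 𝓝 0, g (s w) = g z) ∧
      (∀ᶠ x in 𝓝 z, ContDiffAt ℝ ∞ ζ x) ∧ ζ z = 0 ∧ ContinuousAt b z ∧ b z = 0 ∧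
      (∀ᶠ q in 𝓝 ((0 : P), (0 : D)), ζ (A (q.1, s q.2)) = q.2) ∧
      ∀ᶠ x in 𝓝 z, g x = g z → x = A (b x, s (ζ x)) := by
  set A' := fderiv ℝ A (0, z) with hA'
  have hAd : HasFDerivAt A A' (0, z) := (hA.self_of_nhds.differentiableAt (by simp)).hasFDerivAt
  have hAz : A (0, z) = z := hA0.self_of_nhds
  have hA'0 : ∀ v, A' (0, v) = v := fun v => by
    have h1 : HasFDerivAt (fun x : E => A ((0 : P), x)) (A'.comp (ContinuousLinearMap.inr ℝ P E)) z :=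
      hAd.comp z (hasFDerivAt_prodMk_right (0 : P) z)
    have h2 : HasFDerivAt (fun x : E => A ((0 : P), x)) (ContinuousLinearMap.id ℝ E) z :=
      (hasFDerivAt_id z).congr_of_eventuallyEq hA0
    exact DFunLike.congr_fun (h1.unique h2) v
  have hgd : HasFDerivAt g (fderiv ℝ g z) z :=
    (hg.self_of_nhds.differentiableAt (by simp)).hasFDerivAt
  have hgB : ∀ p, fderiv ℝ g z (A' (p, 0)) = 0 := fun p => by
    have h1 : HasFDerivAt (fun q : P => g (A (q, z)))
        ((fderiv ℝ g z).comp (A'.comp (ContinuousLinearMap.inl ℝ P E))) 0 := by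
      have := hasFDerivAt_prodMk_left (𝕜 := ℝ) (0 : P) z
      refine HasFDerivAt.comp (g := g) (f := fun q : P => A (q, z)) (0 : P) ?_ (hAd.comp (0 : P) this)
      rw [hAz]; exact hgd
    have h2 : HasFDerivAt (fun q : P => g (A (q, z))) (0 : P →L[ℝ] G) 0 := by
      refine (hasFDerivAt_const (g z) (0 : P)).congr_of_eventuallyEq ?_
      exact (Continuous.tendsto (by fun_prop : Continuous fun q : P => (q, z)) 0).eventually hgA
    exact DFunLike.congr_fun (h1.unique h2) p
  obtain ⟨Ψ, hΨB, hΨT⟩ := exists_linear_splitting (D := D)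
    (A'.toLinearMap ∘ₗ LinearMap.inl ℝ P E) hB (fderiv ℝ g z).toLinearMap hgs hgB hdim
  let Λ : E →L[ℝ] (P × G) × D := LinearMap.toContinuousLinearMap Ψ.symm.toLinearMap
  have hΛ : ∀ x, Λ x = Ψ.symm x := fun x => rfl
  let l1 : E →L[ℝ] P := (ContinuousLinearMap.fst ℝ P G).comp ((ContinuousLinearMap.fst ℝ _ D).comp Λ)
  let l2 : E →L[ℝ] D := (ContinuousLinearMap.snd ℝ _ D).comp Λ
  have hl : ∀ p c w, l1 (Ψ ((p, c), w)) = p ∧ l2 (Ψ ((p, c), w)) = w := fun p c w => by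
    constructor <;> simp [l1, l2, hΛ]
  -- Coordinates adapted to the splitting into orbit, transverse and slice directions, with middle
  -- component `g` itself. The slice is the preimage of `N z + (0, 0, w)`.
  let N : E → (P × G) × D := fun x => ((l1 x, g x), l2 x)
  let N' : E →L[ℝ] (P × G) × D := (l1.prod (fderiv ℝ g z)).prod l2
  have hN' : ∀ q, N' (Ψ q) = q := by
    rintro ⟨⟨p, c⟩, w⟩
    simp only [N', ContinuousLinearMap.prod_apply, (hl p c w).1, (hl p c w).2]
    have h := hΨT p c w
    change fderiv ℝ g z _ = c at h
    rw [h]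
  have hNd : HasFDerivAt N N' z := (l1.hasFDerivAt.prodMk hgd).prodMk l2.hasFDerivAt
  have hN'b : Function.Bijective N' := by
    refine ⟨fun x y h => ?_, fun q => ⟨Ψ q, hN' q⟩⟩
    obtain ⟨q, rfl⟩ := Ψ.surjective x
    obtain ⟨r, rfl⟩ := Ψ.surjective y
    rw [hN', hN'] at h
    rw [h]
  have hNbij : Function.Bijective (fderiv ℝ N z) := hNd.fderiv ▸ hN'b
  obtain ⟨M, hM, hMz, hMN, hNM⟩ := exists_local_inverse (f := N) (a := z)
    (hg.mono fun x hx => (l1.contDiff.contDiffAt.prodMk hx).prodMk l2.contDiff.contDiffAt) hNbij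
  set M' := fderiv ℝ M (N z)
  have hMd : HasFDerivAt M M' (N z) := (hM.self_of_nhds.differentiableAt (by simp)).hasFDerivAt
  have hNM' : ∀ q, N' (M' q) = q := fun q => by
    have h1 : HasFDerivAt (fun y => N (M y)) (N'.comp M') (N z) :=
      HasFDerivAt.comp (g := N) (N z) (hMz.symm ▸ hNd) hMd
    have h2 : HasFDerivAt (fun y => N (M y)) (ContinuousLinearMap.id ℝ _) (N z) :=
      (hasFDerivAt_id _).congr_of_eventuallyEq hNM
    exact DFunLike.congr_fun (h1.unique h2) q
  -- `κ` forgets the orbit coordinate. The map `A ∘ J` moves the transversal, which has coordinates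
  -- in `G × D`, by the action; its local inverse `h` supplies both `b` and `ζ`.
  let κ : (P × G) × D →L[ℝ] (P × G) × D :=
    ((0 : (P × G) × D →L[ℝ] P).prod ((ContinuousLinearMap.snd ℝ P G).comp
      (ContinuousLinearMap.fst ℝ (P × G) D))).prod (ContinuousLinearMap.snd ℝ (P × G) D)
  have hκ : ∀ p c w, κ ((p, c), w) = ((0, c), w) := fun p c w => rfl
  let π : (P × G) × D →L[ℝ] P :=
    (ContinuousLinearMap.fst ℝ P G).comp (ContinuousLinearMap.fst ℝ (P × G) D)
  let J : (P × G) × D → P × E := fun q => (π q, M (N z + κ q))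
  have hJ0 : J 0 = (0, z) := by simp [J, hMz]
  have hκt : Tendsto (fun q => N z + κ q) (𝓝 0) (𝓝 (N z)) := by
    have : Continuous fun q => N z + κ q := by fun_prop
    simpa using this.tendsto 0
  have hJs : ∀ᶠ q in 𝓝 0, ContDiffAt ℝ ∞ J q := by
    filter_upwards [hκt.eventually hM] with q hq
    exact π.contDiff.contDiffAt.prodMk (hq.comp q (contDiffAt_const.add κ.contDiff.contDiffAt))
  have hJt : Tendsto J (𝓝 0) (𝓝 (0, z)) := hJ0 ▸ hJs.self_of_nhds.continuousAt
  have hJd : HasFDerivAt J (π.prod (M'.comp κ)) 0 := by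
    refine π.hasFDerivAt.prodMk ?_
    refine HasFDerivAt.comp (g := M) (0 : (P × G) × D) ?_ (κ.hasFDerivAt.const_add (N z))
    simpa using hMd
  have hHd : HasFDerivAt (fun q => A (J q)) (A'.comp (π.prod (M'.comp κ))) 0 :=
    HasFDerivAt.comp (g := A) (0 : (P × G) × D) (hJ0.symm ▸ hAd) hJd
  have hHs : ∀ᶠ q in 𝓝 0, ContDiffAt ℝ ∞ (fun q => A (J q)) q := by
    filter_upwards [hJs, hJt.eventually hA] with q h1 h2
    exact h2.comp q h1
  have hH0 : A (J 0) = z := by rw [hJ0, hAz]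
  -- The derivative of `A ∘ J` at `0` is the inverse of `N'`, since `A'` restricts to the identity
  -- on `E` and to the orbit directions on `P`.
  have hNH : ∀ q, N' (A' (π q, M' (κ q))) = q := by
    rintro ⟨⟨p, c⟩, w⟩
    have h1 : A' (p, M' (κ ((p, c), w))) = A' (p, 0) + M' (κ ((p, c), w)) := by
      rw [← hA'0 (M' _), ← map_add]; simp [hA'0]
    have h2 : A' (p, 0) = Ψ ((p, 0), 0) := (hΨB p).symm
    change N' (A' (p, M' (κ ((p, c), w)))) = _
    rw [h1, map_add, hNM', h2, hN', hκ]
    simp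
  have hHbij : Function.Bijective (fderiv ℝ (fun q => A (J q)) 0) := by
    rw [hHd.fderiv]
    refine ⟨fun x y h => ?_, fun y => ⟨N' y, hN'b.1 (hNH _)⟩⟩
    rw [← hNH x, ← hNH y]
    exact congrArg N' h
  obtain ⟨h, hhs, hh0, hhH, hHh⟩ := exists_local_inverse hHs hHbij
  rw [hH0] at hhs hh0 hHh
  have hht : Tendsto h (𝓝 z) (𝓝 0) := by
    have := hhs.self_of_nhds.continuousAt.tendsto
    rwa [hh0] at this
  let i : D →L[ℝ] (P × G) × D := ContinuousLinearMap.inr ℝ (P × G) D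
  have hit : Tendsto (fun w => N z + i w) (𝓝 0) (𝓝 (N z)) := by
    have : Continuous fun w => N z + i w := by fun_prop
    simpa using this.tendsto 0
  refine ⟨fun w => M (N z + i w), fun x => (h x).2, fun x => (h x).1.1, ?_, ?_, ?_, ?_, ?_, ?_, ?_,
    ?_, ?_⟩
  · filter_upwards [hit.eventually hM] with w hw
    exact hw.comp w (contDiffAt_const.add i.contDiff.contDiffAt)
  · simp [hMz]
  · filter_upwards [hit.eventually hNM] with w hw
    have := congrArg (fun q => q.1.2) hw
    simpa [N, i] using this
  · filter_upwards [hhs] with x hx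
    exact contDiff_snd.contDiffAt.comp x hx
  · simp [hh0]
  · exact (continuous_fst.comp continuous_fst).continuousAt.comp hhs.self_of_nhds.continuousAt
  · simp [hh0]
  · have ht : Tendsto (fun q : P × D => (((q.1, 0), q.2) : (P × G) × D)) (𝓝 (0, 0)) (𝓝 0) :=
      Continuous.tendsto' (by fun_prop) _ _ rfl
    filter_upwards [ht.eventually hhH] with q hq
    exact congrArg Prod.snd hq
  · filter_upwards [hHh, hht.eventually (hJt.eventually hgA), hht.eventually (hκt.eventually hNM)]
      with x h1 h2 h3 hx
    rw [h1, hx] at h2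
    have h4 : g (M (N z + κ (h x))) = g z + (h x).1.2 := congrArg (fun q => q.1.2) h3
    -- Invariance makes the `G`-coordinate of `h x` equal to `g x - g z`, which is zero on the level
    -- set; the point of the transversal thus lies on the slice.
    have h5 : (h x).1.2 = 0 := by
      have : g z = g z + (h x).1.2 := h2.trans h4
      simpa using this
    have h6 : κ (h x) = i (h x).2 := by
      change (((0 : P), (h x).1.2), (h x).2) = _
      rw [h5]; rfl
    rw [← h6]
    exact h1.symm

end Slice

end Tetraplectic

namespace Tetraplectic

open Set Filter Topology MeasureTheory Module

section ManifoldSlice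

variable {d : ℕ} {X : Type*} [TopologicalSpace X] [ChartedSpace (EuclideanSpace ℝ (Fin d)) X]
  [IsManifold (𝓡 d) ∞ X]
  {P G D : Type*} [NormedAddCommGroup P] [NormedSpace ℝ P] [FiniteDimensional ℝ P]
  [NormedAddCommGroup G] [NormedSpace ℝ G] [FiniteDimensional ℝ G]
  [NormedAddCommGroup D] [NormedSpace ℝ D] [FiniteDimensional ℝ D]

/-- The local result is read in the chart at `z`. No group law is required of `a`, so `P = 0` with
the trivial action also yields parametrizations of the level set itself. -/
theorem exists_slice_manifold {a : P × X → X} {μ : X → G} {z : X}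
    (ha : ContMDiff (𝓘(ℝ, P).prod (𝓡 d)) (𝓡 d) ∞ a) (ha0 : ∀ x, a (0, x) = x)
    (hB : Function.Injective (mder 𝓘(ℝ, P) (𝓡 d) (fun p => a (p, z)) 0))
    (hμ : ContMDiff (𝓡 d) 𝓘(ℝ, G) ∞ μ) (hz : Function.Surjective (mder (𝓡 d) 𝓘(ℝ, G) μ z))
    (hinv : ∀ q, μ (a q) = μ q.2) (hdim : d = finrank ℝ P + finrank ℝ G + finrank ℝ D) :
    ∃ (s : D → X) (ζ : X → D) (b : X → P),
      (∀ᶠ w in 𝓝 0, ContMDiffAt 𝓘(ℝ, D) (𝓡 d) ∞ s w) ∧ s 0 = z ∧ (∀ᶠ w in 𝓝 0, μ (s w) = μ z) ∧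
      (∀ᶠ x in 𝓝 z, ContMDiffAt (𝓡 d) 𝓘(ℝ, D) ∞ ζ x) ∧ ζ z = 0 ∧
      (∀ᶠ q in 𝓝 ((0 : P), (0 : D)), ζ (a (q.1, s q.2)) = q.2) ∧
      ∀ᶠ x in 𝓝 z, μ x = μ z → x = a (b x, s (ζ x)) := by
  let φ := chartAt (EuclideanSpace ℝ (Fin d)) z
  have hzs : z ∈ φ.source := mem_chart_source _ z
  have ht : φ z ∈ φ.target := mem_chart_target _ z
  have hzz : φ.symm (φ z) = z := φ.left_inv hzs
  let A : P × EuclideanSpace ℝ (Fin d) → EuclideanSpace ℝ (Fin d) := fun q => φ (a (q.1, φ.symm q.2))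
  have hev : ∀ᶠ q in 𝓝 ((0 : P), φ z), q.2 ∈ φ.target :=
    continuousAt_snd.eventually (φ.open_target.mem_nhds ht)
  have hev' : ∀ᶠ y in 𝓝 (φ z), y ∈ φ.target := φ.open_target.mem_nhds ht
  have hin : ∀ q : P × EuclideanSpace ℝ (Fin d), q.2 ∈ φ.target →
      ContMDiffAt 𝓘(ℝ, P × EuclideanSpace ℝ (Fin d)) (𝓡 d) ∞ (fun q => a (q.1, φ.symm q.2)) q :=
    fun q hq => (ha _).comp q (contDiff_fst.contMDiff.contMDiffAt.prodMk
      ((contMDiffAt_chart_symm z hq).comp q contDiff_snd.contMDiff.contMDiffAt))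
  have hsrc : ∀ᶠ q in 𝓝 ((0 : P), φ z), a (q.1, φ.symm q.2) ∈ φ.source := by
    refine (hin (0, φ z) ht).continuousAt.eventually (φ.open_source.mem_nhds ?_)
    simp only [ha0, hzz]
    exact hzs
  have hA : ∀ᶠ q in 𝓝 ((0 : P), φ z), ContDiffAt ℝ ∞ A q := by
    filter_upwards [hev, hsrc] with q h1 h2
    exact contMDiffAt_iff_contDiffAt.1 ((contMDiffAt_chart z h2).comp q (hin q h1))
  have hAd := (hA.self_of_nhds.differentiableAt (by simp)).hasFDerivAt
  have hap : ContMDiff 𝓘(ℝ, P) (𝓡 d) ∞ fun p => a (p, z) :=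
    ha.comp (contMDiff_id.prodMk contMDiff_const)
  have hB' : Function.Injective fun p => fderiv ℝ A (0, φ z) (p, 0) := by
    have h1 := HasFDerivAt.comp (g := A) (f := fun p : P => (p, φ z)) (0 : P) hAd
      (hasFDerivAt_prodMk_left (𝕜 := ℝ) (0 : P) (φ z))
    have h2 : ∀ p, fderiv ℝ A (0, φ z) (p, 0) =
        mder (𝓡 d) (𝓡 d) φ z (mder 𝓘(ℝ, P) (𝓡 d) (fun p => a (p, z)) 0 p) := fun p => by
      have h3 := mder_comp_apply (I' := 𝓡 d) (I'' := 𝓡 d) (g := φ) (f := fun p => a (p, z)) (0 : P)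
        ((contMDiffAt_chart z (by rw [ha0]; exact hzs)).mdifferentiableAt (by simp))
        (hap.mdifferentiable (by simp) 0) p
      rw [ha0] at h3
      have h4 : (φ ∘ fun p => a (p, z)) = A ∘ fun p : P => (p, φ z) := by
        ext1 p; simp only [A, hzz, Function.comp_apply]
      rw [← h3, h4, mder_eq_fderiv, h1.fderiv]
      rfl
    intro p q hpq
    simp only [h2] at hpq
    exact hB ((bijective_mder_chart z hzs).1 hpq)
  have hg : ∀ y ∈ φ.target, ContDiffAt ℝ ∞ (μ ∘ φ.symm) y := fun y hy =>
    contDiffAt_comp_chart_symm z hy (hμ _)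
  have hgs : Function.Surjective (fderiv ℝ (μ ∘ φ.symm) (φ z)) := fun c => by
    rw [← hzz] at hz
    obtain ⟨v, hv⟩ := hz c
    obtain ⟨u, hu⟩ := (bijective_mder_chart_symm z ht).2 v
    exact ⟨u, by rw [fderiv_comp_chart_symm z ht (hμ _), hu, hv]⟩
  have hgA : ∀ᶠ q in 𝓝 ((0 : P), φ z), (μ ∘ φ.symm) (A q) = (μ ∘ φ.symm) q.2 := by
    filter_upwards [hsrc] with q hq
    simp only [A, Function.comp_apply, φ.left_inv hq, hinv]
  obtain ⟨s, ζ, b, hs, hs0, hsg, hζ, hζ0, hb, hb0, h1, h3⟩ := exists_slice (D := D) hA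
    (hev'.mono fun y hy => by
      simp only [A, ha0]; exact φ.right_inv hy)
    hB' (hev'.mono hg) hgs hgA
    (by rw [finrank_euclideanSpace_fin]; exact hdim)
  have hφ : Tendsto φ (𝓝 z) (𝓝 (φ z)) := φ.continuousAt hzs
  have hst : Tendsto s (𝓝 0) (𝓝 (φ z)) := hs0 ▸ hs.self_of_nhds.continuousAt
  have hφs : ∀ᶠ x in 𝓝 z, x ∈ φ.source := φ.open_source.mem_nhds hzs
  refine ⟨fun w => φ.symm (s w), fun x => ζ (φ x), fun x => b (φ x), ?_, ?_, ?_, ?_, hζ0, h1.mono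
    fun q hq => hq, ?_⟩
  · filter_upwards [hs, hst.eventually (φ.open_target.mem_nhds ht)] with w h4 h5
    exact (contMDiffAt_chart_symm z h5).comp w h4.contMDiffAt
  · simp only [hs0, hzz]
  · filter_upwards [hsg] with w hw
    simpa [hzz] using hw
  · filter_upwards [hφ.eventually hζ, hφs] with x h4 h5
    exact h4.contMDiffAt.comp x (contMDiffAt_chart z h5)
  · have hζt : Tendsto (fun x => s (ζ (φ x))) (𝓝 z) (𝓝 (φ z)) := by
      refine hst.comp ?_
      have := hζ.self_of_nhds.continuousAt.tendsto
      rw [hζ0] at this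
      exact this.comp hφ
    have hbt : Tendsto (fun x => b (φ x)) (𝓝 z) (𝓝 0) := by
      have := hb.tendsto
      rw [hb0] at this
      exact this.comp hφ
    filter_upwards [hφ.eventually h3, hφs, (hbt.prodMk_nhds hζt).eventually hsrc] with x h4 h5 h6 hx
    have h7 := h4 (by simp only [Function.comp_apply, φ.left_inv h5, hzz]; exact hx)
    exact φ.injOn h5 h6 h7

end ManifoldSlice

end Tetraplectic

/-! ### Charts on quotients of level sets. -/

namespace Tetraplectic

open Set Filter Topology MeasureTheory Module

section SliceCharts

variable {d n r : ℕ} {X : Type*} [TopologicalSpace X] [ChartedSpace (EuclideanSpace ℝ (Fin d)) X]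
  {μ : X → EuclideanSpace ℝ (Fin n)} {c : EuclideanSpace ℝ (Fin n)}
  {Q : Type*} [TopologicalSpace Q]

/-- A chart of a quotient of a level set whose inverse lifts to a smooth map into `X`, and which
is locally induced by smooth maps on `X`. -/
structure IsSliceChart (d : ℕ) [ChartedSpace (EuclideanSpace ℝ (Fin d)) X]
    (q : LevelSet μ c → Q) (e : OpenPartialHomeomorph Q (EuclideanSpace ℝ (Fin r))) :
    Prop where
  exists_lift : ∃ s : EuclideanSpace ℝ (Fin r) → X, ∀ w ∈ e.target,
    ContMDiffAt (𝓡 r) (𝓡 d) ∞ s w ∧ ∃ h : μ (s w) = c, q ⟨s w, h⟩ = e.symm w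
  exists_extension : ∀ z : LevelSet μ c, q z ∈ e.source →
    ∃ ζ : X → EuclideanSpace ℝ (Fin r), ContMDiffAt (𝓡 d) (𝓡 r) ∞ ζ z ∧
      ∀ᶠ z' in 𝓝 z, e (q z') = ζ z'

/-- The map `q ∘ s` is injective near `0`, and open because every point of the level set near the
slice is identified with its slice point `s (ζ x)`. Its inverse is the chart. -/
theorem exists_isSliceChart {q : LevelSet μ c → Q} (hq : IsOpenQuotientMap q) (z₀ : LevelSet μ c)
    {s : EuclideanSpace ℝ (Fin r) → X} {ζ : X → EuclideanSpace ℝ (Fin r)}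
    (hs : ∀ᶠ w in 𝓝 0, ContMDiffAt (𝓡 r) (𝓡 d) ∞ s w) (hs0 : s 0 = z₀)
    (hμs : ∀ᶠ w in 𝓝 0, μ (s w) = c)
    (hζ : ∀ᶠ x in 𝓝 (z₀ : X), ContMDiffAt (𝓡 d) (𝓡 r) ∞ ζ x) (hζs : ∀ᶠ w in 𝓝 0, ζ (s w) = w)
    (hfib : ∀ᶠ x in 𝓝 (z₀ : X), ∀ (h : μ x = c) (h' : μ (s (ζ x)) = c),
      q ⟨x, h⟩ = q ⟨s (ζ x), h'⟩)
    (hinj : ∀ᶠ p in 𝓝 ((0 : EuclideanSpace ℝ (Fin r)), (0 : EuclideanSpace ℝ (Fin r))),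
      ∀ (h : μ (s p.1) = c) (h' : μ (s p.2) = c), q ⟨s p.1, h⟩ = q ⟨s p.2, h'⟩ → p.1 = p.2)
    (htrans : ∀ z z' : LevelSet μ c, q z = q z' → ∃ T : X → X, ContMDiff (𝓡 d) (𝓡 d) ∞ T ∧
      T z = z' ∧ ∀ (x : X) (h : μ x = c), ∃ h' : μ (T x) = c, q ⟨T x, h'⟩ = q ⟨x, h⟩) :
    ∃ e : OpenPartialHomeomorph Q (EuclideanSpace ℝ (Fin r)), IsSliceChart d q e ∧
      q z₀ ∈ e.source := by
  have hs0c : ContinuousAt s 0 := hs.self_of_nhds.continuousAt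
  have hst : Tendsto s (𝓝 0) (𝓝 (z₀ : X)) := hs0 ▸ hs0c
  obtain ⟨U, hU, hUinj⟩ : ∃ U ∈ 𝓝 (0 : EuclideanSpace ℝ (Fin r)), ∀ w ∈ U, ∀ w' ∈ U,
      ∀ (h : μ (s w) = c) (h' : μ (s w') = c), q ⟨s w, h⟩ = q ⟨s w', h'⟩ → w = w' := by
    rw [nhds_prod_eq] at hinj
    obtain ⟨t, ht, h⟩ := eventually_prod_self_iff (r := fun w w' =>
      ∀ (h : μ (s w) = c) (h' : μ (s w') = c), q ⟨s w, h⟩ = q ⟨s w', h'⟩ → w = w') |>.1 hinj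
    exact ⟨t, ht, fun w hw w' hw' => h w hw w' hw'⟩
  obtain ⟨W, hWsub, hWo, hW0⟩ := mem_nhds_iff.1 (((hs.and hμs).and (hζs.and
    (hst.eventually (hζ.and hfib).eventually_nhds))).and hU)
  have hWs : ∀ w ∈ W, ContMDiffAt (𝓡 r) (𝓡 d) ∞ s w := fun w hw => (hWsub hw).1.1.1
  have hWμ : ∀ w ∈ W, μ (s w) = c := fun w hw => (hWsub hw).1.1.2
  have hWζ : ∀ w ∈ W, ζ (s w) = w := fun w hw => (hWsub hw).1.2.1
  have hWf := fun w (hw : w ∈ W) => (hWsub hw).1.2.2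
  classical
  let l : EuclideanSpace ℝ (Fin r) → LevelSet μ c := fun w =>
    if h : μ (s w) = c then ⟨s w, h⟩ else z₀
  have hl : ∀ (w) (hw : w ∈ W), l w = ⟨s w, hWμ w hw⟩ := fun w hw => dif_pos (hWμ w hw)
  let σ : EuclideanSpace ℝ (Fin r) → Q := fun w => q (l w)
  have hlc : ∀ w ∈ W, ContinuousAt l w := fun w hw => by
    refine IsInducing.subtypeVal.continuousAt_iff.2 ?_
    refine (hWs w hw).continuousAt.congr ?_
    filter_upwards [hWo.mem_nhds hw] with w' hw'
    simp [hl w' hw']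
  have hσi : InjOn σ W := fun w hw w' hw' h => by
    refine hUinj w (hWsub hw).2 w' (hWsub hw').2 (hWμ w hw) (hWμ w' hw') ?_
    rw [← hl w hw, ← hl w' hw']
    exact h
  have hnear : ∀ (w : EuclideanSpace ℝ (Fin r)) (V : Set (EuclideanSpace ℝ (Fin r))), w ∈ W →
      V ⊆ W → V ∈ 𝓝 w → ∀ᶠ x in 𝓝 (s w), ζ x ∈ V ∧ ∀ h : μ x = c, q ⟨x, h⟩ = σ (ζ x) := by
    intro w V hw hVW hV
    have hc : Tendsto ζ (𝓝 (s w)) (𝓝 w) := by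
      have := (hWf w hw).self_of_nhds.1.continuousAt.tendsto
      rwa [hWζ w hw] at this
    filter_upwards [hc hV, hWf w hw] with x h1 h2
    refine ⟨h1, fun h => ?_⟩
    rw [h2.2 h (hWμ _ (hVW h1)), ← hl _ (hVW h1)]
  have hopen : ∀ V ⊆ W, IsOpen V → IsOpen (σ '' V) := by
    intro V hVW hV
    refine isOpen_iff_mem_nhds.2 ?_
    rintro _ ⟨w, hw, rfl⟩
    have h1 := hnear w V (hVW hw) hVW (hV.mem_nhds hw)
    have h2 : ∀ᶠ z : LevelSet μ c in 𝓝 (l w), ζ z ∈ V ∧ q z = σ (ζ z) := by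
      have h3 : Tendsto (Subtype.val : LevelSet μ c → X) (𝓝 (l w)) (𝓝 (s w)) := by
        have := (continuous_subtype_val (p := fun x => μ x = c)).tendsto (l w)
        rwa [hl w (hVW hw)] at this ⊢
      exact (h3.eventually h1).mono fun z hz => ⟨hz.1, hz.2 z.2⟩
    refine mem_of_superset (hq.isOpenMap.image_mem_nhds h2) ?_
    rintro _ ⟨z, hz, rfl⟩
    exact ⟨ζ z, hz.1, hz.2.symm⟩
  let e₀ : OpenPartialHomeomorph (EuclideanSpace ℝ (Fin r)) Q :=
    OpenPartialHomeomorph.ofContinuousOpenRestrict (hσi.toPartialEquiv σ W)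
      (fun w hw => (hq.continuous.continuousAt.comp (hlc w hw)).continuousWithinAt)
      (fun V hV => by
        have : (hσi.toPartialEquiv σ W).source.domRestrict (hσi.toPartialEquiv σ W) '' V =
            σ '' (Subtype.val '' V) := by
          rw [image_image]; rfl
        rw [this]
        exact hopen _ (by rintro _ ⟨w, -, rfl⟩; exact w.2) (hWo.isOpenMap_subtype_val _ hV)) hWo
  have he₀ : ∀ w, e₀ w = σ w := fun w => rfl
  have he₀s : e₀.source = W := rfl
  refine ⟨e₀.symm, ⟨⟨s, fun w hw => ⟨hWs w hw, hWμ w hw, ?_⟩⟩, fun z hz => ?_⟩, ?_⟩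
  · rw [← hl w hw]; rfl
  · obtain ⟨w, hw, hwz⟩ : ∃ w ∈ W, σ w = q z := hz
    -- `z` may lie far from the slice within its fibre; `T` carries it onto the slice, where `ζ` is
    -- smooth.
    obtain ⟨T, hT, hTz, hTq⟩ := htrans z (l w) hwz.symm
    rw [hl w hw] at hTz
    refine ⟨fun x => ζ (T x), ?_, ?_⟩
    · refine ContMDiffAt.comp (g := ζ) (z : X) ?_ (hT z)
      rw [hTz]
      exact (hWf w hw).self_of_nhds.1
    · have h1 := hnear w W hw subset_rfl (hWo.mem_nhds hw)
      have h2 : Tendsto (fun z' : LevelSet μ c => T z') (𝓝 z) (𝓝 (s w)) := by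
        have := (hT.continuous.comp continuous_subtype_val).tendsto z
        simp only [Function.comp_apply, hTz] at this
        exact this
      filter_upwards [h2.eventually h1] with z' hz'
      obtain ⟨h', hq'⟩ := hTq z' z'.2
      have h3 : q z' = e₀ (ζ (T z')) := by
        rw [he₀, ← hz'.2 h', hq']
      rw [h3]
      exact e₀.left_inv hz'.1
  · refine ⟨0, hW0, ?_⟩
    change q (l 0) = _
    rw [hl 0 hW0]
    congr 1
    exact Subtype.ext hs0

/-- A quotient covered by slice charts is a manifold. -/
theorem exists_chartedSpace {q : LevelSet μ c → Q}
    (h : ∀ y : Q, ∃ e : OpenPartialHomeomorph Q (EuclideanSpace ℝ (Fin r)),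
      IsSliceChart d q e ∧ y ∈ e.source) :
    ∃ _ : ChartedSpace (EuclideanSpace ℝ (Fin r)) Q, IsManifold (𝓡 r) ∞ Q ∧
      ∀ y : Q, IsSliceChart d q (chartAt (EuclideanSpace ℝ (Fin r)) y) := by
  choose e he hes using h
  let C : ChartedSpace (EuclideanSpace ℝ (Fin r)) Q :=
    { atlas := {e | IsSliceChart d q e}
      chartAt := e
      mem_chart_source := hes
      chart_mem_atlas := he }
  refine ⟨C, isManifold_of_contDiffOn (𝓡 r) ∞ Q fun e e' he he' => ?_, he⟩
  -- A change of charts `e' ∘ e⁻¹` coincides locally with `ζ ∘ s`, for a lift `s` of `e⁻¹` and an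
  -- extension `ζ` of `e'`.
  obtain ⟨s, hs⟩ := IsSliceChart.exists_lift he
  intro w hw
  simp only [mfld_simps] at hw
  obtain ⟨hw1, h1, hqw⟩ := hs w hw.1
  obtain ⟨ζ, hζ, hζe⟩ := IsSliceChart.exists_extension he' ⟨s w, h1⟩ (by rw [hqw]; exact hw.2)
  refine ContDiffAt.contDiffWithinAt ?_
  refine (contMDiffAt_iff_contDiffAt.1 (ContMDiffAt.comp (g := ζ) w hζ hw1)).congr_of_eventuallyEq ?_
  classical
  let l : EuclideanSpace ℝ (Fin r) → LevelSet μ c := fun w' =>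
    if h : μ (s w') = c then ⟨s w', h⟩ else ⟨s w, h1⟩
  have hlt : ∀ w' ∈ e.target, ∃ h : μ (s w') = c, l w' = ⟨s w', h⟩ := fun w' hw' =>
    ⟨(hs w' hw').2.1, dif_pos (hs w' hw').2.1⟩
  have hlc : Tendsto l (𝓝 w) (𝓝 ⟨s w, h1⟩) := by
    have : ContinuousAt l w := by
      refine IsInducing.subtypeVal.continuousAt_iff.2 (hw1.continuousAt.congr ?_)
      filter_upwards [e.open_target.mem_nhds hw.1] with w' hw'
      obtain ⟨h, hh⟩ := hlt w' hw'
      simp [hh]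
    obtain ⟨h, hh⟩ := hlt w hw.1
    rw [ContinuousAt, hh] at this
    exact this
  filter_upwards [hlc.eventually hζe, e.open_target.mem_nhds hw.1] with w' h2 h3
  obtain ⟨h, hh⟩ := hlt w' h3
  obtain ⟨-, h', hq'⟩ := hs w' h3
  rw [hh, hq'] at h2
  exact h2

end SliceCharts

end Tetraplectic

/-! ### Charts of the level set and of the reduced space. -/

namespace Tetraplectic

open Set Filter Topology MeasureTheory Module

theorem finrank_spheroidLie (n : ℕ) : finrank ℝ (SpheroidLie n) = 3 * n := by
  have h : finrank ℝ imQuaternion = 3 := by rw [imEquiv.finrank_eq]; simp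
  rw [Module.finrank_pi_fintype]
  simp [h, mul_comm]

section Charts

variable {d n : ℕ} {X : Type*} [TopologicalSpace X] [ChartedSpace (EuclideanSpace ℝ (Fin d)) X]
  {μ : X → EuclideanSpace ℝ (Fin n)} {c : EuclideanSpace ℝ (Fin n)}

/-- The slice construction with zero-dimensional `P` and the identity as quotient map. -/
theorem exists_isSliceChart_levelSet [IsManifold (𝓡 d) ∞ X]
    (hμ : ContMDiff (𝓡 d) 𝓘(ℝ, EuclideanSpace ℝ (Fin n)) ∞ μ) (hc : IsRegularValue d μ c)
    (z₀ : LevelSet μ c) :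
    ∃ e : OpenPartialHomeomorph (LevelSet μ c) (EuclideanSpace ℝ (Fin (d - n))),
      IsSliceChart d (id : LevelSet μ c → LevelSet μ c) e ∧ z₀ ∈ e.source := by
  have hz : Function.Surjective (mder (𝓡 d) 𝓘(ℝ, EuclideanSpace ℝ (Fin n)) μ z₀) := hc z₀ z₀.2
  have hnd : n ≤ d := by
    have := LinearMap.finrank_le_finrank_of_surjective
      (f := (mder (𝓡 d) 𝓘(ℝ, EuclideanSpace ℝ (Fin n)) μ z₀).toLinearMap) hz
    simpa using this
  obtain ⟨s, ζ, b, hs, hs0, hμs, hζ, -, h1, h3⟩ := exists_slice_manifold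
    (P := EuclideanSpace ℝ (Fin 0)) (D := EuclideanSpace ℝ (Fin (d - n)))
    (a := fun q : EuclideanSpace ℝ (Fin 0) × X => q.2) (z := (z₀ : X)) contMDiff_snd (fun _ => rfl)
    (Function.injective_of_subsingleton _) hμ hz (fun _ => rfl)
    (by simp only [finrank_euclideanSpace_fin]; omega)
  have hζs : ∀ᶠ w in 𝓝 (0 : EuclideanSpace ℝ (Fin (d - n))), ζ (s w) = w :=
    (Continuous.tendsto (by fun_prop : Continuous fun w : EuclideanSpace ℝ (Fin (d - n)) =>
      ((0 : EuclideanSpace ℝ (Fin 0)), w)) 0).eventually h1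
  refine exists_isSliceChart IsOpenQuotientMap.id z₀ hs hs0 (hμs.mono fun w hw => hw.trans z₀.2) hζ
    hζs (h3.mono fun x hx h h' => Subtype.ext (hx (h.trans z₀.2.symm))) ?_ ?_
  · filter_upwards [continuousAt_fst.eventually hζs, continuousAt_snd.eventually hζs]
      with p h4 h5 h h' hp
    have h6 : s p.1 = s p.2 := congrArg Subtype.val hp
    rw [← h4, ← h5, h6]
  · rintro z _ rfl
    exact ⟨id, contMDiff_id, rfl, fun x h => ⟨h, rfl⟩⟩

variable [MulAction (Spheroid n) X]

omit [TopologicalSpace X] [ChartedSpace (EuclideanSpace ℝ (Fin d)) X] in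
theorem reductionMap_eq_iff {z z' : LevelSet μ c} :
    reductionMap μ c z = reductionMap μ c z' ↔ ∃ g : Spheroid n, g • (z' : X) = z :=
  Quotient.eq (r := (MulAction.orbitRel (Spheroid n) X).comap Subtype.val)

omit [ChartedSpace (EuclideanSpace ℝ (Fin d)) X] in
theorem isOpenQuotientMap_reductionMap (hcont : ∀ g : Spheroid n, Continuous fun x : X => g • x)
    (hinv : ∀ (a : Spheroid n) (x : X), μ (a • x) = μ x) :
    IsOpenQuotientMap (reductionMap (n := n) μ c) where
  surjective := Quotient.mk_surjective
  continuous := continuous_quot_mk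
  isOpenMap U hU := by
    refine isOpen_coinduced.2 ?_
    let T : Spheroid n → LevelSet μ c → LevelSet μ c := fun g z => ⟨g • (z : X), (hinv g z).trans z.2⟩
    have hT : ∀ g, Continuous (T g) := fun g =>
      ((hcont g).comp continuous_subtype_val).subtype_mk _
    have : reductionMap μ c ⁻¹' (reductionMap μ c '' U) = ⋃ g, T g ⁻¹' U := by
      ext z
      simp only [mem_preimage, mem_image, mem_iUnion]
      constructor
      · rintro ⟨z', hz', h⟩
        obtain ⟨g, hg⟩ := reductionMap_eq_iff.1 h
        exact ⟨g, by rw [show T g z = z' from Subtype.ext hg]; exact hz'⟩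
      · rintro ⟨g, hg⟩
        exact ⟨T g z, hg, reductionMap_eq_iff.2 ⟨g, rfl⟩⟩
    exact this ▸ isOpen_iUnion fun g => hU.preimage (hT g)

/-- The orbit relation is the projection, along the compact group, of a closed set; so it is closed.
-/
theorem t2Space_reducedSpace [T2Space X] (hact : IsSmoothAction d n X)
    (hinv : ∀ (a : Spheroid n) (x : X), μ (a • x) = μ x) : T2Space (ReducedSpace (n := n) μ c) := by
  have hq := isOpenQuotientMap_reductionMap (c := c) (fun g => (hact.contMDiff_smul g).continuous) hinv
  refine (t2Space_iff_of_isOpenQuotientMap hq).2 ?_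
  have hcl : IsClosed {p : Spheroid n × (LevelSet μ c × LevelSet μ c) |
      p.1 • (p.2.2 : X) = p.2.1} := by
    refine isClosed_eq ?_ (by fun_prop)
    exact hact.continuous.comp (f := fun p : Spheroid n × (LevelSet μ c × LevelSet μ c) =>
      (p.1, (p.2.2 : X))) (by fun_prop)
  have h := isClosedMap_snd_of_compactSpace _ hcl
  have he : {p : LevelSet μ c × LevelSet μ c | reductionMap (n := n) μ c p.1 = reductionMap μ c p.2} =
      Prod.snd '' {p : Spheroid n × (LevelSet μ c × LevelSet μ c) | p.1 • (p.2.2 : X) = p.2.1} := by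
    ext p
    simp only [mem_ofPred_eq, reductionMap_eq_iff, mem_image, Prod.exists, exists_eq_right]
  rw [he]
  exact h

theorem secondCountable_reducedSpace [SecondCountableTopology X] (hact : IsSmoothAction d n X)
    (hinv : ∀ (a : Spheroid n) (x : X), μ (a • x) = μ x) :
    SecondCountableTopology (ReducedSpace (n := n) μ c) :=
  have hq := isOpenQuotientMap_reductionMap (c := c) (fun g => (hact.contMDiff_smul g).continuous) hinv
  have : SecondCountableTopology (LevelSet μ c) :=
    inferInstanceAs (SecondCountableTopology {x | μ x = c})
  hq.isQuotientMap.secondCountableTopology hq.isOpenMap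

/-- Distinct points of a slice of a free action of a compact group lie in distinct orbits. -/
theorem IsSmoothAction.eventually_eq_of_smul_eq [T2Space X] (hact : IsSmoothAction d n X) {z : X}
    (hfree : ∀ g : Spheroid n, g • z = z → g = 1) {D : Type*} [TopologicalSpace D] [Zero D]
    {s : D → X} {ζ : X → D} (hs : ContinuousAt s 0) (hs0 : s 0 = z)
    (hζ : ∀ᶠ q in 𝓝 ((0 : SpheroidLie n), (0 : D)), ζ (spheroidExp q.1 • s q.2) = q.2) :
    ∀ᶠ p in 𝓝 ((0 : D), (0 : D)), ∀ g : Spheroid n, g • s p.2 = s p.1 → p.1 = p.2 := by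
  -- By compactness it suffices to argue near each fixed `g`. Near `1` the group elements are
  -- exponentials of small vectors and the slice property applies; near any other `g` freeness
  -- separates `g • z` from `z`.
  have key := (isCompact_univ (X := Spheroid n)).eventually_forall_of_forall_eventually
    (x₀ := ((0 : D), (0 : D))) (P := fun p g => g • s p.2 = s p.1 → p.1 = p.2) fun g _ => ?_
  · exact key.mono fun p hp g => hp g (mem_univ g)
  have hs1 : Tendsto (fun u : (D × D) × Spheroid n => s u.1.1) (𝓝 ((0, 0), g)) (𝓝 z) := by
    have : Tendsto (fun u : (D × D) × Spheroid n => u.1.1) (𝓝 ((0, 0), g)) (𝓝 0) :=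
      Continuous.tendsto (by fun_prop) _
    exact (hs0 ▸ hs.tendsto : Tendsto s (𝓝 0) (𝓝 z)).comp this
  have hs2 : Tendsto (fun u : (D × D) × Spheroid n => s u.1.2) (𝓝 ((0, 0), g)) (𝓝 z) := by
    have : Tendsto (fun u : (D × D) × Spheroid n => u.1.2) (𝓝 ((0, 0), g)) (𝓝 0) :=
      Continuous.tendsto (by fun_prop) _
    exact (hs0 ▸ hs.tendsto : Tendsto s (𝓝 0) (𝓝 z)).comp this
  have hg : Tendsto (fun u : (D × D) × Spheroid n => u.2) (𝓝 ((0, 0), g)) (𝓝 g) :=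
    Continuous.tendsto (by fun_prop) _
  by_cases h1 : g = 1
  · subst h1
    obtain ⟨L, hL, hLe⟩ := exists_spheroidLog (n := n)
    have ht2 : Tendsto (fun u : (D × D) × Spheroid n => u.1.2) (𝓝 ((0, 0), 1)) (𝓝 0) :=
      Continuous.tendsto (by fun_prop) _
    have ht1 : Tendsto (fun u : (D × D) × Spheroid n => u.1.1) (𝓝 ((0, 0), 1)) (𝓝 0) :=
      Continuous.tendsto (by fun_prop) _
    have h2 := ((hL.comp hg).prodMk_nhds ht2).eventually hζ
    have h3 := ((tendsto_const_nhds (x := (0 : SpheroidLie n))).prodMk_nhds ht1).eventually hζ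
    filter_upwards [h2, h3, hg.eventually hLe] with u h4 h5 h6 h7
    simp only [Function.comp_apply, h6, h7] at h4
    simp only [spheroidExp_zero, one_smul] at h5
    exact h5.symm.trans h4
  · have hne : g • z ≠ z := fun h => h1 (hfree g h)
    have h2 : Tendsto (fun u : (D × D) × Spheroid n => u.2 • s u.1.2) (𝓝 ((0, 0), g)) (𝓝 (g • z)) :=
      (hact.continuous.tendsto (g, z)).comp (hg.prodMk_nhds hs2)
    filter_upwards [(h2.prodMk_nhds hs1).eventually (isClosed_diagonal.isOpen_compl.mem_nhds hne)]
      with u hu hu2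
    exact absurd hu2 hu

/-- In `hd` the three summands count the orbit directions, the components of `μ` and the slice
directions. -/
theorem exists_isSliceChart_reducedSpace [T2Space X] [IsManifold (𝓡 d) ∞ X] {k : ℕ}
    (hact : IsSmoothAction d n X) (hμ : ContMDiff (𝓡 d) 𝓘(ℝ, EuclideanSpace ℝ (Fin n)) ∞ μ)
    (hinv : ∀ (a : Spheroid n) (x : X), μ (a • x) = μ x) (hc : IsRegularValue d μ c)
    (hfree : ∀ z, μ z = c → ∀ g : Spheroid n, g • z = z → g = 1) (hd : d = 3 * n + n + k)
    (y : ReducedSpace (n := n) μ c) :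
    ∃ e : OpenPartialHomeomorph (ReducedSpace (n := n) μ c) (EuclideanSpace ℝ (Fin k)),
      IsSliceChart d (reductionMap μ c) e ∧ y ∈ e.source := by
  have hq := isOpenQuotientMap_reductionMap (c := c) (fun g => (hact.contMDiff_smul g).continuous) hinv
  obtain ⟨z₀, rfl⟩ := hq.surjective y
  have hz : Function.Surjective (mder (𝓡 d) 𝓘(ℝ, EuclideanSpace ℝ (Fin n)) μ z₀) := hc z₀ z₀.2
  have ha : ContMDiff (𝓘(ℝ, SpheroidLie n).prod (𝓡 d)) (𝓡 d) ∞
      fun q : SpheroidLie n × X => spheroidExp q.1 • q.2 := fun q =>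
    hact.comp contMDiffAt_fst contMDiffAt_snd
  obtain ⟨s, ζ, b, hs, hs0, hμs, hζ, -, h1, h3⟩ := exists_slice_manifold
    (P := SpheroidLie n) (D := EuclideanSpace ℝ (Fin k)) ha
    (fun x => by simp only [spheroidExp_zero, one_smul])
    (hact.injective_infAct (hfree z₀ z₀.2)) hμ hz (fun q => hinv _ _)
    (by simp only [finrank_euclideanSpace_fin, finrank_spheroidLie]; exact hd)
  have hζs : ∀ᶠ w in 𝓝 (0 : EuclideanSpace ℝ (Fin k)), ζ (s w) = w := by
    have := (Continuous.tendsto (by fun_prop : Continuous fun w : EuclideanSpace ℝ (Fin k) =>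
      ((0 : SpheroidLie n), w)) 0).eventually h1
    simpa only [spheroidExp_zero, one_smul] using this
  refine exists_isSliceChart hq z₀ hs hs0 (hμs.mono fun w hw => hw.trans z₀.2) hζ
    hζs (h3.mono fun x hx h h' => ?_) ?_ ?_
  · exact reductionMap_eq_iff.2 ⟨_, (hx (h.trans z₀.2.symm)).symm⟩
  · filter_upwards [hact.eventually_eq_of_smul_eq (hfree z₀ z₀.2) hs.self_of_nhds.continuousAt hs0 h1]
      with p hp h h' hpq
    obtain ⟨g, hg⟩ := reductionMap_eq_iff.1 hpq
    exact hp g hg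
  · intro z z' hzz
    obtain ⟨g, hg⟩ := reductionMap_eq_iff.1 hzz.symm
    exact ⟨fun x => g • x, hact.contMDiff_smul g, hg, fun x h => ⟨(hinv g x).trans h,
      reductionMap_eq_iff.2 ⟨g, rfl⟩⟩⟩

end Charts

end Tetraplectic

/-! ### The inclusion is an immersion and the projection a submersion. -/

namespace Tetraplectic

open Set Filter Topology MeasureTheory Module

section SliceManifolds

variable {d n r k : ℕ} {X : Type*} [TopologicalSpace X] [ChartedSpace (EuclideanSpace ℝ (Fin d)) X]
  {μ : X → EuclideanSpace ℝ (Fin n)} {c : EuclideanSpace ℝ (Fin n)}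
  [ChartedSpace (EuclideanSpace ℝ (Fin r)) (LevelSet μ c)] [IsManifold (𝓡 r) ∞ (LevelSet μ c)]
  {Q : Type*} [TopologicalSpace Q] [ChartedSpace (EuclideanSpace ℝ (Fin k)) Q]
  [IsManifold (𝓡 k) ∞ Q]

theorem contMDiff_inclusionMap
    (hZ : ∀ z, IsSliceChart d (id : LevelSet μ c → LevelSet μ c)
      (chartAt (EuclideanSpace ℝ (Fin r)) z)) :
    ContMDiff (𝓡 r) (𝓡 d) ∞ (inclusionMap μ c) := fun z => by
  obtain ⟨s, hs⟩ := (hZ z).exists_lift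
  set e := chartAt (EuclideanSpace ℝ (Fin r)) z
  have hz : z ∈ e.source := mem_chart_source _ z
  have h1 : ContMDiffAt (𝓡 r) (𝓡 d) ∞ (s ∘ e) z :=
    (hs _ (e.map_source hz)).1.comp z (contMDiffAt_chart z hz)
  refine h1.congr_of_eventuallyEq ?_
  filter_upwards [e.open_source.mem_nhds hz] with z' hz'
  obtain ⟨-, h, hq⟩ := hs _ (e.map_source hz')
  rw [e.left_inv hz'] at hq
  exact (congrArg Subtype.val hq).symm

omit [ChartedSpace (EuclideanSpace ℝ (Fin r)) (LevelSet μ c)] [IsManifold (𝓡 r) ∞ (LevelSet μ c)] in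
/-- A map into a quotient of a level set is smooth if it lifts to a smooth map to `X`. -/
theorem contMDiffAt_of_lift {q : LevelSet μ c → Q} (hqc : Continuous q)
    (hQ : ∀ y, IsSliceChart d q (chartAt (EuclideanSpace ℝ (Fin k)) y))
    {E H M : Type*} [NormedAddCommGroup E] [NormedSpace ℝ E] [TopologicalSpace H]
    {I : ModelWithCorners ℝ E H} [TopologicalSpace M] [ChartedSpace H M] {f : M → LevelSet μ c}
    {x : M} (hf : ContMDiffAt I (𝓡 d) ∞ (fun y => (f y : X)) x) :
    ContMDiffAt I (𝓡 k) ∞ (fun y => q (f y)) x := by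
  have hfc : ContinuousAt f x := IsInducing.subtypeVal.continuousAt_iff.2 hf.continuousAt
  set e := chartAt (EuclideanSpace ℝ (Fin k)) (q (f x))
  have hx : q (f x) ∈ e.source := mem_chart_source _ _
  obtain ⟨ζ, hζ, hζe⟩ := (hQ (q (f x))).exists_extension (f x) hx
  have h0 : e (q (f x)) = ζ (f x) := hζe.self_of_nhds
  have h1 : ContMDiffAt I (𝓡 k) ∞ (fun y => e.symm (ζ (f y))) x := by
    refine ContMDiffAt.comp (g := e.symm) x ?_ (hζ.comp x hf)
    exact contMDiffAt_chart_symm _ (h0 ▸ e.map_source hx)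
  refine h1.congr_of_eventuallyEq ?_
  filter_upwards [hfc.eventually hζe,
    (hqc.continuousAt.comp hfc).eventually (e.open_source.mem_nhds hx)] with y h2 h3
  rw [← h2]
  exact (e.left_inv h3).symm

/-- Near `z` the chart is the restriction of a smooth map on `X`, so its bijective derivative
factors through that of the inclusion. -/
theorem injective_mder_inclusionMap
    (hZ : ∀ z, IsSliceChart d (id : LevelSet μ c → LevelSet μ c)
      (chartAt (EuclideanSpace ℝ (Fin r)) z)) (z : LevelSet μ c) :
    Function.Injective (mder (𝓡 r) (𝓡 d) (inclusionMap μ c) z) := by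
  obtain ⟨ζ, hζ, hζe⟩ := (hZ z).exists_extension z (mem_chart_source _ z)
  have h := fun v => mder_comp_apply (g := ζ) (f := inclusionMap μ c) z
    (hζ.mdifferentiableAt (by simp)) ((contMDiff_inclusionMap hZ).mdifferentiable (by simp) z) v
  have h2 : mder (𝓡 r) (𝓡 r) (chartAt (EuclideanSpace ℝ (Fin r)) z) z =
      mder (𝓡 r) (𝓡 r) (ζ ∘ inclusionMap μ c) z := mder_congr hζe
  intro v w hvw
  refine (bijective_mder_chart z (mem_chart_source _ z)).1 ?_
  rw [h2, h, h, hvw]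

/-- Smooth local sections of the projection. -/
theorem exists_section {q : LevelSet μ c → Q} (hqs : Function.Surjective q)
    (hZ : ∀ z, IsSliceChart d (id : LevelSet μ c → LevelSet μ c)
      (chartAt (EuclideanSpace ℝ (Fin r)) z))
    (hQ : ∀ y, IsSliceChart d q (chartAt (EuclideanSpace ℝ (Fin k)) y)) (y : Q) :
    ∃ γ : EuclideanSpace ℝ (Fin k) → LevelSet μ c,
      ∀ w ∈ (chartAt (EuclideanSpace ℝ (Fin k)) y).target, ContMDiffAt (𝓡 k) (𝓡 r) ∞ γ w ∧
        q (γ w) = (chartAt (EuclideanSpace ℝ (Fin k)) y).symm w := by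
  obtain ⟨s, hs⟩ := (hQ y).exists_lift
  set e := chartAt (EuclideanSpace ℝ (Fin k)) y
  obtain ⟨z₀, -⟩ := hqs y
  classical
  let γ : EuclideanSpace ℝ (Fin k) → LevelSet μ c := fun w =>
    if h : μ (s w) = c then ⟨s w, h⟩ else z₀
  have hγ : ∀ w ∈ e.target, ∃ h : μ (s w) = c, γ w = ⟨s w, h⟩ := fun w hw =>
    ⟨(hs w hw).2.1, dif_pos (hs w hw).2.1⟩
  refine ⟨γ, fun w hw => ⟨?_, ?_⟩⟩
  · refine contMDiffAt_of_lift (q := id) continuous_id hZ ((hs w hw).1.congr_of_eventuallyEq ?_)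
    filter_upwards [e.open_target.mem_nhds hw] with w' hw'
    obtain ⟨h, hh⟩ := hγ w' hw'
    exact congrArg Subtype.val hh
  · obtain ⟨h, hh⟩ := hγ w hw
    obtain ⟨-, h', hq⟩ := hs w hw
    rw [hh, hq]

variable [MulAction (Spheroid n) X]

/-- The action on a level set. -/
def levelSmul (hinv : ∀ (a : Spheroid n) (x : X), μ (a • x) = μ x) (g : Spheroid n)
    (z : LevelSet μ c) : LevelSet μ c := ⟨g • (z : X), (hinv g z).trans z.2⟩

theorem contMDiff_levelSmul (hact : IsSmoothAction d n X)
    (hinv : ∀ (a : Spheroid n) (x : X), μ (a • x) = μ x)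
    (hZ : ∀ z, IsSliceChart d (id : LevelSet μ c → LevelSet μ c)
      (chartAt (EuclideanSpace ℝ (Fin r)) z)) (g : Spheroid n) :
    ContMDiff (𝓡 r) (𝓡 r) ∞ (levelSmul (c := c) hinv g) := fun z =>
  contMDiffAt_of_lift (q := id) continuous_id hZ
    (((hact.contMDiff_smul g).comp (contMDiff_inclusionMap hZ)) z)

omit [TopologicalSpace X] [ChartedSpace (EuclideanSpace ℝ (Fin d)) X]
  [ChartedSpace (EuclideanSpace ℝ (Fin r)) (LevelSet μ c)] [IsManifold (𝓡 r) ∞ (LevelSet μ c)] in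
theorem reductionMap_levelSmul (hinv : ∀ (a : Spheroid n) (x : X), μ (a • x) = μ x) (g : Spheroid n)
    (z : LevelSet μ c) : reductionMap μ c (levelSmul hinv g z) = reductionMap μ c z :=
  reductionMap_eq_iff.2 ⟨g, rfl⟩

variable [ChartedSpace (EuclideanSpace ℝ (Fin k)) (ReducedSpace (n := n) μ c)]
  [IsManifold (𝓡 k) ∞ (ReducedSpace (n := n) μ c)]

/-- A local section, translated by a group element so as to pass through `z`, is still a section,
and its composite with the projection is the inverse of a chart. -/
theorem surjective_mder_reductionMap (hact : IsSmoothAction d n X)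
    (hinv : ∀ (a : Spheroid n) (x : X), μ (a • x) = μ x)
    (hZ : ∀ z, IsSliceChart d (id : LevelSet μ c → LevelSet μ c)
      (chartAt (EuclideanSpace ℝ (Fin r)) z))
    (hQ : ∀ y, IsSliceChart d (reductionMap (n := n) μ c)
      (chartAt (EuclideanSpace ℝ (Fin k)) y)) (z : LevelSet μ c) :
    Function.Surjective (mder (𝓡 r) (𝓡 k) (reductionMap (n := n) μ c) z) := by
  have hq := isOpenQuotientMap_reductionMap (c := c) (fun g => (hact.contMDiff_smul g).continuous) hinv
  obtain ⟨γ, hγ⟩ := exists_section hq.surjective hZ hQ (reductionMap μ c z)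
  set e := chartAt (EuclideanSpace ℝ (Fin k)) (reductionMap (n := n) μ c z)
  have hz : reductionMap (n := n) μ c z ∈ e.source := mem_chart_source _ _
  have ht := e.map_source hz
  obtain ⟨g, hg⟩ : ∃ g : Spheroid n, g • (γ (e (reductionMap μ c z)) : X) = z :=
    reductionMap_eq_iff.1 (by rw [(hγ _ ht).2, e.left_inv hz])
  have hg' : levelSmul hinv g (γ (e (reductionMap μ c z))) = z := Subtype.ext hg
  have hs : ContMDiffAt (𝓡 k) (𝓡 r) ∞ (levelSmul hinv g ∘ γ) (e (reductionMap μ c z)) :=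
    (contMDiff_levelSmul hact hinv hZ g _).comp _ (hγ _ ht).1
  have hqs : ContMDiff (𝓡 r) (𝓡 k) ∞ (reductionMap (n := n) μ c) := fun z =>
    contMDiffAt_of_lift hq.continuous hQ (contMDiff_inclusionMap hZ z)
  have h := fun v => mder_comp_apply (g := reductionMap (n := n) μ c) (f := levelSmul hinv g ∘ γ)
    (e (reductionMap μ c z)) (hqs.mdifferentiable (by simp) _) (hs.mdifferentiableAt (by simp)) v
  have h2 : mder (𝓡 k) (𝓡 k) e.symm (e (reductionMap μ c z)) =
      mder (𝓡 k) (𝓡 k) (reductionMap μ c ∘ (levelSmul hinv g ∘ γ)) (e (reductionMap μ c z)) := by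
    refine mder_congr ?_
    filter_upwards [e.open_target.mem_nhds ht] with w hw
    rw [Function.comp_apply, Function.comp_apply, reductionMap_levelSmul, (hγ w hw).2]
  intro v
  obtain ⟨u, hu⟩ := (bijective_mder_chart_symm _ ht).2 v
  rw [h2, h, Function.comp_apply, hg'] at hu
  exact ⟨_, hu⟩

end SliceManifolds

end Tetraplectic

/-! ### Horizontal forms and their descent to the quotient. -/

namespace Tetraplectic

open Set Filter Topology MeasureTheory Module

section Horizontal

variable {n : ℕ} {V : Type*} [NormedAddCommGroup V] [NormedSpace ℝ V]
  {S : SpheroidLie n →ₗ[ℝ] V} {A : V →ₗ[ℝ] EuclideanSpace ℝ (Fin n)} {ψ : V [⋀^Fin 4]→L[ℝ] ℝ}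

theorem eq_zero_of_horizontal (hor : ∀ β u v w, A u = 0 → A v = 0 → A w = 0 → ψ ![S β, u, v, w] = 0)
    {f : Fin 4 → V} (hf : ∀ a, A (f a) = 0) {a : Fin 4} {β : SpheroidLie n} (ha : f a = S β) :
    ψ f = 0 := by
  have h := ψ.toAlternatingMap.map_perm f (Equiv.swap 0 a)
  have h2 : f ∘ Equiv.swap 0 a = ![S β, f (Equiv.swap 0 a 1), f (Equiv.swap 0 a 2),
      f (Equiv.swap 0 a 3)] := by
    ext1 i
    fin_cases i
    · simp [ha]
    all_goals rfl
  have h3 : ψ.toAlternatingMap (f ∘ Equiv.swap 0 a) = 0 := by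
    rw [h2]
    exact hor β _ _ _ (hf _) (hf _) (hf _)
  rw [h3] at h
  rcases Int.units_eq_one_or (Equiv.Perm.sign (Equiv.swap 0 a)) with hs | hs <;> rw [hs] at h
  · simpa using h.symm
  · simpa using h.symm

/-- The arguments are replaced one at a time; each replacement changes the value by a term with an
orbit vector among its entries. -/
theorem eq_of_sub_mem_range (hor : ∀ β u v w, A u = 0 → A v = 0 → A w = 0 → ψ ![S β, u, v, w] = 0)
    {f f' : Fin 4 → V} (hf : ∀ a, A (f a) = 0) (hf' : ∀ a, A (f' a) = 0)
    (hff : ∀ a, ∃ β, S β = f' a - f a) : ψ f' = ψ f := by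
  have key : ∀ s : Finset (Fin 4), ψ (s.piecewise f' f) = ψ f := by
    intro s
    induction s using Finset.induction_on with
    | empty => simp
    | insert a s has ih =>
      have hk : ∀ i, A (s.piecewise f' f i) = 0 := fun i => by
        by_cases hi : i ∈ s <;> simp [hi, hf, hf']
      obtain ⟨β, hβ⟩ := hff a
      have h1 : f' a = f a + S β := by rw [hβ]; abel
      have h2 : Function.update (s.piecewise f' f) a (f a) = s.piecewise f' f := by
        rw [Function.update_eq_self_iff]; simp [has]
      have h3 : ψ (Function.update (s.piecewise f' f) a (S β)) = 0 := by
        refine eq_zero_of_horizontal hor (a := a) (β := β) (fun i => ?_) (Function.update_self ..)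
        by_cases hi : i = a
        · subst hi
          rw [Function.update_self, hβ, map_sub, hf, hf', sub_zero]
        · rw [Function.update_of_ne hi, hk]
      rw [Finset.piecewise_insert, h1, ψ.map_update_add, h2, ih, h3, add_zero]
  have := key Finset.univ
  rwa [Finset.piecewise_univ] at this

/-- If `ψ^{n+k}` does not vanish, then neither does `ψ^k` on the kernel of `A`. -/
theorem exists_wedgePow_ne_zero [FiniteDimensional ℝ V] {m k : ℕ} (hmk : m = n + k)
    (hV : finrank ℝ V = 4 * m)
    (hS : Function.Injective S) (hA : Function.Surjective A) (hAS : ∀ β, A (S β) = 0)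
    (hor : ∀ β u v w, A u = 0 → A v = 0 → A w = 0 → ψ ![S β, u, v, w] = 0)
    {v : Fin m × Fin 4 → V} (hv : wedgePow ψ m v ≠ 0) :
    ∃ w : Fin k × Fin 4 → V, (∀ i, A (w i) = 0) ∧ wedgePow ψ k w ≠ 0 := by
  -- The splitting gives a basis of `3n` vectors in the range of `S`, `n` transverse to `ker A` and
  -- `4k` more in `ker A`: the three kinds of the counting lemma.
  obtain ⟨Ψ, hΨS, hΨA⟩ := exists_linear_splitting (D := Fin k × Fin 4 → ℝ) S hS A hA hAS (by
    rw [hV, finrank_spheroidLie, finrank_euclideanSpace_fin, finrank_fintype_fun_eq_card]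
    simp [hmk]; ring)
  let bP : Basis (Fin n × Fin 3) ℝ (SpheroidLie n) :=
    (finBasis ℝ (SpheroidLie n)).reindex (Fintype.equivOfCardEq (by
      simp [finrank_spheroidLie, mul_comm]))
  let b := ((bP.prod (EuclideanSpace.basisFun (Fin n) ℝ).toBasis).prod
    (Pi.basisFun ℝ (Fin k × Fin 4))).map Ψ
  have hbP : ∀ p, b (Sum.inl (Sum.inl p)) = S (bP p) := fun p => by
    rw [← hΨS]
    simp only [b, Basis.map_apply]
    congr 1
    ext1 <;> simp
  have hbA : ∀ x, (∀ i, x ≠ Sum.inl (Sum.inr i)) → A (b x) = 0 := fun x hx => by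
    rcases x with (p | i) | q
    · rw [hbP, hAS]
    · exact absurd rfl (hx i)
    · have : b (Sum.inr q) = Ψ ((0, 0), Pi.single q 1) := by
        simp only [b, Basis.map_apply]
        congr 1
        ext1
        · simp; rfl
        · simp
      rw [this, hΨA]
  obtain ⟨ρ, hρ⟩ := exists_wedgePow_ne_zero_of_basis hmk b (fun u ⟨a, p, ha⟩ hu =>
    eq_zero_of_horizontal hor (a := a) (β := bP p) (fun i => hbA _ (hu i)) (by rw [ha, hbP])) hv
  exact ⟨_, fun i => hbA _ (by simp), hρ⟩

end Horizontal

section ReducedForm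

variable {d n r k : ℕ} {X : Type*} [TopologicalSpace X] [ChartedSpace (EuclideanSpace ℝ (Fin d)) X]
  {μ : X → EuclideanSpace ℝ (Fin n)} {c : EuclideanSpace ℝ (Fin n)}
  [ChartedSpace (EuclideanSpace ℝ (Fin r)) (LevelSet μ c)] [IsManifold (𝓡 r) ∞ (LevelSet μ c)]
  [MulAction (Spheroid n) X]

theorem mder_inclusionMap_mem_ker (hμ : ContMDiff (𝓡 d) 𝓘(ℝ, EuclideanSpace ℝ (Fin n)) ∞ μ)
    (hZ : ∀ z, IsSliceChart d (id : LevelSet μ c → LevelSet μ c)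
      (chartAt (EuclideanSpace ℝ (Fin r)) z)) (z : LevelSet μ c) (v : EuclideanSpace ℝ (Fin r)) :
    mder (𝓡 d) 𝓘(ℝ, EuclideanSpace ℝ (Fin n)) μ z (mder (𝓡 r) (𝓡 d) (inclusionMap μ c) z v) = 0 := by
  have h := mder_comp_apply (g := μ) (f := inclusionMap μ c) z (hμ.mdifferentiable (by simp) _)
    ((contMDiff_inclusionMap hZ).mdifferentiable (by simp) z) v
  have h2 : μ ∘ inclusionMap μ c = fun _ => c := funext fun z => z.2
  rw [h2, mder_const] at h
  exact h.symm

/-- The tangent space of the level set lies in the kernel of `dμ`, and both have dimension `r`. -/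
theorem exists_mder_inclusionMap_eq (hμ : ContMDiff (𝓡 d) 𝓘(ℝ, EuclideanSpace ℝ (Fin n)) ∞ μ)
    (hc : IsRegularValue d μ c) (hr : d = n + r)
    (hZ : ∀ z, IsSliceChart d (id : LevelSet μ c → LevelSet μ c)
      (chartAt (EuclideanSpace ℝ (Fin r)) z)) (z : LevelSet μ c) {v : EuclideanSpace ℝ (Fin d)}
    (hv : mder (𝓡 d) 𝓘(ℝ, EuclideanSpace ℝ (Fin n)) μ z v = 0) :
    ∃ u, mder (𝓡 r) (𝓡 d) (inclusionMap μ c) z u = v := by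
  let A := (mder (𝓡 d) 𝓘(ℝ, EuclideanSpace ℝ (Fin n)) μ z).toLinearMap
  let J := (mder (𝓡 r) (𝓡 d) (inclusionMap μ c) z).toLinearMap
  have hA : finrank ℝ (LinearMap.ker A) = r := by
    have h := A.finrank_range_add_finrank_ker
    rw [(LinearMap.range_eq_top (f := A)).2 (hc z z.2), finrank_top, finrank_euclideanSpace_fin,
      finrank_euclideanSpace_fin] at h
    omega
  have hle : LinearMap.range J ≤ LinearMap.ker A := by
    rintro _ ⟨u, rfl⟩
    exact mder_inclusionMap_mem_ker hμ hZ z u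
  have heq : LinearMap.range J = LinearMap.ker A := by
    refine Submodule.eq_of_le_of_finrank_eq hle ?_
    rw [LinearMap.finrank_range_of_inj (injective_mder_inclusionMap hZ z), hA,
      finrank_euclideanSpace_fin]
  have : v ∈ LinearMap.range J := heq ▸ hv
  exact this

variable [ChartedSpace (EuclideanSpace ℝ (Fin k)) (ReducedSpace (n := n) μ c)]
  [IsManifold (𝓡 k) ∞ (ReducedSpace (n := n) μ c)]

/-- The kernel of the derivative of the projection is tangent to the orbits. -/
theorem exists_infAct_eq_of_mder_reductionMap_eq_zero (hact : IsSmoothAction d n X)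
    (hinv : ∀ (a : Spheroid n) (x : X), μ (a • x) = μ x) (hr : r = 3 * n + k)
    (hZ : ∀ z, IsSliceChart d (id : LevelSet μ c → LevelSet μ c)
      (chartAt (EuclideanSpace ℝ (Fin r)) z))
    (hQ : ∀ y, IsSliceChart d (reductionMap (n := n) μ c)
      (chartAt (EuclideanSpace ℝ (Fin k)) y)) {z : LevelSet μ c}
    (hz : Function.Injective (infAct (d := d) (n := n) (z : X))) {u : EuclideanSpace ℝ (Fin r)}
    (hu : mder (𝓡 r) (𝓡 k) (reductionMap (n := n) μ c) z u = 0) :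
    ∃ β : SpheroidLie n, infAct (z : X) β = mder (𝓡 r) (𝓡 d) (inclusionMap μ c) z u := by
  have hq := isOpenQuotientMap_reductionMap (c := c) (fun g => (hact.contMDiff_smul g).continuous) hinv
  have hqs : ContMDiff (𝓡 r) (𝓡 k) ∞ (reductionMap (n := n) μ c) := fun z =>
    contMDiffAt_of_lift hq.continuous hQ (contMDiff_inclusionMap hZ z)
  let o : SpheroidLie n → LevelSet μ c := fun b => levelSmul hinv (spheroidExp b) z
  have ho : ContMDiff 𝓘(ℝ, SpheroidLie n) (𝓡 r) ∞ o := fun b =>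
    contMDiffAt_of_lift (q := id) continuous_id hZ (hact.contMDiff_orbit (z : X) b)
  have ho0 : o 0 = z := Subtype.ext (by simp [o, levelSmul, spheroidExp_zero])
  let T := mder 𝓘(ℝ, SpheroidLie n) (𝓡 r) o 0
  have hTι : ∀ β, mder (𝓡 r) (𝓡 d) (inclusionMap μ c) z (T β) = infAct (z : X) β := fun β => by
    have h := mder_comp_apply (g := inclusionMap μ c) (f := o) (0 : SpheroidLie n)
      ((contMDiff_inclusionMap hZ).mdifferentiable (by simp) _) (ho.mdifferentiable (by simp) 0) β
    rw [ho0] at h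
    exact h.symm
  have hTq : ∀ β, mder (𝓡 r) (𝓡 k) (reductionMap (n := n) μ c) z (T β) = 0 := fun β => by
    have h := mder_comp_apply (g := reductionMap (n := n) μ c) (f := o) (0 : SpheroidLie n)
      (hqs.mdifferentiable (by simp) _) (ho.mdifferentiable (by simp) 0) β
    have h2 : reductionMap μ c ∘ o = fun _ => reductionMap μ c z :=
      funext fun b => reductionMap_levelSmul hinv _ z
    rw [h2, mder_const, ho0] at h
    exact h.symm
  have hTi : Function.Injective T := fun a b hab => hz (by rw [← hTι, ← hTι, hab])
  let Dπ := (mder (𝓡 r) (𝓡 k) (reductionMap (n := n) μ c) z).toLinearMap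
  have hker : finrank ℝ (LinearMap.ker Dπ) = 3 * n := by
    have h := Dπ.finrank_range_add_finrank_ker
    rw [(LinearMap.range_eq_top (f := Dπ)).2 (surjective_mder_reductionMap hact hinv hZ hQ z), finrank_top,
      finrank_euclideanSpace_fin, finrank_euclideanSpace_fin] at h
    omega
  have heq : LinearMap.range T.toLinearMap = LinearMap.ker Dπ := by
    refine Submodule.eq_of_le_of_finrank_eq ?_ ?_
    · rintro _ ⟨β, rfl⟩
      exact hTq β
    · rw [LinearMap.finrank_range_of_inj hTi, hker, finrank_spheroidLie]
  obtain ⟨β, rfl⟩ : u ∈ LinearMap.range T.toLinearMap := heq ▸ hu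
  exact ⟨β, (hTι β).symm⟩

/-- At one point of the fibre the form is defined through a linear right inverse of the projection's
derivative; horizontality makes the choice immaterial, and invariance carries the identity to the
rest of the fibre. -/
theorem exists_reduced_form_at (hact : IsSmoothAction d n X) {ψ : DForm d 4 X}
    (hψi : IsInvariantForm (n := n) ψ) (hμ : ContMDiff (𝓡 d) 𝓘(ℝ, EuclideanSpace ℝ (Fin n)) ∞ μ)
    (hinv : ∀ (a : Spheroid n) (x : X), μ (a • x) = μ x) (hhor : IsHorizontalOn ψ μ c)
    (hr : r = 3 * n + k)
    (hZ : ∀ z, IsSliceChart d (id : LevelSet μ c → LevelSet μ c)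
      (chartAt (EuclideanSpace ℝ (Fin r)) z))
    (hQ : ∀ y, IsSliceChart d (reductionMap (n := n) μ c)
      (chartAt (EuclideanSpace ℝ (Fin k)) y))
    (hfree : ∀ z : X, μ z = c → Function.Injective (infAct (d := d) (n := n) z))
    (y : ReducedSpace (n := n) μ c) :
    ∃ η : EuclideanSpace ℝ (Fin k) [⋀^Fin 4]→L[ℝ] ℝ, ∀ z, reductionMap μ c z = y →
      ∀ v : Fin 4 → EuclideanSpace ℝ (Fin r),
        η (fun i => mder (𝓡 r) (𝓡 k) (reductionMap (n := n) μ c) z (v i)) =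
          formAt ψ (z : X) fun i => mder (𝓡 r) (𝓡 d) (inclusionMap μ c) z (v i) := by
  have hq := isOpenQuotientMap_reductionMap (c := c) (fun g => (hact.contMDiff_smul g).continuous) hinv
  have hqs : ContMDiff (𝓡 r) (𝓡 k) ∞ (reductionMap (n := n) μ c) := fun z =>
    contMDiffAt_of_lift hq.continuous hQ (contMDiff_inclusionMap hZ z)
  obtain ⟨z₁, rfl⟩ := hq.surjective y
  set Dπ := mder (𝓡 r) (𝓡 k) (reductionMap (n := n) μ c) z₁
  set J := mder (𝓡 r) (𝓡 d) (inclusionMap μ c) z₁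
  obtain ⟨R, hR⟩ := Dπ.toLinearMap.exists_rightInverse_of_surjective
    (LinearMap.range_eq_top.2 (surjective_mder_reductionMap hact hinv hZ hQ z₁))
  have hR' : ∀ w, Dπ (R w) = w := fun w => LinearMap.congr_fun hR w
  refine ⟨(formAt ψ (z₁ : X)).compContinuousLinearMap (J.comp (LinearMap.toContinuousLinearMap R)),
    fun z hz v => ?_⟩
  obtain ⟨g, hg⟩ := reductionMap_eq_iff.1 hz.symm
  have hg' : levelSmul hinv g z = z₁ := Subtype.ext hg
  let u : Fin 4 → EuclideanSpace ℝ (Fin r) := fun i => mder (𝓡 r) (𝓡 r) (levelSmul hinv g) z (v i)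
  have hG := (contMDiff_levelSmul hact hinv hZ g).mdifferentiable (by simp) z
  have hu1 : ∀ i, Dπ (u i) = mder (𝓡 r) (𝓡 k) (reductionMap (n := n) μ c) z (v i) := fun i => by
    have h := mder_comp_apply (g := reductionMap (n := n) μ c) z (hqs.mdifferentiable (by simp) _)
      hG (v i)
    rw [hg'] at h
    rw [← h]
    congr 2
    exact funext fun z => (reductionMap_levelSmul hinv g z)
  have hu2 : ∀ i, J (u i) = mder (𝓡 d) (𝓡 d) (fun x : X => g • x) z
      (mder (𝓡 r) (𝓡 d) (inclusionMap μ c) z (v i)) := fun i => by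
    have h := mder_comp_apply (g := inclusionMap μ c) z
      ((contMDiff_inclusionMap hZ).mdifferentiable (by simp) _) hG (v i)
    have h' := mder_comp_apply (g := fun x : X => g • x) (f := inclusionMap μ c) z
      ((hact.contMDiff_smul g).mdifferentiable (by simp) _)
      ((contMDiff_inclusionMap hZ).mdifferentiable (by simp) z) (v i)
    rw [hg'] at h
    exact h.symm.trans h'
  rw [← hψi.apply g (z : X), hg]
  simp only [← hu1, ← hu2]
  refine eq_of_sub_mem_range (S := (infAct (d := d) (n := n) (z₁ : X)).toLinearMap)
    (A := (mder (𝓡 d) 𝓘(ℝ, EuclideanSpace ℝ (Fin n)) μ z₁).toLinearMap) ?_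
    (fun a => mder_inclusionMap_mem_ker hμ hZ z₁ _) (fun a => mder_inclusionMap_mem_ker hμ hZ z₁ _)
    fun a => ?_
  · intro β a b e ha hb he
    have h := hhor z₁ z₁.2 β a b e ha hb he
    rw [hact.fundField_eq] at h
    exact h
  · obtain ⟨β, hβ⟩ := exists_infAct_eq_of_mder_reductionMap_eq_zero hact hinv hr hZ hQ
      (hfree z₁ z₁.2) (u := R (Dπ (u a)) - u a) (by
        change Dπ _ = 0
        rw [map_sub, hR', sub_self])
    refine ⟨β, hβ.trans ?_⟩
    rw [map_sub]
    rfl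

/-- In a chart, a form on the reduced space that pulls back to the restriction of `ψ` is the
pullback of `ψ` along a smooth section. -/
theorem exists_inChart_eq_pullAlong (hact : IsSmoothAction d n X) {ψ : DForm d 4 X}
    (hinv : ∀ (a : Spheroid n) (x : X), μ (a • x) = μ x)
    (hZ : ∀ z, IsSliceChart d (id : LevelSet μ c → LevelSet μ c)
      (chartAt (EuclideanSpace ℝ (Fin r)) z))
    (hQ : ∀ y, IsSliceChart d (reductionMap (n := n) μ c)
      (chartAt (EuclideanSpace ℝ (Fin k)) y))
    {η : DForm k 4 (ReducedSpace (n := n) μ c)}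
    (hη : ∀ (z : LevelSet μ c) (v : Fin 4 → EuclideanSpace ℝ (Fin r)),
        formAt η (reductionMap μ c z)
          (fun i => mder (𝓡 r) (𝓡 k) (reductionMap (n := n) μ c) z (v i)) =
          formAt ψ (z : X) fun i => mder (𝓡 r) (𝓡 d) (inclusionMap μ c) z (v i))
    (y : ReducedSpace (n := n) μ c) :
    ∃ s : EuclideanSpace ℝ (Fin k) → X, ∀ w ∈ (chartAt (EuclideanSpace ℝ (Fin k)) y).target,
      ContMDiffAt (𝓡 k) (𝓡 d) ∞ s w ∧ η.inChart y w = pullAlong s ψ w := by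
  have hq := isOpenQuotientMap_reductionMap (c := c) (fun g => (hact.contMDiff_smul g).continuous) hinv
  have hqs : ContMDiff (𝓡 r) (𝓡 k) ∞ (reductionMap (n := n) μ c) := fun z =>
    contMDiffAt_of_lift hq.continuous hQ (contMDiff_inclusionMap hZ z)
  obtain ⟨γ, hγ⟩ := exists_section hq.surjective hZ hQ y
  set e := chartAt (EuclideanSpace ℝ (Fin k)) y
  refine ⟨inclusionMap μ c ∘ γ, fun w hw => ⟨(contMDiff_inclusionMap hZ _).comp w (hγ w hw).1, ?_⟩⟩
  have hγd := (hγ w hw).1.mdifferentiableAt (by simp)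
  have hev : e.symm =ᶠ[𝓝 w] reductionMap μ c ∘ γ := by
    filter_upwards [e.open_target.mem_nhds hw] with w' hw' using (hγ w' hw').2.symm
  rw [inChart_eq_pullAlong, pullAlong_congr η hev]
  ext v
  rw [pullAlong_apply, pullAlong_apply]
  have h1 := fun i => mder_comp_apply (g := reductionMap (n := n) μ c) w
    (hqs.mdifferentiable (by simp) _) hγd (v i)
  have h2 := fun i => mder_comp_apply (g := inclusionMap μ c) w
    ((contMDiff_inclusionMap hZ).mdifferentiable (by simp) _) hγd (v i)
  simp only [h1, h2]
  exact hη (γ w) _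

end ReducedForm

end Tetraplectic

/-! ### Tetraplectic reduction. -/

namespace Tetraplectic

open Set Filter Topology MeasureTheory Module

section Reduction

variable {m n r k : ℕ} {X : Type*} [TopologicalSpace X]
  [ChartedSpace (EuclideanSpace ℝ (Fin (4 * m))) X] [IsManifold (𝓡 (4 * m)) ∞ X]
  {μ : X → EuclideanSpace ℝ (Fin n)} {c : EuclideanSpace ℝ (Fin n)} [MulAction (Spheroid n) X]

omit [IsManifold (𝓡 (4 * m)) ∞ X] in
-- The `3n` independent orbit directions lie in the kernel of `dμ`, of dimension `4m - n`.
theorem le_of_injective_infAct (hact : IsSmoothAction (4 * m) n X)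
    (hμ : ContMDiff (𝓡 (4 * m)) 𝓘(ℝ, EuclideanSpace ℝ (Fin n)) ∞ μ)
    (hinv : ∀ (a : Spheroid n) (x : X), μ (a • x) = μ x) {z : X}
    (hz : Function.Surjective (tangentMap (d := 4 * m) μ z))
    (hi : Function.Injective (infAct (d := 4 * m) (n := n) z)) : n ≤ m := by
  let A := (mder (𝓡 (4 * m)) 𝓘(ℝ, EuclideanSpace ℝ (Fin n)) μ z).toLinearMap
  let S := (infAct (d := 4 * m) (n := n) z).toLinearMap
  have h1 := A.finrank_range_add_finrank_ker
  rw [(LinearMap.range_eq_top (f := A)).2 hz, finrank_top, finrank_euclideanSpace_fin,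
    finrank_euclideanSpace_fin] at h1
  have h2 : LinearMap.range S ≤ LinearMap.ker A := by
    rintro _ ⟨β, rfl⟩
    exact tangentMap_infAct hact hμ hinv z β
  have h3 := Submodule.finrank_mono h2
  rw [LinearMap.finrank_range_of_inj hi, finrank_spheroidLie] at h3
  omega

variable [ChartedSpace (EuclideanSpace ℝ (Fin r)) (LevelSet μ c)] [IsManifold (𝓡 r) ∞ (LevelSet μ c)]
  [ChartedSpace (EuclideanSpace ℝ (Fin (4 * k))) (ReducedSpace (n := n) μ c)]
  [IsManifold (𝓡 (4 * k)) ∞ (ReducedSpace (n := n) μ c)]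

/-- Smoothness and closedness are local, and in a chart `η` is the pullback of `ψ` along a smooth
section. Nonvanishing of the volume form comes from `exists_wedgePow_ne_zero`, whose vectors in `ker
dμ` lift to the level set. -/
theorem isTetraplectic_of_pullback (hact : IsSmoothAction (4 * m) n X) {ψ : DForm (4 * m) 4 X}
    (hψ : IsTetraplectic ψ) (hμ : ContMDiff (𝓡 (4 * m)) 𝓘(ℝ, EuclideanSpace ℝ (Fin n)) ∞ μ)
    (hinv : ∀ (a : Spheroid n) (x : X), μ (a • x) = μ x) (hc : IsRegularValue (4 * m) μ c)
    (hhor : IsHorizontalOn ψ μ c)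
    (hr : ∀ _ : LevelSet μ c, m = n + k ∧ 4 * m = n + r)
    (hZ : ∀ z, IsSliceChart (4 * m) (id : LevelSet μ c → LevelSet μ c)
      (chartAt (EuclideanSpace ℝ (Fin r)) z))
    (hQ : ∀ y, IsSliceChart (4 * m) (reductionMap (n := n) μ c)
      (chartAt (EuclideanSpace ℝ (Fin (4 * k))) y))
    (hfree : ∀ z : X, μ z = c → Function.Injective (infAct (d := 4 * m) (n := n) z))
    {η : DForm (4 * k) 4 (ReducedSpace (n := n) μ c)}
    (hη : ∀ (z : LevelSet μ c) (v : Fin 4 → EuclideanSpace ℝ (Fin r)),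
        formAt η (reductionMap μ c z)
          (fun i => mder (𝓡 r) (𝓡 (4 * k)) (reductionMap (n := n) μ c) z (v i)) =
          formAt ψ (z : X) fun i => mder (𝓡 r) (𝓡 (4 * m)) (inclusionMap μ c) z (v i)) :
    IsTetraplectic η where
  smooth y w hw := by
    obtain ⟨s, hs⟩ := exists_inChart_eq_pullAlong hact hinv hZ hQ hη y
    have ht : ∀ᶠ w' in 𝓝 w, w' ∈ (chartAt (EuclideanSpace ℝ (Fin (4 * k))) y).target :=
      (chartAt (EuclideanSpace ℝ (Fin (4 * k))) y).open_target.mem_nhds hw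
    refine ContDiffAt.contDiffWithinAt ?_
    exact (contDiffAt_pullAlong (ht.mono fun w' hw' => (hs w' hw').1)
      hψ.smooth).congr_of_eventuallyEq (ht.mono fun w' hw' => (hs w' hw').2)
  closed y w hw := by
    obtain ⟨s, hs⟩ := exists_inChart_eq_pullAlong hact hinv hZ hQ hη y
    have ht : ∀ᶠ w' in 𝓝 w, w' ∈ (chartAt (EuclideanSpace ℝ (Fin (4 * k))) y).target :=
      (chartAt (EuclideanSpace ℝ (Fin (4 * k))) y).open_target.mem_nhds hw
    have he : η.inChart y =ᶠ[𝓝 w] pullAlong s ψ := ht.mono fun w' hw' => (hs w' hw').2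
    rw [he.extDeriv_eq]
    exact extDeriv_pullAlong (ht.mono fun w' hw' => (hs w' hw').1) hψ.smooth hψ.closed
  volume y := by
    obtain ⟨z, rfl⟩ := Quotient.mk_surjective y
    obtain ⟨hmk, hdr⟩ := hr z
    obtain ⟨v, hv⟩ := hψ.volume (z : X)
    obtain ⟨w, hw, hw0⟩ := exists_wedgePow_ne_zero (V := EuclideanSpace ℝ (Fin (4 * m)))
      (ψ := formAt ψ (z : X)) (S := (infAct (d := 4 * m) (n := n) (z : X)).toLinearMap)
      (A := (mder (𝓡 (4 * m)) 𝓘(ℝ, EuclideanSpace ℝ (Fin n)) μ z).toLinearMap) hmk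
      finrank_euclideanSpace_fin (hfree z z.2) (hc z z.2) (tangentMap_infAct hact hμ hinv z)
      (fun β a b e ha hb he => by
        have h := hhor z z.2 β a b e ha hb he
        rw [hact.fundField_eq] at h
        exact h) hv
    choose u hu using fun i => exists_mder_inclusionMap_eq hμ hc hdr hZ z (hw i)
    refine ⟨fun i => mder (𝓡 r) (𝓡 (4 * k)) (reductionMap (n := n) μ c) z (u i), ?_⟩
    refine ne_of_eq_of_ne ?_ hw0
    unfold wedgePow
    congr 1
    refine Finset.sum_congr rfl fun σ _ => ?_
    congr 1
    refine Finset.prod_congr rfl fun i _ => ?_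
    refine (hη z fun a => u (σ (i, a))).trans ?_
    simp only [hu]

end Reduction

end Tetraplectic

theorem mainTheorem1 {m n : ℕ} {X : Type*} [TopologicalSpace X] [T2Space X]
    [SecondCountableTopology X] [ChartedSpace (EuclideanSpace ℝ (Fin (4 * m))) X]
    [IsManifold (𝓡 (4 * m)) ∞ X] [MulAction (Tetraplectic.Spheroid n) X]
    (hact : Tetraplectic.IsSmoothAction (4 * m) n X)
    (ψ : Tetraplectic.DForm (4 * m) 4 X) (hψ : Tetraplectic.IsTetraplectic ψ)
    (hinv : Tetraplectic.IsInvariantForm (n := n) ψ)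
    (μ : X → EuclideanSpace ℝ (Fin n)) (hμ : Tetraplectic.IsTriMomentumMap ψ μ)
    (c : EuclideanSpace ℝ (Fin n)) (hc : Tetraplectic.IsRegularValue (4 * m) μ c)
    (hstab : Tetraplectic.StabilizersFormSpheroidBundle (d := 4 * m) μ c)
    (hhor : Tetraplectic.IsHorizontalOn ψ μ c) :
    -- `Z = μ⁻¹(c)` is an embedded submanifold of `X` (of codimension `n`)
    ∃ _ : ChartedSpace (EuclideanSpace ℝ (Fin (4 * m - n))) (Tetraplectic.LevelSet μ c),
      IsManifold (𝓡 (4 * m - n)) ∞ (Tetraplectic.LevelSet μ c) ∧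
      ContMDiff (𝓡 (4 * m - n)) (𝓡 (4 * m)) ∞ (Tetraplectic.inclusionMap μ c) ∧
      (∀ z : Tetraplectic.LevelSet μ c, Function.Injective
        (mfderiv (𝓡 (4 * m - n)) (𝓡 (4 * m)) (Tetraplectic.inclusionMap μ c) z)) ∧
      -- the quotient `Y = Z / Σⁿ` is a smooth manifold, with `Z → Y` a smooth submersion
      ∃ (k : ℕ) (_ : ChartedSpace (EuclideanSpace ℝ (Fin (4 * k)))
          (Tetraplectic.ReducedSpace μ c)),
        T2Space (Tetraplectic.ReducedSpace μ c) ∧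
        SecondCountableTopology (Tetraplectic.ReducedSpace μ c) ∧
        IsManifold (𝓡 (4 * k)) ∞ (Tetraplectic.ReducedSpace μ c) ∧
        ContMDiff (𝓡 (4 * m - n)) (𝓡 (4 * k)) ∞ (Tetraplectic.reductionMap μ c) ∧
        (∀ z : Tetraplectic.LevelSet μ c, Function.Surjective
          (mfderiv (𝓡 (4 * m - n)) (𝓡 (4 * k)) (Tetraplectic.reductionMap μ c) z)) ∧
        -- and `ψ` descends to a tetraplectic structure on `Y`
        ∃ ψY : Tetraplectic.DForm (4 * k) 4 (Tetraplectic.ReducedSpace μ c),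
          Tetraplectic.IsTetraplectic ψY ∧
          (ψY.pullback (Tetraplectic.reductionMap μ c) :
              Tetraplectic.DForm (4 * m - n) 4 (Tetraplectic.LevelSet μ c)) =
            ψ.pullback (Tetraplectic.inclusionMap μ c) := by
  open Tetraplectic in
  have hfree : ∀ z : X, μ z = c → ∀ g : Spheroid n, g • z = z → g = 1 := fun z hz g hg =>
    eq_one_of_smul_eq hact hψ.smooth hψ.closed hinv hμ hc hstab hz hg
  have hinj : ∀ z : X, μ z = c → Function.Injective (infAct (d := 4 * m) (n := n) z) :=
    fun z hz => hact.injective_infAct (hfree z hz)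
  -- The inequality needs a point of the level set. If there is none, `m - n` may be a truncated
  -- difference, but then both manifolds are empty and the dimensions are immaterial.
  have hnm : ∀ _ : LevelSet μ c, n ≤ m := fun z =>
    le_of_injective_infAct hact hμ.smooth hμ.invariant (hc z z.2) (hinj z z.2)
  obtain ⟨cZ, mZ, hZ⟩ := exists_chartedSpace (exists_isSliceChart_levelSet hμ.smooth hc)
  obtain ⟨cY, mY, hY⟩ := exists_chartedSpace (r := 4 * (m - n))
    (q := reductionMap (n := n) μ c) fun y => by
      obtain ⟨z, rfl⟩ := Quotient.mk_surjective y
      have := hnm z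
      exact exists_isSliceChart_reducedSpace hact hμ.smooth hμ.invariant hc hfree (by omega) _
  have hq := isOpenQuotientMap_reductionMap (c := c)
    (fun g => (hact.contMDiff_smul g).continuous) hμ.invariant
  have hex : ∀ y : ReducedSpace (n := n) μ c,
      ∃ η : EuclideanSpace ℝ (Fin (4 * (m - n))) [⋀^Fin 4]→L[ℝ] ℝ, ∀ z, reductionMap μ c z = y →
        ∀ v : Fin 4 → EuclideanSpace ℝ (Fin (4 * m - n)),
        η (fun i => mder (𝓡 (4 * m - n)) (𝓡 (4 * (m - n))) (reductionMap (n := n) μ c) z (v i)) =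
          formAt ψ (z : X)
            fun i => mder (𝓡 (4 * m - n)) (𝓡 (4 * m)) (inclusionMap μ c) z (v i) := fun y => by
    obtain ⟨z, hz⟩ := Quotient.mk_surjective y
    have := hnm z
    exact exists_reduced_form_at hact hinv hμ.smooth hμ.invariant hhor (by omega) hZ hY hinj y
  choose η hη using hex
  refine ⟨cZ, mZ, contMDiff_inclusionMap hZ, injective_mder_inclusionMap hZ, m - n, cY,
    t2Space_reducedSpace hact hμ.invariant, secondCountable_reducedSpace hact hμ.invariant, mY,
    fun z => contMDiffAt_of_lift hq.continuous hY (contMDiff_inclusionMap hZ z),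
    surjective_mder_reductionMap hact hμ.invariant hZ hY, η, ?_, ?_⟩
  · refine isTetraplectic_of_pullback hact hψ hμ.smooth hμ.invariant hc hhor (fun z => ?_) hZ hY hinj
      fun z => hη _ z rfl
    have := hnm z
    omega
  · ext z v
    exact hη _ z rfl v
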